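/- Let $R$ be a commutative unital ring. **The category.** Let $\mathbf{uCob}_R(\emptyset)$ be the $R$-linear symmetric monoidal category (under disjoint union $\amalg$) whose objects are finite collections of numbered v-circles (circles immersed in the plane, with virtual crossings only), and whose morphisms are $R$-linear combinations of cobordisms, considered as abstract surfaces with boundary, generated by the cap $\iota\colon\emptyset\to\bigcirc$, the cup $\varepsilon\colon\bigcirc\to\emptyset$, the cylinders $\mathrm{Id}$ and $\Phi$, the permutation $\tau$, the pantsup $m$, the pantsdown $\Delta$ (all orientable generators with only positive boundary decorations, except that the upper decoration of $\Phi$ is negative), and the two times punctured projective plane $\theta$, subject to the following relations: $\tau$ is the symmetry of the monoidal structure; $(m,\iota,\Delta,\varepsilon)$ satisfy (co)associativity, (co)commutativity, the (co)unit relations and the Frobenius relation; and $$\Phi\Phi=\mathrm{Id},\quad \Phi\iota=\iota,\quad \varepsilon\Phi=-\varepsilon,\quad \Phi m=m(\Phi\amalg\Phi),\quad \Delta\Phi=-(\Phi\amalg\Phi)\Delta,$$ $$\theta\Phi=\Phi\theta=\theta=-\theta,\quad \theta m=m(\theta\amalg\mathrm{Id}),\quad \Delta\theta=(\theta\amalg\mathrm{Id})\Delta,\quad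 m(\Phi\amalg\mathrm{Id})\Delta=\theta\theta.$$ **Resolutions and choices.** Let $L_D$ be an oriented virtual link diagram with $n$ ordered classical crossings, of which $n_-$ are negative. For $a\in\{0,1\}^n$ let $\gamma_a$ be the resolution of $L_D$ in which the $i$-th crossing is resolved in the way $a_i$, with $|a|=\sum_i a_i$. Here, for a crossing drawn such that the strand from the lower left to the upper right is on top, the $0$-resolution consists of a left and a right string and the $1$-resolution of a lower and an upper string. Choose for every crossing one of the two rotations which bring it into this position, and choose for every $\gamma_a$ an orientation of its v-circles and a numbering of its v-circles. **The saddles.** If $b$ arises from $a$ by changing the $r$-th letter from $0$ to $1$, there is a saddle $\gamma_a\to\gamma_b$. It is $m$ (two v-circles merge), $\Delta$ (one v-circle splits) or $\theta$ (one v-circle goes to one v-circle), together with cylinders on the unaffected v-circles. *Decorations.* A cylinder is $\mathrm{Id}$ if the orientations of its v-circle in $\gamma_a$ and $\gamma_b$ agree, and $\Phi$ otherwise. In the cases $m$ and $\Delta$ the saddle is composed with $\Phi$ at each of its three boundary circles where the chosen orientation of the string does not agree with the reference orientation: left string down, right string up, lower string to the left, upper string to the right. *Sign.* In the cases $m$ and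 $\Delta$ the saddle is moreover multiplied by the saddle sign, defined as follows. Let $\gamma$ be the one of $\gamma_a,\gamma_b$ with more v-circles, say $k$, and $\gamma'$ the other one. The numbering of $\gamma'$ induces one of $\gamma$: unaffected v-circles keep their numbers; of the two remaining v-circles the one through the left string (case $m$) or the lower string (case $\Delta$) gets the number in $\gamma'$ of the affected v-circle, and the other one gets the number $k$. The saddle sign is the sign of the permutation between the chosen and the induced numbering of $\gamma$. **The complexes.** Let $[\![L_D]\!]$ be the sequence of objects and morphisms of the category $\mathrm{Mat}(\mathbf{uCob}_R(\emptyset))$ of formal matrices (the additive closure) whose object in degree $i-n_-$ is $\bigoplus_{|a|=i}\gamma_a$ and whose differentials are the matrices of these decorated and signed saddles. Let $[\![L_D]\!]_c$ be the classical Khovanov complex: it has the same objects, and its saddles consist of $m$, $\Delta$ and $\mathrm{Id}$ (without $\Phi$; and of $\theta$, for a saddle from one v-circle to one v-circle), multiplied by the classical sign $(-1)^{a_1+\dots+a_{r-1}}$. **Theorem.** Let $L_D$ be an oriented classical link diagram, that is, a diagram without virtual crossings. For all choices above (where the numberings of the v-circles used for $[\![L_D]\!]_c$ may differ from those used for $[\![L_D]\!]$),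 both $[\![L_D]\!]$ and $[\![L_D]\!]_c$ are cochain complexes, and they are isomorphic as cochain complexes over $\mathrm{Mat}(\mathbf{uCob}_R(\emptyset))$. -/

import Mathlib

open CategoryTheory

noncomputable section

namespace VKh

universe u

/-! ## Decorated cobordisms between finite families of circles -/

/-- Formal words in the generating cobordisms, from a family of circles indexed by `A` (top) to a
family of circles indexed by `B` (bottom). All compositions are in diagrammatic order.

* `cyl e w` is a disjoint union of cylinders joining the top circle `a` to the bottom circle `e a`;
  the cylinder at `a` is `Φ⁻₊` if `w a = true` and `Id⁺₊` if `w a = false`. Thus the identities, `Φ⁻₊`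
  and the permutation cobordism `τ` are of this form, and every `cyl e w` is generated by them.
* `cap` is `ι₊ : ∅ → ○`, `cup` is `ε⁺ : ○ → ∅`, `mul` is the pantsup `m⁺⁺₊`, `comul` is the
  pantsdown `Δ⁺₊₊`, and `theta` is the two times punctured projective plane.
* `tensor` is the disjoint union. -/
inductive CobWord (R : Type u) : Type → Type → Type (max u 1)
  | cyl {A B : Type} (e : A ≃ B) (w : A → Bool) : CobWord R A B
  | cap : CobWord R Empty Unit
  | cup : CobWord R Unit Empty
  | mul : CobWord R (Unit ⊕ Unit) Unit
  | comul : CobWord R Unit (Unit ⊕ Unit)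
  | theta : CobWord R Unit Unit
  | comp {A B C : Type} [Finite B] (f : CobWord R A B) (g : CobWord R B C) : CobWord R A C
  | tensor {A B A' B' : Type} (f : CobWord R A B) (g : CobWord R A' B') :
      CobWord R (A ⊕ A') (B ⊕ B')
  | zero {A B : Type} : CobWord R A B
  | add {A B : Type} (f g : CobWord R A B) : CobWord R A B
  | smul {A B : Type} (r : R) (f : CobWord R A B) : CobWord R A B

namespace CobWord

variable {R : Type u}

/-- Undecorated cylinders permuting the circles. -/
abbrev perm {A B : Type} (e : A ≃ B) : CobWord R A B := cyl e fun _ => false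

/-- The identity, a union of cylinders `Id⁺₊`. -/
abbrev ident (A : Type) : CobWord R A A := perm (Equiv.refl A)

/-- The cylinder `Φ⁻₊`. -/
abbrev phi : CobWord R Unit Unit := cyl (Equiv.refl Unit) fun _ => true

end CobWord

open CobWord in
/-- The relations between decorated cobordisms. -/
inductive CobRel (R : Type u) [CommRing R] :
    ∀ {A B : Type}, CobWord R A B → CobWord R A B → Prop
  -- equivalence relation, compatible with all operations
  | refl {A B : Type} (f : CobWord R A B) : CobRel R f f
  | symm {A B : Type} {f g : CobWord R A B} : CobRel R f g → CobRel R g f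
  | trans {A B : Type} {f g h : CobWord R A B} : CobRel R f g → CobRel R g h → CobRel R f h
  | comp_congr {A B C : Type} [Finite B] {f f' : CobWord R A B} {g g' : CobWord R B C} :
      CobRel R f f' → CobRel R g g' → CobRel R (comp f g) (comp f' g')
  | tensor_congr {A B A' B' : Type} {f f' : CobWord R A B} {g g' : CobWord R A' B'} :
      CobRel R f f' → CobRel R g g' → CobRel R (tensor f g) (tensor f' g')
  | add_congr {A B : Type} {f f' g g' : CobWord R A B} :
      CobRel R f f' → CobRel R g g' → CobRel R (add f g) (add f' g')
  | smul_congr {A B : Type} (r : R) {f f' : CobWord R A B} :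
      CobRel R f f' → CobRel R (smul r f) (smul r f')
  -- the morphisms form `R`-modules
  | add_comm {A B : Type} (f g : CobWord R A B) : CobRel R (add f g) (add g f)
  | add_assoc {A B : Type} (f g h : CobWord R A B) :
      CobRel R (add (add f g) h) (add f (add g h))
  | zero_add {A B : Type} (f : CobWord R A B) : CobRel R (add zero f) f
  | zero_smul {A B : Type} (f : CobWord R A B) : CobRel R (smul 0 f) zero
  | one_smul {A B : Type} (f : CobWord R A B) : CobRel R (smul 1 f) f
  | mul_smul {A B : Type} (r s : R) (f : CobWord R A B) :
      CobRel R (smul (r * s) f) (smul r (smul s f))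
  | add_smul {A B : Type} (r s : R) (f : CobWord R A B) :
      CobRel R (smul (r + s) f) (add (smul r f) (smul s f))
  | smul_add {A B : Type} (r : R) (f g : CobWord R A B) :
      CobRel R (smul r (add f g)) (add (smul r f) (smul r g))
  -- composition and disjoint union are `R`-bilinear
  | add_comp {A B C : Type} [Finite B] (f f' : CobWord R A B) (g : CobWord R B C) :
      CobRel R (comp (add f f') g) (add (comp f g) (comp f' g))
  | comp_add {A B C : Type} [Finite B] (f : CobWord R A B) (g g' : CobWord R B C) :
      CobRel R (comp f (add g g')) (add (comp f g) (comp f g'))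
  | smul_comp {A B C : Type} [Finite B] (r : R) (f : CobWord R A B) (g : CobWord R B C) :
      CobRel R (comp (smul r f) g) (smul r (comp f g))
  | comp_smul {A B C : Type} [Finite B] (r : R) (f : CobWord R A B) (g : CobWord R B C) :
      CobRel R (comp f (smul r g)) (smul r (comp f g))
  | add_tensor {A B A' B' : Type} (f f' : CobWord R A B) (g : CobWord R A' B') :
      CobRel R (tensor (add f f') g) (add (tensor f g) (tensor f' g))
  | tensor_add {A B A' B' : Type} (f : CobWord R A B) (g g' : CobWord R A' B') :
      CobRel R (tensor f (add g g')) (add (tensor f g) (tensor f g'))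
  | smul_tensor {A B A' B' : Type} (r : R) (f : CobWord R A B) (g : CobWord R A' B') :
      CobRel R (tensor (smul r f) g) (smul r (tensor f g))
  | tensor_smul {A B A' B' : Type} (r : R) (f : CobWord R A B) (g : CobWord R A' B') :
      CobRel R (tensor f (smul r g)) (smul r (tensor f g))
  -- category
  | comp_assoc {A B C D : Type} [Finite B] [Finite C] (f : CobWord R A B) (g : CobWord R B C)
      (h : CobWord R C D) : CobRel R (comp (comp f g) h) (comp f (comp g h))
  | id_comp {A B : Type} [Finite A] (f : CobWord R A B) : CobRel R (comp (ident A) f) f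
  | comp_id {A B : Type} [Finite B] (f : CobWord R A B) : CobRel R (comp f (ident B)) f
  -- symmetric monoidal category under disjoint union
  | tensor_comp {A B C A' B' C' : Type} [Finite B] [Finite B'] (f : CobWord R A B)
      (g : CobWord R B C) (f' : CobWord R A' B') (g' : CobWord R B' C') :
      CobRel R (tensor (comp f g) (comp f' g')) (comp (tensor f f') (tensor g g'))
  | assoc_natural {A B A' B' A'' B'' : Type} [Finite (A ⊕ (A' ⊕ A''))] [Finite ((B ⊕ B') ⊕ B'')]
      (f : CobWord R A B) (f' : CobWord R A' B') (f'' : CobWord R A'' B'') :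
      CobRel R (comp (tensor (tensor f f') f'') (perm (Equiv.sumAssoc B B' B'')))
        (comp (perm (Equiv.sumAssoc A A' A'')) (tensor f (tensor f' f'')))
  | swap_natural {A B A' B' : Type} [Finite (A' ⊕ A)] [Finite (B ⊕ B')]
      (f : CobWord R A B) (f' : CobWord R A' B') :
      CobRel R (comp (tensor f f') (perm (Equiv.sumComm B B')))
        (comp (perm (Equiv.sumComm A A')) (tensor f' f))
  | unit_natural {A B : Type} [Finite A] [Finite B] (f : CobWord R A B) :
      CobRel R (comp (tensor f (ident Empty)) (perm (Equiv.sumEmpty B Empty)))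
        (comp (perm (Equiv.sumEmpty A Empty)) f)
  -- gluing and disjoint union of cylinders (this contains `Φ⁻₊ ∘ Φ⁻₊ = Id⁺₊` and `τ ∘ τ = Id`)
  | cyl_comp {A B C : Type} [Finite B] (e : A ≃ B) (w : A → Bool) (e' : B ≃ C) (w' : B → Bool) :
      CobRel R (comp (cyl e w) (cyl e' w')) (cyl (e.trans e') fun a => xor (w a) (w' (e a)))
  | cyl_tensor {A B A' B' : Type} (e : A ≃ B) (w : A → Bool) (e' : A' ≃ B') (w' : A' → Bool) :
      CobRel R (tensor (cyl e w) (cyl e' w')) (cyl (Equiv.sumCongr e e') (Sum.elim w w'))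
  -- commutativity, cocommutativity, associativity, coassociativity, unit, counit, Frobenius
  | mul_comm : CobRel R (comp (perm (Equiv.sumComm Unit Unit)) mul) mul
  | comul_comm : CobRel R (comp comul (perm (Equiv.sumComm Unit Unit))) comul
  | mul_assoc : CobRel R (comp (tensor mul (ident Unit)) mul)
      (comp (perm (Equiv.sumAssoc Unit Unit Unit)) (comp (tensor (ident Unit) mul) mul))
  | comul_assoc : CobRel R
      (comp (comp comul (tensor comul (ident Unit))) (perm (Equiv.sumAssoc Unit Unit Unit)))
      (comp comul (tensor (ident Unit) comul))
  | cap_mul : CobRel R (comp (tensor cap (ident Unit)) mul) (perm (Equiv.emptySum Empty Unit))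
  | comul_cup : CobRel R (comp comul (tensor cup (ident Unit)))
      (perm (Equiv.emptySum Empty Unit).symm)
  | frobenius : CobRel R (comp mul comul)
      (comp (tensor comul (ident Unit))
        (comp (perm (Equiv.sumAssoc Unit Unit Unit)) (tensor (ident Unit) mul)))
  -- changing all boundary decorations of a connected orientable generator
  | cap_phi : CobRel R (comp cap phi) cap
  | phi_cup : CobRel R (comp phi cup) (smul (-1) cup)
  | mul_phi : CobRel R (comp mul phi) (comp (tensor phi phi) mul)
  | phi_comul : CobRel R (comp phi comul) (smul (-1) (comp comul (tensor phi phi)))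
  -- the non orientable generator
  | phi_theta : CobRel R (comp phi theta) theta
  | theta_phi : CobRel R (comp theta phi) theta
  | neg_theta : CobRel R (smul (-1) theta) theta
  | mul_theta : CobRel R (comp mul theta) (comp (tensor theta (ident Unit)) mul)
  | theta_comul : CobRel R (comp theta comul) (comp comul (tensor theta (ident Unit)))
  | moebius : CobRel R (comp comul (comp (tensor phi (ident Unit)) mul)) (comp theta theta)

/-- The setoid of the relations. -/
instance cobSetoid (R : Type u) [CommRing R] (A B : Type) : Setoid (CobWord R A B) where
  r := CobRel R
  iseqv := ⟨CobRel.refl, CobRel.symm, CobRel.trans⟩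

/-- Decorated cobordisms (`R`-linear combinations, modulo the relations). -/
def Cob (R : Type u) [CommRing R] (A B : Type) : Type (max u 1) :=
  Quotient (cobSetoid R A B)

namespace Cob

variable {R : Type u} [CommRing R] {A B C D A' B' : Type}

/-- The class of a word. -/
def mk (f : CobWord R A B) : Cob R A B := Quotient.mk _ f

/-- Gluing, in diagrammatic order. -/
def comp [Finite B] (f : Cob R A B) (g : Cob R B C) : Cob R A C :=
  Quotient.map₂ CobWord.comp (fun _ _ h _ _ h' => CobRel.comp_congr h h') f g

/-- Disjoint union. -/
def tensor (f : Cob R A B) (g : Cob R A' B') : Cob R (A ⊕ A') (B ⊕ B') :=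
  Quotient.map₂ CobWord.tensor (fun _ _ h _ _ h' => CobRel.tensor_congr h h') f g

/-- Decorated cylinders. -/
def cyl (e : A ≃ B) (w : A → Bool) : Cob R A B := mk (CobWord.cyl e w)

/-- Undecorated cylinders. -/
def perm (e : A ≃ B) : Cob R A B := mk (CobWord.perm e)

instance : Zero (Cob R A B) := ⟨mk CobWord.zero⟩

instance : Add (Cob R A B) :=
  ⟨Quotient.map₂ CobWord.add fun _ _ h _ _ h' => CobRel.add_congr h h'⟩

instance : Neg (Cob R A B) :=
  ⟨Quotient.map (CobWord.smul (-1)) fun _ _ h => CobRel.smul_congr _ h⟩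

instance : AddCommGroup (Cob R A B) where
  add_assoc := by
    rintro ⟨f⟩ ⟨g⟩ ⟨h⟩
    exact Quotient.sound (CobRel.add_assoc f g h)
  zero_add := by
    rintro ⟨f⟩
    exact Quotient.sound (CobRel.zero_add f)
  add_zero := by
    rintro ⟨f⟩
    exact Quotient.sound ((CobRel.add_comm _ _).trans (CobRel.zero_add f))
  add_comm := by
    rintro ⟨f⟩ ⟨g⟩
    exact Quotient.sound (CobRel.add_comm f g)
  neg_add_cancel := by
    rintro ⟨f⟩
    refine Quotient.sound ?_
    refine ((CobRel.refl _).add_congr (CobRel.one_smul f).symm).trans ?_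
    refine (CobRel.add_smul (-1) 1 f).symm.trans ?_
    rw [neg_add_cancel]
    exact CobRel.zero_smul f
  nsmul := nsmulRec
  zsmul := zsmulRec

instance : Module R (Cob R A B) where
  smul r := Quotient.map (CobWord.smul r) fun _ _ h => CobRel.smul_congr _ h
  one_smul := by
    rintro ⟨f⟩
    exact Quotient.sound (CobRel.one_smul f)
  mul_smul := by
    rintro r s ⟨f⟩
    exact Quotient.sound (CobRel.mul_smul r s f)
  smul_zero r := by
    refine Quotient.sound ?_
    refine ((CobRel.zero_smul CobWord.zero).symm.smul_congr r).trans ?_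
    refine (CobRel.mul_smul r 0 CobWord.zero).symm.trans ?_
    rw [mul_zero]
    exact CobRel.zero_smul _
  smul_add := by
    rintro r ⟨f⟩ ⟨g⟩
    exact Quotient.sound (CobRel.smul_add r f g)
  add_smul := by
    rintro r s ⟨f⟩
    exact Quotient.sound (CobRel.add_smul r s f)
  zero_smul := by
    rintro ⟨f⟩
    exact Quotient.sound (CobRel.zero_smul f)

end Cob

/-! ## Oriented virtual link diagrams -/

/-- Half-edges of a four valent graph with `n` classical and `v` virtual crossings. The four
half-edges at a vertex are numbered `0, 1, 2, 3` counterclockwise. -/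
abbrev Dart (n v : ℕ) : Type := (Fin n ⊕ Fin v) × Fin 4

/-- An oriented virtual link diagram with ordered classical crossings, as a combinatorial planar
map. At a classical crossing the overcrossing strand is `1`–`3` and the undercrossing strand is
`0`–`2`: the crossing is drawn with the half-edges `0, 1, 2, 3` pointing south-east, north-east,
north-west, south-west, so that the strand going from the lower left to the upper right is on top.
Which of the two ends of the lower strand is called `0` is the choice of one of the two rotations
that bring the crossing into this position. -/
structure VLinkDiagram where
  /-- number of classical crossings -/
  n : ℕ
  /-- number of virtual crossings -/
  v : ℕ
  /-- number of closed edges without vertices -/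
  loops : ℕ
  /-- the other half of an edge -/
  edge : Dart n v → Dart n v
  edge_edge : ∀ d, edge (edge d) = d
  edge_ne : ∀ d, edge d ≠ d
  /-- Planarity: Euler's formula `V + F = E + 2C`, where the faces are traced by "go along the
  edge, then turn to the next half-edge" and `C` is the number of connected components. -/
  planar : (n + v) + Nat.card (Quot fun d d' : Dart n v => d' = ((edge d).1, (edge d).2 + 1)) =
    Nat.card (Quot fun d d' : Dart n v => d' = edge d) +
      2 * Nat.card (Quot fun d d' : Dart n v => d' = edge d ∨ d' = (d.1, d.2 + 1))
  /-- The orientation of the link: `out d` says that the link leaves the vertex along `d`.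
  (Orientations of the closed edges without vertices are never used and are not recorded.) -/
  out : Dart n v → Bool
  out_edge : ∀ d, out (edge d) = !out d
  out_straight : ∀ x i, out (x, i + 2) = !out (x, i)

namespace VLinkDiagram

variable (L : VLinkDiagram)

/-- A classical diagram has no virtual crossings. -/
def IsClassical : Prop := L.v = 0

/-- The number of negative crossings. (With the two strands oriented upwards, that is with `1` and
`2` outgoing, the crossing is positive.) -/
def nMinus : ℕ :=
  (Finset.univ.filter fun x : Fin L.n => L.out (Sum.inl x, 1) ≠ L.out (Sum.inl x, 2)).card

/-- Words of length `n` in the alphabet `{0, 1}`. -/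
abbrev State : Type := Fin L.n → Bool

variable {L}

/-- Number of letters `1`. -/
def ones (a : L.State) : ℕ := (Finset.univ.filter fun x => a x = true).card

/-- The half-edge to which `d` is joined in the resolution `γ_a`: the `0`-resolution joins
`0`–`1` and `2`–`3`, the `1`-resolution joins `0`–`3` and `1`–`2`, and a virtual crossing is
traversed straight ahead. -/
def smooth (a : L.State) : Dart L.n L.v → Dart L.n L.v
  | (Sum.inl x, i) => (Sum.inl x, if a x then ![3, 2, 1, 0] i else ![1, 0, 3, 2] i)
  | (Sum.inr x, i) => (Sum.inr x, i + 2)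

/-- The v-circles of the resolution `γ_a`. -/
abbrev Circle (a : L.State) : Type :=
  Quot (fun d d' : Dart L.n L.v => d' = L.edge d ∨ d' = smooth a d) ⊕ Fin L.loops

instance (a : L.State) : Fintype (Circle a) := Fintype.ofFinite _

instance (a : L.State) : DecidableEq (Circle a) := Classical.decEq _

/-- The v-circle through a half-edge. -/
def circleOf (a : L.State) (d : Dart L.n L.v) : Circle a := Sum.inl (Quot.mk _ d)

/-- An orientation of all v-circles of the resolution `γ_a`; `out d` says that the v-circle through
`d` leaves the vertex along `d`. -/
structure ResOrientation (a : L.State) where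
  out : Dart L.n L.v → Bool
  out_edge : ∀ d, out (L.edge d) = !out d
  out_smooth : ∀ d, out (smooth a d) = !out d
  loopDir : Fin L.loops → Bool

/-- A numbering of the v-circles of `γ_a`. -/
abbrev Numbering (a : L.State) : Type := Circle a ≃ Fin (Fintype.card (Circle a))

variable (L) in
/-- The choices made in the construction: orientations of all resolutions and fixed numberings of
the v-circles of all resolutions. -/
structure Choices where
  orient : ∀ a : L.State, ResOrientation a
  number : ∀ a : L.State, Numbering a

end VLinkDiagram

/-! ## The category of decorated cobordisms -/

/-- A finite collection of numbered v-circles, given as a resolution of a virtual link diagram (a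
collection of v-circles is a virtual link diagram without classical crossings, which is its own
unique resolution). -/
structure VCircles where
  diagram : VLinkDiagram
  state : diagram.State
  number : VLinkDiagram.Numbering state

/-- The v-circles of the collection. -/
abbrev VCircles.Carrier (X : VCircles) : Type := VLinkDiagram.Circle X.state

/-- The objects of the category of cobordisms with boundary decorations, over `R`. -/
structure UCob (R : Type u) where
  circles : VCircles

/-- The `R`-linear category of cobordisms with boundary decorations. Cobordisms are considered up to
boundary preserving homeomorphisms of abstract surfaces. -/
instance (R : Type u) [CommRing R] : Category (UCob R) where
  Hom X Y := Cob R X.circles.Carrier Y.circles.Carrier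
  id X := Cob.perm (Equiv.refl _)
  comp f g := Cob.comp f g
  id_comp := by
    rintro X Y ⟨f⟩
    exact Quotient.sound (CobRel.id_comp f)
  comp_id := by
    rintro X Y ⟨f⟩
    exact Quotient.sound (CobRel.comp_id f)
  assoc := by
    rintro W X Y Z ⟨f⟩ ⟨g⟩ ⟨h⟩
    exact Quotient.sound (CobRel.comp_assoc f g h)

instance (R : Type u) [CommRing R] : Preadditive (UCob R) where
  homGroup X Y := inferInstanceAs (AddCommGroup (Cob R X.circles.Carrier Y.circles.Carrier))
  add_comp := by
    rintro X Y Z ⟨f⟩ ⟨f'⟩ ⟨g⟩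
    exact Quotient.sound (CobRel.add_comp f f' g)
  comp_add := by
    rintro X Y Z ⟨f⟩ ⟨g⟩ ⟨g'⟩
    exact Quotient.sound (CobRel.comp_add f g g')

instance (R : Type u) [CommRing R] : Linear R (UCob R) where
  homModule X Y := inferInstanceAs (Module R (Cob R X.circles.Carrier Y.circles.Carrier))
  smul_comp := by
    rintro X Y Z r ⟨f⟩ ⟨g⟩
    exact Quotient.sound (CobRel.smul_comp r f g)
  comp_smul := by
    rintro X Y Z ⟨f⟩ r ⟨g⟩
    exact Quotient.sound (CobRel.comp_smul r f g)

/-! ## Saddles -/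

/-- If exactly `x` satisfies `T`, split off `x`. -/
def isolateOne {C : Type} [DecidableEq C] (T : C → Prop) (x : C) (hT : ∀ c, T c ↔ c = x) :
    C ≃ Unit ⊕ {c : C // ¬ T c} where
  toFun c := if h : c = x then Sum.inl () else Sum.inr ⟨c, fun t => h ((hT c).1 t)⟩
  invFun := Sum.elim (fun _ => x) fun c => c.1
  left_inv c := by
    by_cases h : c = x <;> simp [h]
  right_inv := by
    rintro (_ | ⟨c, hc⟩)
    · simp
    · have : c ≠ x := fun h => hc ((hT c).2 h)
      simp [this]

/-- If exactly the two different elements `x`, `y` satisfy `T`, split off `x` and `y`, in this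
order. -/
def isolateTwo {C : Type} [DecidableEq C] (T : C → Prop) (x y : C) (hxy : x ≠ y)
    (hT : ∀ c, T c ↔ c = x ∨ c = y) : C ≃ (Unit ⊕ Unit) ⊕ {c : C // ¬ T c} where
  toFun c :=
    if h : c = x then Sum.inl (Sum.inl ())
    else if h' : c = y then Sum.inl (Sum.inr ())
    else Sum.inr ⟨c, fun t => ((hT c).1 t).elim h h'⟩
  invFun := Sum.elim (Sum.elim (fun _ => x) fun _ => y) fun c => c.1
  left_inv c := by
    by_cases h : c = x
    · simp [h]
    · by_cases h' : c = y
      · subst h'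
        simp [h]
      · simp [h, h']
  right_inv := by
    rintro ((_ | _) | ⟨c, hc⟩)
    · simp
    · simp [hxy.symm]
    · have h1 : c ≠ x := fun h => hc ((hT c).2 (Or.inl h))
      have h2 : c ≠ y := fun h => hc ((hT c).2 (Or.inr h))
      simp [h1, h2]

namespace VLinkDiagram

variable {L : VLinkDiagram}

/-- There is a saddle `γ_a → γ_b` at the crossing `r`. -/
structure IsSaddle (a b : L.State) (r : Fin L.n) : Prop where
  src : a r = false
  tgt : b r = true
  away : ∀ x, x ≠ r → a x = b x

/-- The v-circle of `γ_a` containing the string at `r` that ends in the half-edge `0`. For `a r = 0`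
this is the right string, for `a r = 1` it is the lower string. -/
def circ0 (a : L.State) (r : Fin L.n) : Circle a := circleOf a (Sum.inl r, 0)

/-- The v-circle of `γ_a` containing the string at `r` that ends in the half-edge `2`. For `a r = 0`
this is the left string, for `a r = 1` it is the upper string. -/
def circ2 (a : L.State) (r : Fin L.n) : Circle a := circleOf a (Sum.inl r, 2)

/-- The v-circles of `γ_a` that pass through the neighbourhood of the crossing `r`. -/
def Touched (a : L.State) (r : Fin L.n) (c : Circle a) : Prop := c = circ0 a r ∨ c = circ2 a r

theorem smooth_away {a b : L.State} {r : Fin L.n} (h : ∀ x, x ≠ r → a x = b x)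
    {d : Dart L.n L.v} (hd : d.1 ≠ Sum.inl r) : smooth a d = smooth b d := by
  obtain ⟨x | x, i⟩ := d
  · have : x ≠ r := fun e => hd (by rw [e])
    simp [smooth, h x this]
  · rfl

theorem circleOf_edge (a : L.State) (d : Dart L.n L.v) :
    circleOf a (L.edge d) = circleOf a d :=
  congrArg Sum.inl (Quot.sound (r := fun d d' : Dart L.n L.v => d' = L.edge d ∨ d' = smooth a d)
    (Or.inl rfl)).symm

theorem circleOf_smooth (a : L.State) (d : Dart L.n L.v) :
    circleOf a (smooth a d) = circleOf a d :=
  congrArg Sum.inl (Quot.sound (r := fun d d' : Dart L.n L.v => d' = L.edge d ∨ d' = smooth a d)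
    (Or.inr rfl)).symm

theorem touched_at (a : L.State) (r : Fin L.n) (i : Fin 4) :
    Touched a r (circleOf a (Sum.inl r, i)) := by
  have h0 := circleOf_smooth a (Sum.inl r, 0)
  have h2 := circleOf_smooth a (Sum.inl r, 2)
  unfold Touched circ0 circ2
  cases ha : a r <;> simp [smooth, ha] at h0 h2 <;> fin_cases i <;> simp [h0, h2]

theorem smooth_fst (a : L.State) (d : Dart L.n L.v) : (smooth a d).1 = d.1 := by
  obtain ⟨x | x, i⟩ := d <;> rfl

theorem touched_of_touched {a b : L.State} {r : Fin L.n} (h : ∀ x, x ≠ r → a x = b x)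
    (d : Dart L.n L.v) (hd : Touched b r (circleOf b d)) : Touched a r (circleOf a d) := by
  let P : Quot (fun d d' : Dart L.n L.v => d' = L.edge d ∨ d' = smooth b d) → Prop :=
    Quot.lift (fun d => Touched a r (circleOf a d)) (by
      rintro d _ (rfl | rfl)
      · simp only [circleOf_edge]
      · by_cases hd : d.1 = Sum.inl r
        · obtain ⟨x, i⟩ := d
          obtain rfl : x = Sum.inl r := hd
          exact propext (iff_of_true (touched_at a r i) (touched_at a r _))
        · simp only [← smooth_away h hd, circleOf_smooth])
  rcases hd with hd | hd
  · have : P (Quot.mk _ d) = P (Quot.mk _ (Sum.inl r, 0)) := congrArg P (Sum.inl.inj hd)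
    exact this.mpr (touched_at a r 0)
  · have : P (Quot.mk _ d) = P (Quot.mk _ (Sum.inl r, 2)) := congrArg P (Sum.inl.inj hd)
    exact this.mpr (touched_at a r 2)

open scoped Classical in
/-- On v-circles not passing through `r`, this sends the v-circle of `γ_a` through a half-edge to
the v-circle of `γ_b` through the same half-edge (the other v-circles have the value `circ0`, which
is never used). -/
def transferAux {a b : L.State} {r : Fin L.n} (h : ∀ x, x ≠ r → a x = b x) :
    Circle a → Circle b :=
  Sum.elim
    (Quot.lift (fun d => if Touched a r (circleOf a d) then circ0 b r else circleOf b d) (by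
      rintro d _ (rfl | rfl)
      · simp only [circleOf_edge]
      · by_cases hd : d.1 = Sum.inl r
        · obtain ⟨x, i⟩ := d
          obtain rfl : x = Sum.inl r := hd
          exact (if_pos (touched_at a r i)).trans (if_pos (touched_at a r _)).symm
        · have : circleOf b (smooth a d) = circleOf b d := by
            rw [smooth_away h hd, circleOf_smooth]
          simp only [circleOf_smooth, this]))
    Sum.inr

theorem transferAux_circleOf {a b : L.State} {r : Fin L.n} (h : ∀ x, x ≠ r → a x = b x)
    (d : Dart L.n L.v) (hd : ¬ Touched a r (circleOf a d)) :
    transferAux h (circleOf a d) = circleOf b d := if_neg hd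

theorem not_touched_loop (a : L.State) (r : Fin L.n) (l : Fin L.loops) :
    ¬ Touched a r (Sum.inr l) := by
  rintro (h | h) <;> cases h

theorem transferAux_not_touched {a b : L.State} {r : Fin L.n} (h : ∀ x, x ≠ r → a x = b x)
    (c : Circle a) (hc : ¬ Touched a r c) : ¬ Touched b r (transferAux h c) := by
  obtain ⟨⟨d⟩⟩ | l := c
  · have e := transferAux_circleOf h d hc
    intro t
    exact hc (touched_of_touched h d (e ▸ t))
  · exact not_touched_loop b r l

theorem transferAux_transferAux {a b : L.State} {r : Fin L.n} (h : ∀ x, x ≠ r → a x = b x)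
    (h' : ∀ x, x ≠ r → b x = a x) (c : Circle a) (hc : ¬ Touched a r c) :
    transferAux h' (transferAux h c) = c := by
  obtain ⟨⟨d⟩⟩ | l := c
  · have e := transferAux_circleOf h d hc
    have hb : ¬ Touched b r (circleOf b d) := fun t => hc (touched_of_touched h d t)
    have e' := transferAux_circleOf h' d hb
    exact (congrArg (transferAux h') e).trans e'
  · rfl

/-- The v-circles unaffected by a saddle at `r`, in its source and in its target. -/
def unaffected {a b : L.State} {r : Fin L.n} (h : IsSaddle a b r) :
    {c : Circle a // ¬ Touched a r c} ≃ {c : Circle b // ¬ Touched b r c} where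
  toFun c := ⟨transferAux h.away c.1, transferAux_not_touched h.away c.1 c.2⟩
  invFun c := ⟨transferAux (fun x hx => (h.away x hx).symm) c.1,
    transferAux_not_touched (fun x hx => (h.away x hx).symm) c.1 c.2⟩
  left_inv c := Subtype.ext (transferAux_transferAux h.away (fun x hx => (h.away x hx).symm)
    c.1 c.2)
  right_inv c := Subtype.ext (transferAux_transferAux (fun x hx => (h.away x hx).symm) h.away
    c.1 c.2)

/-- The two strings at `r` belong to one v-circle: split it off. -/
def splitOne (a : L.State) (r : Fin L.n) (h : circ0 a r = circ2 a r) :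
    Circle a ≃ Unit ⊕ {c : Circle a // ¬ Touched a r c} :=
  isolateOne (Touched a r) (circ0 a r) fun c => by simp [Touched, ← h]

/-- The two strings at `r` belong to different v-circles: split them off, the one through the
half-edge `0` first. -/
def split02 (a : L.State) (r : Fin L.n) (h : circ0 a r ≠ circ2 a r) :
    Circle a ≃ (Unit ⊕ Unit) ⊕ {c : Circle a // ¬ Touched a r c} :=
  isolateTwo (Touched a r) (circ0 a r) (circ2 a r) h fun _ => Iff.rfl

/-- The two strings at `r` belong to different v-circles: split them off, the one through the
half-edge `2` first. -/
def split20 (a : L.State) (r : Fin L.n) (h : circ0 a r ≠ circ2 a r) :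
    Circle a ≃ (Unit ⊕ Unit) ⊕ {c : Circle a // ¬ Touched a r c} :=
  isolateTwo (Touched a r) (circ2 a r) (circ0 a r) h.symm fun _ => Or.comm

/-- The saddle `γ_a → γ_b` without decorations and signs, that is with only positive gluing
numbers: it is `theta` (one v-circle to one v-circle), `comul` (one to two; the first output is the
lower string), or `mul` (two to one; the first input is the left string), together with cylinders
`Id⁺₊` on the unaffected v-circles. Two v-circles never go to two v-circles, so the last value is
never used. -/
def saddle (R : Type u) [CommRing R] {a b : L.State} {r : Fin L.n} (h : IsSaddle a b r) :
    Cob R (Circle a) (Circle b) :=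
  if ha : circ0 a r = circ2 a r then
    if hb : circ0 b r = circ2 b r then
      (Cob.perm (splitOne a r ha)).comp
        (((Cob.mk CobWord.theta).tensor (Cob.perm (unaffected h))).comp
          (Cob.perm (splitOne b r hb).symm))
    else
      (Cob.perm (splitOne a r ha)).comp
        (((Cob.mk CobWord.comul).tensor (Cob.perm (unaffected h))).comp
          (Cob.perm (split02 b r hb).symm))
  else
    if hb : circ0 b r = circ2 b r then
      (Cob.perm (split20 a r ha)).comp
        (((Cob.mk CobWord.mul).tensor (Cob.perm (unaffected h))).comp
          (Cob.perm (splitOne b r hb).symm))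
    else 0

/-- The saddle is non orientable. -/
def IsTheta (a b : L.State) (r : Fin L.n) : Prop :=
  circ0 a r = circ2 a r ∧ circ0 b r = circ2 b r

/-- The gluing number at a v-circle through `r` is negative. The reference local orientations, for
which all gluing numbers are positive, are: left string down and right string up in the source,
lower string to the left and upper string to the right in the target; so the half-edges `0` and `2`
are incoming. -/
def GluingNeg {a : L.State} (o : ResOrientation a) (r : Fin L.n) (c : Circle a) : Prop :=
  (c = circ0 a r ∧ o.out (Sum.inl r, 0) = true) ∨ (c = circ2 a r ∧ o.out (Sum.inl r, 2) = true)

/-- A v-circle of `γ_a`, not passing through the crossing where `γ_a` and `γ_b` differ, has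
different orientations in the two resolutions. -/
def Reversed {a b : L.State} (o : ResOrientation a) (o' : ResOrientation b) (c : Circle a) : Prop :=
  (∃ d, c = circleOf a d ∧ o.out d ≠ o'.out d) ∨
    ∃ l, c = Sum.inr l ∧ o.loopDir l ≠ o'.loopDir l

open scoped Classical in
/-- The positions of `Φ⁻₊` above the saddle: at negative gluing numbers of the source, and at
unaffected v-circles whose orientation changes. -/
def topDecoration {a b : L.State} (o : ResOrientation a) (o' : ResOrientation b) (r : Fin L.n)
    (c : Circle a) : Bool :=
  if Touched a r c then decide (¬ IsTheta a b r ∧ GluingNeg o r c) else decide (Reversed o o' c)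

open scoped Classical in
/-- The positions of `Φ⁻₊` below the saddle: at negative gluing numbers of the target. -/
def bottomDecoration (a : L.State) {b : L.State} (o' : ResOrientation b) (r : Fin L.n)
    (c : Circle b) : Bool :=
  decide (¬ IsTheta a b r ∧ GluingNeg o' r c)

/-- Two circles `x`, `y` over one circle: identify `x` with this circle, `y` with the extra point. -/
def dropSecond {U V : Type} (e : U ≃ V) : (Unit ⊕ Unit) ⊕ U ≃ Option (Unit ⊕ V) where
  toFun := Sum.elim (Sum.elim (fun _ => some (Sum.inl ())) fun _ => none)
    fun u => some (Sum.inr (e u))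
  invFun
    | none => Sum.inl (Sum.inr ())
    | some (Sum.inl _) => Sum.inl (Sum.inl ())
    | some (Sum.inr v) => Sum.inr (e.symm v)
  left_inv := by rintro ((_ | _) | u) <;> simp
  right_inv := by rintro (_ | (_ | v)) <;> simp

/-- The numbering of `C` that is induced by a numbering `μ` of `D`: elements of `C` corresponding to
elements of `D` carry the same number, the remaining element carries the largest number. -/
def inducedNumbering {C D : Type} [Fintype D] (E : C ≃ Option D) (μ : D ≃ Fin (Fintype.card D)) :
    C ≃ Fin (Fintype.card D + 1) :=
  E.trans ((Equiv.optionCongr μ).trans finSuccEquivLast.symm)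

/-- The sign of the permutation between the fixed numbering `ν` of `C` and the numbering induced by
`μ`. -/
def numberingSign {C D : Type} [Fintype C] [DecidableEq C] [Fintype D] (E : C ≃ Option D)
    (ν : C ≃ Fin (Fintype.card C)) (μ : D ≃ Fin (Fintype.card D)) : ℤˣ :=
  Equiv.Perm.sign (ν.trans ((finCongr ((Fintype.card_congr (inducedNumbering E μ)).trans
    (Fintype.card_fin _))).trans (inducedNumbering E μ).symm))

/-- The saddle sign. The X-marker is on the left string of the source and on the lower string of the
target. For a multiplication the numbering of the target induces one of the source, for a
comultiplication the numbering of the source induces one of the target. Here the two numbers that are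
left over are the number of the merged (split) v-circle, which goes to the v-circle with the
X-marker, and the maximal number, which goes to the other one. For `theta` the sign is irrelevant. -/
def saddleSign {a b : L.State} {r : Fin L.n} (h : IsSaddle a b r) (ν : Numbering a)
    (μ : Numbering b) : ℤˣ :=
  if ha : circ0 a r = circ2 a r then
    if hb : circ0 b r = circ2 b r then 1
    else
      numberingSign ((split02 b r hb).trans ((dropSecond (unaffected h).symm).trans
        (Equiv.optionCongr (splitOne a r ha).symm))) μ ν
  else
    if hb : circ0 b r = circ2 b r then
      numberingSign ((split20 a r ha).trans ((dropSecond (unaffected h)).trans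
        (Equiv.optionCongr (splitOne b r hb).symm))) ν μ
    else 1

/-- The saddle with the saddle decorations and the saddle sign. -/
def decoratedSaddle (R : Type u) [CommRing R] (ch : L.Choices) {a b : L.State} {r : Fin L.n}
    (h : IsSaddle a b r) : Cob R (Circle a) (Circle b) :=
  ((saddleSign h (ch.number a) (ch.number b) : ℤˣ) : ℤ) •
    (Cob.cyl (Equiv.refl _) (topDecoration (ch.orient a) (ch.orient b) r)).comp
      ((saddle R h).comp (Cob.cyl (Equiv.refl _) (bottomDecoration a (ch.orient b) r)))

/-- The saddle with only positive gluing numbers and the classical sign `(-1)^k`, where `k` is the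
number of letters `1` of `a` before the `r`-th letter. -/
def classicalSaddle (R : Type u) [CommRing R] {a b : L.State} {r : Fin L.n} (h : IsSaddle a b r) :
    Cob R (Circle a) (Circle b) :=
  ((-1 : ℤ) ^ (Finset.univ.filter fun x : Fin L.n => x < r ∧ a x = true).card) • saddle R h

/-! ## The complexes -/

variable (L)

/-- The resolution `γ_a` as an object of the category of cobordisms. -/
def resolution (R : Type u) (a : L.State) (ν : Numbering a) : UCob R := ⟨⟨L, a, ν⟩⟩

/-- The chain module in degree `i`: the formal direct sum of all resolutions with `i + n₋` letters
`1`. -/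
def chainModule (R : Type u) [CommRing R] (ν : ∀ a : L.State, Numbering a) (i : ℤ) :
    Mat_ (UCob R) where
  ι := {a : L.State // (ones a : ℤ) - L.nMinus = i}
  fintype := Fintype.ofFinite _
  X a := L.resolution R a.1 (ν a.1)

open scoped Classical in
/-- The matrix of decorated saddles (for given `a`, `b` there is at most one crossing `r` with a
saddle `γ_a → γ_b` at `r`). -/
def virtualD (R : Type u) [CommRing R] (ch : L.Choices) (i : ℤ) :
    L.chainModule R ch.number i ⟶ L.chainModule R ch.number (i + 1) :=
  fun a b => (∑ r : Fin L.n, if h : IsSaddle a.1 b.1 r then decoratedSaddle R ch h else 0 :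
    Cob R (Circle a.1) (Circle b.1))

open scoped Classical in
/-- The matrix of classical saddles. -/
def classicalD (R : Type u) [CommRing R] (ν : ∀ a : L.State, Numbering a) (i : ℤ) :
    L.chainModule R ν i ⟶ L.chainModule R ν (i + 1) :=
  fun a b => (∑ r : Fin L.n, if h : IsSaddle a.1 b.1 r then classicalSaddle R h else 0 :
    Cob R (Circle a.1) (Circle b.1))

/-- The geometric complex (virtual Khovanov complex), once it is known to be a chain complex. -/
def virtualComplex (R : Type u) [CommRing R] (ch : L.Choices)
    (sq : ∀ i, L.virtualD R ch i ≫ L.virtualD R ch (i + 1) = 0) :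
    CochainComplex (Mat_ (UCob R)) ℤ :=
  CochainComplex.of (L.chainModule R ch.number) (L.virtualD R ch) sq

/-- The classical Khovanov complex, once it is known to be a chain complex. -/
def classicalComplex (R : Type u) [CommRing R] (ν : ∀ a : L.State, Numbering a)
    (sq : ∀ i, L.classicalD R ν i ≫ L.classicalD R ν (i + 1) = 0) :
    CochainComplex (Mat_ (UCob R)) ℤ :=
  CochainComplex.of (L.chainModule R ν) (L.classicalD R ν) sq

end VLinkDiagram

end VKh

end

open CategoryTheory

noncomputable section

namespace VKh

universe u

/-! ## Calculus of cobordisms -/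

namespace Cob

variable {R : Type u} [CommRing R] {A B C D A' B' C' X Y Z W U V : Type}

/-! The four-valent plane graph under the diagram has a source-sink orientation: half-edges are
opposite along every edge and alternate around every vertex (`exists_sourceSink`). This is the
vanishing of the first cohomology of the sphere modulo two, extracted from Euler's formula by a
dimension count. Both smoothings of a classical crossing join neighbouring half-edges, so one such
orientation orients the circles through crossings in all resolutions at once. With respect to it no
unaffected circle through a crossing is reversed, and the three gluing numbers of a saddle are
equal, with a value depending only on the crossing. A pantsup with `Φ` at all three boundary circles
is the pantsup; a pantsdown with `Φ` at all three is minus the pantsdown. Hence, after conjugation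
by `Φ` on the circles whose chosen orientation is the other one, every decorated saddle becomes the
undecorated one times a sign `virtualSign` (`decoratedSaddle_eq`).

The core is `faceRelation`: around every two-dimensional face of the cube the undecorated saddles
commute and the virtual signs multiply to `-1`. Following the circles of a resolution between
incoming half-edges gives a permutation whose cycles are the circles met by crossings, and a saddle
multiplies it by a transposition (`perm_saddle`). So each saddle merges or splits, `theta` never
occurs, and counting circles leaves few types of faces. A pantsup or pantsdown depends only on the
induced map of circles (`IsMul.eq_loc`, `IsComul.eq_loc`), so a face can be checked in convenient
coordinates, where it is associativity, coassociativity, Frobenius or the interchange law, or where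
both paths are visibly the same cobordism.

If the face is a commuting square of merging maps, its two paths induce numberings that differ by
one transposition (`numberingSign_square`). Two types remain: splitting a circle and merging the
parts again, and merging two circles and splitting the result. There the sign depends on how the
strings at the two crossings are connected (`circleOf_of_perm_eq`) and on the crossing signs of the
source-sink orientation.

The classical signs also multiply to `-1` around every face. The quotient of the two sign systems is
therefore a cocycle on the cube, hence the coboundary of some `t` (`exists_sign_potential`). The
diagonal matrix with entries `t a` times the reversing cylinders is the isomorphism. The classical
differential squares to zero by `faceRelation`, and the virtual one by transport along this
isomorphism. -/

theorem comp_assoc [Finite B] [Finite C] (f : Cob R A B) (g : Cob R B C) (h : Cob R C D) :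
    (f.comp g).comp h = f.comp (g.comp h) := by
  obtain ⟨f⟩ := f; obtain ⟨g⟩ := g; obtain ⟨h⟩ := h
  exact Quotient.sound (CobRel.comp_assoc f g h)

theorem perm_refl_comp [Finite A] (f : Cob R A B) : (perm (Equiv.refl A)).comp f = f := by
  obtain ⟨f⟩ := f
  exact Quotient.sound (CobRel.id_comp f)

theorem comp_perm_refl [Finite B] (f : Cob R A B) : f.comp (perm (Equiv.refl B)) = f := by
  obtain ⟨f⟩ := f
  exact Quotient.sound (CobRel.comp_id f)

theorem tensor_comp [Finite B] [Finite B'] (f : Cob R A B) (g : Cob R B C) (f' : Cob R A' B')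
    (g' : Cob R B' C') :
    (f.comp g).tensor (f'.comp g') = (f.tensor f').comp (g.tensor g') := by
  obtain ⟨f⟩ := f; obtain ⟨g⟩ := g; obtain ⟨f'⟩ := f'; obtain ⟨g'⟩ := g'
  exact Quotient.sound (CobRel.tensor_comp f g f' g')

theorem cyl_comp [Finite B] (e : A ≃ B) (w : A → Bool) (e' : B ≃ C) (w' : B → Bool) :
    (cyl e w : Cob R A B).comp (cyl e' w') = cyl (e.trans e') fun a => xor (w a) (w' (e a)) :=
  Quotient.sound (CobRel.cyl_comp e w e' w')

theorem cyl_tensor (e : A ≃ B) (w : A → Bool) (e' : A' ≃ B') (w' : A' → Bool) :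
    (cyl e w : Cob R A B).tensor (cyl e' w') = cyl (Equiv.sumCongr e e') (Sum.elim w w') :=
  Quotient.sound (CobRel.cyl_tensor e w e' w')

theorem perm_comp [Finite B] (e : A ≃ B) (e' : B ≃ C) :
    (perm e : Cob R A B).comp (perm e') = perm (e.trans e') :=
  cyl_comp e _ e' _

theorem perm_tensor (e : A ≃ B) (e' : A' ≃ B') :
    (perm e : Cob R A B).tensor (perm e') = perm (Equiv.sumCongr e e') := by
  refine (cyl_tensor e _ e' _).trans (congrArg (cyl _) ?_)
  funext x
  cases x <;> rfl

theorem perm_comp_assoc [Finite B] [Finite C] (e : A ≃ B) (e' : B ≃ C) (f : Cob R C D) :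
    (perm e : Cob R A B).comp ((perm e').comp f) = (perm (e.trans e')).comp f := by
  rw [← comp_assoc, perm_comp]

theorem smul_comp [Finite B] (r : R) (f : Cob R A B) (g : Cob R B C) :
    (r • f).comp g = r • f.comp g := by
  obtain ⟨f⟩ := f; obtain ⟨g⟩ := g
  exact Quotient.sound (CobRel.smul_comp r f g)

theorem comp_smul [Finite B] (r : R) (f : Cob R A B) (g : Cob R B C) :
    f.comp (r • g) = r • f.comp g := by
  obtain ⟨f⟩ := f; obtain ⟨g⟩ := g
  exact Quotient.sound (CobRel.comp_smul r f g)

theorem smul_tensor (r : R) (f : Cob R A B) (g : Cob R A' B') :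
    (r • f).tensor g = r • f.tensor g := by
  obtain ⟨f⟩ := f; obtain ⟨g⟩ := g
  exact Quotient.sound (CobRel.smul_tensor r f g)

theorem assoc_natural [Finite A] [Finite A'] [Finite C] [Finite B] [Finite B'] [Finite D]
    (f : Cob R A B) (f' : Cob R A' B') (f'' : Cob R C D) :
    ((f.tensor f').tensor f'').comp (perm (Equiv.sumAssoc B B' D)) =
      (perm (Equiv.sumAssoc A A' C)).comp (f.tensor (f'.tensor f'')) := by
  obtain ⟨f⟩ := f; obtain ⟨f'⟩ := f'; obtain ⟨f''⟩ := f''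
  exact Quotient.sound (CobRel.assoc_natural f f' f'')

theorem swap_natural [Finite A] [Finite A'] [Finite B] [Finite B']
    (f : Cob R A B) (f' : Cob R A' B') :
    (f.tensor f').comp (perm (Equiv.sumComm B B')) =
      (perm (Equiv.sumComm A A')).comp (f'.tensor f) := by
  obtain ⟨f⟩ := f; obtain ⟨f'⟩ := f'
  exact Quotient.sound (CobRel.swap_natural f f')

theorem tensor_assoc [Finite A] [Finite A'] [Finite C] [Finite B] [Finite B'] [Finite D]
    (f : Cob R A B) (f' : Cob R A' B') (f'' : Cob R C D) :
    f.tensor (f'.tensor f'') = (perm (Equiv.sumAssoc A A' C).symm).comp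
      (((f.tensor f').tensor f'').comp (perm (Equiv.sumAssoc B B' D))) := by
  rw [assoc_natural, perm_comp_assoc, Equiv.symm_trans_self, perm_refl_comp]

theorem tensor_swap [Finite A] [Finite A'] [Finite B] [Finite B']
    (f : Cob R A B) (f' : Cob R A' B') :
    f.tensor f' = (perm (Equiv.sumComm A A')).comp
      ((f'.tensor f).comp (perm (Equiv.sumComm B' B))) := by
  rw [swap_natural, perm_comp_assoc]
  have : (Equiv.sumComm A A').trans (Equiv.sumComm A' A) = Equiv.refl _ := by
    ext x; cases x <;> rfl
  rw [this, perm_refl_comp]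

/-! ### Cobordisms supported on some of the circles -/

/-- The cobordism `g` on the circles in `X`, and cylinders on the remaining circles. -/
def loc [Finite X] [Finite Y] [Finite U] (g : Cob R X Y) (e : A ≃ X ⊕ U) (e' : Y ⊕ U ≃ B) :
    Cob R A B :=
  (perm e).comp ((g.tensor (perm (Equiv.refl U))).comp (perm e'))

theorem tensor_perm_comp [Finite Y] [Finite U] [Finite B] (g : Cob R X Y) (h : Cob R Y B) :
    (g.comp h).tensor (perm (Equiv.refl U)) =
      (g.tensor (perm (Equiv.refl U))).comp (h.tensor (perm (Equiv.refl U))) := by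
  rw [← tensor_comp, perm_comp]; rfl

variable [Finite X] [Finite Y] [Finite Z] [Finite W] [Finite U] [Finite V]

theorem loc_comp_loc [Finite B] (g : Cob R X Y) (h : Cob R Y Z) (e : A ≃ X ⊕ U) (e' : B ≃ Y ⊕ U)
    (e'' : Z ⊕ U ≃ C) : (loc g e e'.symm).comp (loc h e' e'') = loc (g.comp h) e e'' := by
  unfold loc
  simp only [tensor_perm_comp, comp_assoc, perm_comp_assoc, Equiv.symm_trans_self, perm_refl_comp]

/-- The remaining circles carry only cylinders, so renaming them above and undoing the renaming
below has no effect. -/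
theorem loc_congr_rest (u : U ≃ V) (g : Cob R X Y) (e : A ≃ X ⊕ U) (e' : Y ⊕ U ≃ B) :
    loc g e e' = loc g (e.trans (Equiv.sumCongr (Equiv.refl X) u))
      ((Equiv.sumCongr (Equiv.refl Y) u).symm.trans e') := by
  unfold loc
  rw [← perm_comp, ← perm_comp]
  have h : g.tensor (perm (Equiv.refl U)) = (perm (Equiv.sumCongr (Equiv.refl X) u)).comp
      ((g.tensor (perm (Equiv.refl V))).comp (perm (Equiv.sumCongr (Equiv.refl Y) u).symm)) := by
    have h2 : (Equiv.sumCongr (Equiv.refl Y) u).symm =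
      Equiv.sumCongr (Equiv.refl Y) u.symm := by ext x; cases x <;> rfl
    rw [h2, ← perm_tensor, ← perm_tensor, ← tensor_comp, ← tensor_comp, comp_perm_refl,
      perm_refl_comp, perm_comp, perm_comp]
    congr 2
    ext; simp
  rw [h]
  simp only [comp_assoc]

theorem loc_perm_comp (σ : X ≃ Y) (g : Cob R Y Z) (e : A ≃ X ⊕ U) (e' : Z ⊕ U ≃ B) :
    loc ((perm σ).comp g) e e' = loc g (e.trans (Equiv.sumCongr σ (Equiv.refl U))) e' := by
  unfold loc
  rw [tensor_perm_comp, perm_tensor, ← perm_comp]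
  simp only [comp_assoc]

theorem loc_comp_perm (g : Cob R X Y) (σ : Y ≃ Z) (e : A ≃ X ⊕ U) (e' : Z ⊕ U ≃ B) :
    loc (g.comp (perm σ)) e e' = loc g e ((Equiv.sumCongr σ (Equiv.refl U)).trans e') := by
  unfold loc
  rw [tensor_perm_comp, perm_tensor, ← perm_comp]
  simp only [comp_assoc]

/-- Idle circles can be moved from the tensor factor to the remaining circles. Together with
`loc_perm_tensor` this reduces every placement of a generator to a plain `loc g`. -/
theorem loc_tensor_perm (g : Cob R X Y) (e : A ≃ (X ⊕ W) ⊕ U) (e' : (Y ⊕ W) ⊕ U ≃ B) :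
    loc (g.tensor (perm (Equiv.refl W))) e e' =
      loc g (e.trans (Equiv.sumAssoc X W U)) ((Equiv.sumAssoc Y W U).symm.trans e') := by
  unfold loc
  have h : (perm (Equiv.refl (W ⊕ U)) : Cob R _ _) =
      (perm (Equiv.refl W)).tensor (perm (Equiv.refl U)) := by
    rw [perm_tensor]; congr 1; ext x; cases x <;> rfl
  rw [h, tensor_assoc, ← perm_comp, ← perm_comp]
  simp only [comp_assoc, perm_comp_assoc, Equiv.self_trans_symm, perm_refl_comp]

theorem loc_perm_tensor (g : Cob R X Y) (e : A ≃ (W ⊕ X) ⊕ U) (e' : (W ⊕ Y) ⊕ U ≃ B) :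
    loc ((perm (Equiv.refl W)).tensor g) e e' =
      loc g ((e.trans (Equiv.sumCongr (Equiv.sumComm W X) (Equiv.refl U))).trans
          (Equiv.sumAssoc X W U))
        ((Equiv.sumAssoc Y W U).symm.trans
          ((Equiv.sumCongr (Equiv.sumComm Y W) (Equiv.refl U)).trans e')) := by
  rw [tensor_swap, loc_perm_comp, loc_comp_perm, loc_tensor_perm]

/-- Bifunctoriality of the disjoint union: cobordisms on disjoint sets of circles can be performed
in either order. -/
theorem loc_interchange [Finite C] {X' Y' : Type} [Finite X'] [Finite Y']
    (g : Cob R X Y) (g' : Cob R X' Y')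
    (eA : A ≃ X ⊕ (X' ⊕ U)) (eB : B ≃ X ⊕ (Y' ⊕ U)) (eC : C ≃ Y ⊕ (X' ⊕ U))
    (eD : Y ⊕ (Y' ⊕ U) ≃ D) [Finite B] :
    (loc g eA eC.symm).comp (loc ((perm (Equiv.refl Y)).tensor g')
        (eC.trans (Equiv.sumAssoc Y X' U).symm) ((Equiv.sumAssoc Y Y' U).trans eD)) =
      (loc ((perm (Equiv.refl X)).tensor g') (eA.trans (Equiv.sumAssoc X X' U).symm)
        ((Equiv.sumAssoc X Y' U).trans eB.symm)).comp (loc g eB eD) := by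
  unfold loc
  have key : (g.tensor (perm (Equiv.refl (X' ⊕ U)))).comp ((perm (Equiv.refl Y)).tensor
        (g'.tensor (perm (Equiv.refl U)))) =
      ((perm (Equiv.refl X)).tensor (g'.tensor (perm (Equiv.refl U)))).comp
        (g.tensor (perm (Equiv.refl (Y' ⊕ U)))) := by
    rw [← tensor_comp, ← tensor_comp, comp_perm_refl, comp_perm_refl, perm_refl_comp,
      perm_refl_comp]
  have h : ∀ Q : Type, [Finite Q] → ((perm (Equiv.refl Q)).tensor
      (g'.tensor (perm (Equiv.refl U))) : Cob R _ _) =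
      (perm (Equiv.sumAssoc Q X' U).symm).comp ((((perm (Equiv.refl Q)).tensor g').tensor
        (perm (Equiv.refl U))).comp (perm (Equiv.sumAssoc Q Y' U))) := fun Q _ => tensor_assoc _ _ _
  have key2 := congrArg (fun z => (perm eA).comp (z.comp (perm eD))) key
  simp only [h, comp_assoc] at key2
  simp only [← perm_comp, comp_assoc]
  simp only [perm_comp_assoc, Equiv.symm_trans_self, perm_refl_comp]
  simp only [← Equiv.trans_assoc, Equiv.symm_trans_self, Equiv.refl_trans,
    perm_comp_assoc] at key2 ⊢
  exact key2

end Cob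

/-! ## Merging two circles -/

/-- The map `π` identifies the different points `x`, `y`, and is bijective apart from that. -/
structure IsMerge {A B : Type} (π : A → B) (x y : A) : Prop where
  ne : x ≠ y
  surj : Function.Surjective π
  ker : ∀ c c', π c = π c' ↔ c = c' ∨ (c = x ∧ c' = y) ∨ (c = y ∧ c' = x)

theorem IsMerge.symm {A B : Type} {π : A → B} {x y : A} (h : IsMerge π x y) : IsMerge π y x :=
  ⟨h.ne.symm, h.surj, fun c c' => by rw [h.ker, or_comm (a := c = x ∧ _)]⟩

theorem IsMerge.eq {A B : Type} {π : A → B} {x y : A} (h : IsMerge π x y) : π x = π y :=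
  (h.ker x y).2 (Or.inr (Or.inl ⟨rfl, rfl⟩))

/-- The standard merging map. -/
def fold {U : Type} : (Unit ⊕ Unit) ⊕ U → Unit ⊕ U := Sum.map (fun _ => ()) id

/-- Coordinates in which `π` is the standard merging map. -/
def Coord {A B U : Type} (π : A → B) (e : (Unit ⊕ Unit) ⊕ U ≃ A) (e' : Unit ⊕ U ≃ B) : Prop :=
  ∀ s, π (e s) = e' (fold s)

/-- The left summand is the only two-point fibre of `fold`, so it must be the pair `x`, `y`, in an
undetermined order. -/
theorem Coord.pair {A B U : Type} {π : A → B} {e : (Unit ⊕ Unit) ⊕ U ≃ A} {e' : Unit ⊕ U ≃ B}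
    (c : Coord π e e') {x y : A} (h : IsMerge π x y) :
    (∀ i, e (.inl i) = x ∨ e (.inl i) = y) ∧ π x = e' (.inl ()) ∧
      ∀ u, e (.inr u) ≠ x ∧ e (.inr u) ≠ y := by
  have h1 : π (e (.inl (.inl ()))) = π (e (.inl (.inr ()))) :=
    (c _).trans (c (.inl (.inr ()))).symm
  have h0 : e (.inl (.inl ())) ≠ e (.inl (.inr ())) := fun h => by cases e.injective h
  rcases ((h.ker _ _).1 h1).resolve_left h0 with ⟨hx, hy⟩ | ⟨hy, hx⟩
  · refine ⟨?_, hx ▸ c _, fun u => ⟨fun h => ?_, fun h => ?_⟩⟩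
    · rintro (_ | _)
      exacts [.inl hx, .inr hy]
    · cases e.injective (h.trans hx.symm)
    · cases e.injective (h.trans hy.symm)
  · refine ⟨?_, hx ▸ c (.inl (.inr ())), fun u => ⟨fun h => ?_, fun h => ?_⟩⟩
    · rintro (_ | _)
      exacts [.inr hy, .inl hx]
    · cases e.injective (h.trans hx.symm)
    · cases e.injective (h.trans hy.symm)

theorem exists_sumCongr {X Y U V : Type} (ψ : X ⊕ U ≃ Y ⊕ V) (hl : ∀ x, ∃ y, ψ (.inl x) = .inl y)
    (hr : ∀ u, ∃ v, ψ (.inr u) = .inr v) : ∃ σ u, ψ = Equiv.sumCongr σ u := by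
  choose f hf using hl
  choose g hg using hr
  have bf : Function.Bijective f := by
    refine ⟨fun x x' h => Sum.inl_injective (ψ.injective (by rw [hf, hf, h])), fun y => ?_⟩
    obtain ⟨x | u, h⟩ := ψ.surjective (.inl y)
    · exact ⟨x, Sum.inl_injective ((hf x).symm.trans h)⟩
    · rw [hg] at h; cases h
  have bg : Function.Bijective g := by
    refine ⟨fun x x' h => Sum.inr_injective (ψ.injective (by rw [hg, hg, h])), fun y => ?_⟩
    obtain ⟨x | u, h⟩ := ψ.surjective (.inr y)
    · rw [hf] at h; cases h
    · exact ⟨u, Sum.inr_injective ((hg u).symm.trans h)⟩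
  refine ⟨Equiv.ofBijective f bf, Equiv.ofBijective g bg, ?_⟩
  ext (x | u)
  · exact hf x
  · exact hg u

theorem exists_sumCongr_unit {U V : Type} (ψ : Unit ⊕ U ≃ Unit ⊕ V) (h : ψ (.inl ()) = .inl ()) :
    ∃ u, ψ = Equiv.sumCongr (Equiv.refl Unit) u := by
  obtain ⟨σ, u, e⟩ := exists_sumCongr ψ (fun _ => ⟨(), h⟩) (fun u => by
    rcases hu : ψ (.inr u) with a | v
    · exact absurd (ψ.injective (hu.trans h.symm)) (by simp)
    · exact ⟨v, rfl⟩)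
  exact ⟨u, e.trans (by congr 1)⟩

/-- The change of coordinates is compatible with `fold`, so it preserves the two-point fibre and
permutes the one-point fibres. Only the order `σ` of the pair and the names `u` of the other circles
are free. -/
theorem Coord.unique {A B U V : Type} {π : A → B} {e : (Unit ⊕ Unit) ⊕ U ≃ A} {e' : Unit ⊕ U ≃ B}
    {f : (Unit ⊕ Unit) ⊕ V ≃ A} {f' : Unit ⊕ V ≃ B} (he : Coord π e e') (hf : Coord π f f') :
    ∃ (σ : Unit ⊕ Unit ≃ Unit ⊕ Unit) (u : U ≃ V), e = (Equiv.sumCongr σ u).trans f ∧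
      e' = (Equiv.sumCongr (Equiv.refl Unit) u).trans f' := by
  have key : ∀ s, fold (f.symm (e s)) = f'.symm (e' (fold s)) := fun s => by
    have h := hf (f.symm (e s))
    rw [Equiv.apply_symm_apply, he s] at h
    rw [h, Equiv.symm_apply_apply]
  have hl : ∀ i, ∃ j, f.symm (e (.inl i)) = .inl j := fun i => by
    rcases hi : f.symm (e (.inl i)) with j | v
    · exact ⟨j, rfl⟩
    · exfalso
      -- The other point of the pair has the same image under `fold`, whereas a point of the right
      -- summand is alone in its fibre.
      obtain ⟨i', hne⟩ : ∃ i' : Unit ⊕ Unit, i ≠ i' := by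
        rcases i with _ | _
        · exact ⟨.inr (), by simp⟩
        · exact ⟨.inl (), by simp⟩
      have h1 := key (.inl i)
      have h2 := key (.inl i')
      rw [hi] at h1
      rcases hi' : f.symm (e (.inl i')) with j | v'
      · rw [hi'] at h2
        have := h1.trans h2.symm
        cases this
      · rw [hi'] at h2
        have h3 : (Sum.inr v : Unit ⊕ V) = .inr v' := h1.trans h2.symm
        have h4 : v = v' := Sum.inr_injective h3
        rw [← h4, ← hi] at hi'
        exact hne (by simpa using hi'.symm)
  have hr : ∀ u, ∃ v, f.symm (e (.inr u)) = .inr v := fun u => by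
    rcases hu : f.symm (e (.inr u)) with j | v
    · exfalso
      obtain ⟨j', hj'⟩ := hl (.inl ())
      have h1 := key (.inr u)
      have h2 := key (.inl (.inl ()))
      rw [hu] at h1
      rw [hj'] at h2
      have h3 := h1.symm.trans h2
      have := e'.injective (f'.symm.injective h3)
      cases this
    · exact ⟨v, rfl⟩
  obtain ⟨σ, u, h⟩ := exists_sumCongr (e.trans f.symm) hl hr
  refine ⟨σ, u, ?_, ?_⟩
  · rw [← h]; ext; simp
  · have h' : ∀ s, f.symm (e s) = Equiv.sumCongr σ u s := fun s => by rw [← h]; rfl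
    ext (_ | w)
    · have := key (.inl (.inl ()))
      rw [h'] at this
      exact (Equiv.symm_apply_eq f').1 this.symm
    · have := key (.inr w)
      rw [h'] at this
      exact (Equiv.symm_apply_eq f').1 this.symm

theorem unit_sum_unit_equiv (σ : Unit ⊕ Unit ≃ Unit ⊕ Unit) :
    σ = Equiv.refl _ ∨ σ = Equiv.sumComm Unit Unit := by
  rcases h : σ (.inl ()) with _ | _ <;> rcases h' : σ (.inr ()) with _ | _
  · exact absurd (σ.injective (h.trans h'.symm)) (by simp)
  · left; ext (_ | _); exacts [h, h']
  · right; ext (_ | _); exacts [h, h']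
  · exact absurd (σ.injective (h.trans h'.symm)) (by simp)

/-! ### Pantsups and pantsdowns are determined by the merging map -/

namespace Cob

variable {R : Type u} [CommRing R] {A B C D T : Type}

/-- The pantsup. -/
def mul : Cob R (Unit ⊕ Unit) Unit := mk CobWord.mul

/-- The pantsdown. -/
def comul : Cob R Unit (Unit ⊕ Unit) := mk CobWord.comul

theorem perm_comp_mul (σ : Unit ⊕ Unit ≃ Unit ⊕ Unit) :
    (perm σ : Cob R _ _).comp mul = mul := by
  rcases unit_sum_unit_equiv σ with rfl | rfl
  · exact perm_refl_comp _
  · exact Quotient.sound CobRel.mul_comm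

theorem comul_comp_perm (σ : Unit ⊕ Unit ≃ Unit ⊕ Unit) :
    (comul : Cob R _ _).comp (perm σ) = comul := by
  rcases unit_sum_unit_equiv σ with rfl | rfl
  · exact comp_perm_refl _
  · exact Quotient.sound CobRel.comul_comm

theorem mul_assoc : ((mul : Cob R _ _).tensor (perm (Equiv.refl Unit))).comp mul =
    (perm (Equiv.sumAssoc Unit Unit Unit)).comp
      (((perm (Equiv.refl Unit)).tensor mul).comp mul) :=
  Quotient.sound CobRel.mul_assoc

theorem comul_assoc : ((comul : Cob R _ _).comp (comul.tensor (perm (Equiv.refl Unit)))).comp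
      (perm (Equiv.sumAssoc Unit Unit Unit)) =
    comul.comp ((perm (Equiv.refl Unit)).tensor comul) :=
  Quotient.sound CobRel.comul_assoc

theorem frobenius : (mul : Cob R _ _).comp comul =
    (comul.tensor (perm (Equiv.refl Unit))).comp ((perm (Equiv.sumAssoc Unit Unit Unit)).comp
      ((perm (Equiv.refl Unit)).tensor mul)) :=
  Quotient.sound CobRel.frobenius

/-- `m` is a pantsup merging the circles along `π`. -/
def IsMul (π : A → B) (m : Cob R A B) : Prop :=
  ∃ (U : Type) (_ : Finite U) (e : (Unit ⊕ Unit) ⊕ U ≃ A) (e' : Unit ⊕ U ≃ B),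
    Coord π e e' ∧ m = loc mul e.symm e'

/-- `m` is a pantsdown splitting the circles along `π`. -/
def IsComul (π : A → B) (m : Cob R B A) : Prop :=
  ∃ (U : Type) (_ : Finite U) (e : (Unit ⊕ Unit) ⊕ U ≃ A) (e' : Unit ⊕ U ≃ B),
    Coord π e e' ∧ m = loc comul e'.symm e

/-- By `Coord.unique` two coordinate systems differ by a permutation of the pair, which
commutativity of `mul` absorbs, and by a renaming of the cylinders. So a pantsup may be written in
any coordinates for `π`. -/
theorem IsMul.eq_loc {π : A → B} {m : Cob R A B} (h : IsMul π m) {V : Type} [Finite V]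
    {f : (Unit ⊕ Unit) ⊕ V ≃ A} {f' : Unit ⊕ V ≃ B} (hf : Coord π f f') :
    m = loc mul f.symm f' := by
  obtain ⟨U, _, e, e', he, rfl⟩ := h
  obtain ⟨σ, u, rfl, rfl⟩ := hf.unique he
  conv_lhs => rw [← perm_comp_mul σ.symm, loc_perm_comp, loc_congr_rest u.symm]
  congr 1
  ext x; simp

theorem IsComul.eq_loc {π : A → B} {m : Cob R B A} (h : IsComul π m) {V : Type} [Finite V]
    {f : (Unit ⊕ Unit) ⊕ V ≃ A} {f' : Unit ⊕ V ≃ B} (hf : Coord π f f') :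
    m = loc comul f'.symm f := by
  obtain ⟨U, _, e, e', he, rfl⟩ := h
  obtain ⟨σ, u, rfl, rfl⟩ := hf.unique he
  conv_lhs => rw [← comul_comp_perm σ, loc_comp_perm, loc_congr_rest u.symm]
  congr 1
  ext x; simp

end Cob

/-- The data of a square of merging maps: `f` and `k` merge the pair `x`, `y`, while `g` and `h`
merge the different pair `x'`, `y'`. -/
structure MergeSquare {T A D C : Type} (f : T → A) (g : T → D) (h : A → C) (k : D → C)
    (x y x' y' : T) : Prop where
  comm : ∀ t, h (f t) = k (g t)
  f_merge : IsMerge f x y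
  g_merge : IsMerge g x' y'
  h_merge : IsMerge h (f x') (f y')
  k_merge : IsMerge k (g x) (g y)

namespace MergeSquare

variable {T A D C : Type} {f : T → A} {g : T → D} {h : A → C} {k : D → C} {x y x' y' : T}

theorem symm_left (S : MergeSquare f g h k x y x' y') : MergeSquare f g h k y x x' y' :=
  ⟨S.comm, S.f_merge.symm, S.g_merge, S.h_merge, S.k_merge.symm⟩

theorem symm_right (S : MergeSquare f g h k x y x' y') : MergeSquare f g h k x y y' x' :=
  ⟨S.comm, S.f_merge, S.g_merge.symm, S.h_merge.symm, S.k_merge⟩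

/-- Coordinates for a square merging two disjoint pairs. -/
theorem exists_coord_disjoint (S : MergeSquare f g h k x y x' y') (h1 : x ≠ x') (h2 : x ≠ y')
    (h3 : y ≠ x') (h4 : y ≠ y') [Finite T] :
    ∃ (U : Type) (_ : Finite U) (eT : (Unit ⊕ Unit) ⊕ ((Unit ⊕ Unit) ⊕ U) ≃ T)
      (eA : Unit ⊕ ((Unit ⊕ Unit) ⊕ U) ≃ A) (eD : (Unit ⊕ Unit) ⊕ (Unit ⊕ U) ≃ D)
      (eC : Unit ⊕ (Unit ⊕ U) ≃ C),
      (∀ s, f (eT s) = eA (fold s)) ∧ (∀ s, g (eT s) = eD (Sum.map id fold s)) ∧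
      (∀ s, h (eA s) = eC (Sum.map id fold s)) ∧ (∀ s, k (eD s) = eC (fold s)) := by
  let U : Type := {c : T // c ≠ x ∧ c ≠ y ∧ c ≠ x' ∧ c ≠ y'}
  let pT : (Unit ⊕ Unit) ⊕ ((Unit ⊕ Unit) ⊕ U) → T := Sum.elim (Sum.elim (fun _ => x) fun _ => y)
    (Sum.elim (Sum.elim (fun _ => x') fun _ => y') Subtype.val)
  let pA : Unit ⊕ ((Unit ⊕ Unit) ⊕ U) → A := Sum.elim (fun _ => f x)
    (Sum.elim (Sum.elim (fun _ => f x') fun _ => f y') fun u => f u)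
  let pD : (Unit ⊕ Unit) ⊕ (Unit ⊕ U) → D := Sum.elim (Sum.elim (fun _ => g x) fun _ => g y)
    (Sum.elim (fun _ => g x') fun u => g u)
  let pC : Unit ⊕ (Unit ⊕ U) → C := Sum.elim (fun _ => h (f x))
    (Sum.elim (fun _ => h (f x')) fun u => h (f u))
  have n1 := S.f_merge.ne
  have n2 := S.g_merge.ne
  have cases : ∀ t, ∃ s, pT s = t := fun t => by
    by_cases c1 : t = x
    · exact ⟨.inl (.inl ()), c1.symm⟩
    by_cases c2 : t = y
    · exact ⟨.inl (.inr ()), c2.symm⟩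
    by_cases c3 : t = x'
    · exact ⟨.inr (.inl (.inl ())), c3.symm⟩
    by_cases c4 : t = y'
    · exact ⟨.inr (.inl (.inr ())), c4.symm⟩
    exact ⟨.inr (.inr ⟨t, c1, c2, c3, c4⟩), rfl⟩
  have fA : ∀ s, f (pT s) = pA (fold s) := by
    rintro ((_ | _) | (_ | _) | u)
    exacts [rfl, S.f_merge.eq.symm, rfl, rfl, rfl]
  have fD : ∀ s, g (pT s) = pD (Sum.map id fold s) := by
    rintro ((_ | _) | (_ | _) | u)
    exacts [rfl, rfl, rfl, S.g_merge.eq.symm, rfl]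
  have fC : ∀ s, h (pA s) = pC (Sum.map id fold s) := by
    rintro (_ | (_ | _) | u)
    exacts [rfl, rfl, S.h_merge.eq.symm, rfl]
  have fC' : ∀ s, k (pD s) = pC (fold s) := by
    rintro ((_ | _) | _ | u)
    exacts [(S.comm x).symm, (S.k_merge.eq.symm.trans (S.comm x).symm), (S.comm x').symm,
      (S.comm u).symm]
  have bT : Function.Bijective pT := by
    refine ⟨?_, cases⟩
    rintro ((_ | _) | (_ | _) | ⟨u, u1, u2, u3, u4⟩) ((_ | _) | (_ | _) | ⟨v, v1, v2, v3, v4⟩) e <;>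
      simp only [pT, Sum.elim_inl, Sum.elim_inr] at e <;> grind
  have bA : Function.Bijective pA := by
    refine ⟨?_, fun a => ?_⟩
    · rintro (_ | (_ | _) | ⟨u, u1, u2, u3, u4⟩) (_ | (_ | _) | ⟨v, v1, v2, v3, v4⟩) e <;>
        simp only [pA, Sum.elim_inl, Sum.elim_inr, S.f_merge.ker] at e <;> grind
    · obtain ⟨t, rfl⟩ := S.f_merge.surj a
      obtain ⟨s, rfl⟩ := cases t
      exact ⟨_, (fA s).symm⟩
  have bD : Function.Bijective pD := by
    refine ⟨?_, fun a => ?_⟩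
    · rintro ((_ | _) | _ | ⟨u, u1, u2, u3, u4⟩) ((_ | _) | _ | ⟨v, v1, v2, v3, v4⟩) e <;>
        simp only [pD, Sum.elim_inl, Sum.elim_inr, S.g_merge.ker] at e <;> grind
    · obtain ⟨t, rfl⟩ := S.g_merge.surj a
      obtain ⟨s, rfl⟩ := cases t
      exact ⟨_, (fD s).symm⟩
  have bC : Function.Bijective pC := by
    refine ⟨?_, fun a => ?_⟩
    · rintro (_ | _ | ⟨u, u1, u2, u3, u4⟩) (_ | _ | ⟨v, v1, v2, v3, v4⟩) e <;>
        simp only [pC, Sum.elim_inl, Sum.elim_inr, S.h_merge.ker, S.f_merge.ker] at e <;> grind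
    · obtain ⟨t, rfl⟩ := S.h_merge.surj a
      obtain ⟨s, rfl⟩ := bA.2 t
      exact ⟨_, (fC s).symm⟩
  exact ⟨U, inferInstance, Equiv.ofBijective pT bT, Equiv.ofBijective pA bA,
    Equiv.ofBijective pD bD, Equiv.ofBijective pC bC, fA, fD, fC, fC'⟩

/-- Coordinates for a square merging two pairs with a common element. -/
theorem exists_coord_common {x y z : T} (S : MergeSquare f g h k x y y z) (hne : x ≠ z) [Finite T] :
    ∃ (U : Type) (_ : Finite U) (eT : ((Unit ⊕ Unit) ⊕ Unit) ⊕ U ≃ T)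
      (eA : (Unit ⊕ Unit) ⊕ U ≃ A) (eD : (Unit ⊕ Unit) ⊕ U ≃ D) (eC : Unit ⊕ U ≃ C),
      (∀ s, f (eT s) = eA (Sum.map fold id s)) ∧
      (∀ s, g (eT s) = eD (Sum.map (Sum.map id (fun _ => ()) ∘ Equiv.sumAssoc _ _ _) id s)) ∧
      (∀ s, h (eA s) = eC (fold s)) ∧ (∀ s, k (eD s) = eC (fold s)) := by
  let U : Type := {c : T // c ≠ x ∧ c ≠ y ∧ c ≠ z}
  let pT : ((Unit ⊕ Unit) ⊕ Unit) ⊕ U → T :=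
    Sum.elim (Sum.elim (Sum.elim (fun _ => x) fun _ => y) fun _ => z) Subtype.val
  let pA : (Unit ⊕ Unit) ⊕ U → A := Sum.elim (Sum.elim (fun _ => f x) fun _ => f z) fun u => f u
  let pD : (Unit ⊕ Unit) ⊕ U → D := Sum.elim (Sum.elim (fun _ => g x) fun _ => g z) fun u => g u
  let pC : Unit ⊕ U → C := Sum.elim (fun _ => h (f x)) fun u => h (f u)
  have n1 := S.f_merge.ne
  have n2 := S.g_merge.ne
  have cases : ∀ t, ∃ s, pT s = t := fun t => by
    by_cases c1 : t = x
    · exact ⟨.inl (.inl (.inl ())), c1.symm⟩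
    by_cases c2 : t = y
    · exact ⟨.inl (.inl (.inr ())), c2.symm⟩
    by_cases c3 : t = z
    · exact ⟨.inl (.inr ()), c3.symm⟩
    exact ⟨.inr ⟨t, c1, c2, c3⟩, rfl⟩
  have fA : ∀ s, f (pT s) = pA (Sum.map fold id s) := by
    rintro (((_ | _) | _) | u)
    exacts [rfl, S.f_merge.eq.symm, rfl, rfl]
  have fD : ∀ s, g (pT s) =
      pD (Sum.map (Sum.map id (fun _ => ()) ∘ Equiv.sumAssoc _ _ _) id s) := by
    rintro (((_ | _) | _) | u)
    exacts [rfl, S.g_merge.eq, rfl, rfl]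
  have fC : ∀ s, h (pA s) = pC (fold s) := by
    rintro ((_ | _) | u)
    exacts [rfl, S.h_merge.eq.symm.trans (congrArg h S.f_merge.eq.symm), rfl]
  have fC' : ∀ s, k (pD s) = pC (fold s) := by
    rintro ((_ | _) | u)
    exacts [(S.comm x).symm, (congrArg k S.g_merge.eq.symm).trans
      (S.k_merge.eq.symm.trans (S.comm x).symm),
      (S.comm u).symm]
  have bT : Function.Bijective pT := by
    refine ⟨?_, cases⟩
    rintro (((_ | _) | _) | ⟨u, u1, u2, u3⟩) (((_ | _) | _) | ⟨v, v1, v2, v3⟩) e <;>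
      simp only [pT, Sum.elim_inl, Sum.elim_inr] at e <;> grind
  have bA : Function.Bijective pA := by
    refine ⟨?_, fun a => ?_⟩
    · rintro ((_ | _) | ⟨u, u1, u2, u3⟩) ((_ | _) | ⟨v, v1, v2, v3⟩) e <;>
        simp only [pA, Sum.elim_inl, Sum.elim_inr, S.f_merge.ker] at e <;> grind
    · obtain ⟨t, rfl⟩ := S.f_merge.surj a
      obtain ⟨s, rfl⟩ := cases t
      exact ⟨_, (fA s).symm⟩
  have bD : Function.Bijective pD := by
    refine ⟨?_, fun a => ?_⟩
    · rintro ((_ | _) | ⟨u, u1, u2, u3⟩) ((_ | _) | ⟨v, v1, v2, v3⟩) e <;>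
        simp only [pD, Sum.elim_inl, Sum.elim_inr, S.g_merge.ker] at e <;> grind
    · obtain ⟨t, rfl⟩ := S.g_merge.surj a
      obtain ⟨s, rfl⟩ := cases t
      exact ⟨_, (fD s).symm⟩
  have bC : Function.Bijective pC := by
    refine ⟨?_, fun a => ?_⟩
    · rintro (_ | ⟨u, u1, u2, u3⟩) (_ | ⟨v, v1, v2, v3⟩) e <;>
        simp only [pC, Sum.elim_inl, Sum.elim_inr, S.h_merge.ker, S.f_merge.ker] at e <;> grind
    · obtain ⟨t, rfl⟩ := S.h_merge.surj a
      obtain ⟨s, rfl⟩ := bA.2 t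
      exact ⟨_, (fC s).symm⟩
  exact ⟨U, inferInstance, Equiv.ofBijective pT bT, Equiv.ofBijective pA bA,
    Equiv.ofBijective pD bD, Equiv.ofBijective pC bC, fA, fD, fC, fC'⟩

/-- The two pairs merged in a square are different. -/
theorem pairs_ne (S : MergeSquare f g h k x y x' y') :
    ¬ (x = x' ∧ y = y') ∧ ¬ (x = y' ∧ y = x') := by
  have := S.h_merge.ne
  have e := S.f_merge.eq
  constructor
  · rintro ⟨rfl, rfl⟩
    exact this e
  · rintro ⟨rfl, rfl⟩
    exact this e.symm

/-- Up to the order of the merged pairs, a square merges two disjoint pairs or two pairs with a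
common element. -/
theorem induction {P : T → T → T → T → Prop} (S : MergeSquare f g h k x y x' y')
    (left : ∀ x y x' y', P x y x' y' → P y x x' y') (right : ∀ x y x' y', P x y x' y' → P x y y' x')
    (disjoint : x ≠ x' → x ≠ y' → y ≠ x' → y ≠ y' → P x y x' y')
    (common : ∀ x y z, MergeSquare f g h k x y y z → x ≠ z → P x y y z) : P x y x' y' := by
  have n := S.pairs_ne
  by_cases h1 : x = x'
  · subst h1
    exact left _ _ _ _ (common _ _ _ S.symm_left fun e => n.1 ⟨rfl, e⟩)
  by_cases h2 : x = y'
  · subst h2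
    exact left _ _ _ _ (right _ _ _ _ (common _ _ _ S.symm_left.symm_right fun e => n.2 ⟨rfl, e⟩))
  by_cases h3 : y = x'
  · subst h3
    exact common _ _ _ S h2
  by_cases h4 : y = y'
  · subst h4
    exact right _ _ _ _ (common _ _ _ S.symm_right h1)
  exact disjoint h1 h2 h3 h4

end MergeSquare

/-! ### Pants in the coordinates of a merge square -/

namespace Cob

variable {R : Type u} [CommRing R] {A B C D T U W : Type} [Finite U] [Finite W]

/-- Puts the second of two disjoint pairs beside the idle circles `W`, in the shape required by
`loc_interchange`. -/
theorem IsMul.eq_loc_right {π : A → B} {m : Cob R A B} (hm : IsMul π m)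
    (e : W ⊕ ((Unit ⊕ Unit) ⊕ U) ≃ A) (e' : W ⊕ (Unit ⊕ U) ≃ B)
    (h : ∀ s, π (e s) = e' (Sum.map id fold s)) :
    m = loc ((perm (Equiv.refl W)).tensor mul) (e.symm.trans (Equiv.sumAssoc _ _ _).symm)
      ((Equiv.sumAssoc _ _ _).trans e') := by
  rw [loc_perm_tensor]
  refine hm.eq_loc (f := (((e.symm.trans (Equiv.sumAssoc _ _ _).symm).trans (Equiv.sumCongr
    (Equiv.sumComm W (Unit ⊕ Unit)) (Equiv.refl U))).trans (Equiv.sumAssoc _ W U)).symm) ?_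
  rintro ((_ | _) | w | u)
  exacts [h (.inr (.inl (.inl ()))), h (.inr (.inl (.inr ()))), h (.inl w), h (.inr (.inr u))]

theorem IsComul.eq_loc_right {π : A → B} {m : Cob R B A} (hm : IsComul π m)
    (e : W ⊕ ((Unit ⊕ Unit) ⊕ U) ≃ A) (e' : W ⊕ (Unit ⊕ U) ≃ B)
    (h : ∀ s, π (e s) = e' (Sum.map id fold s)) :
    m = loc ((perm (Equiv.refl W)).tensor comul) (e'.symm.trans (Equiv.sumAssoc _ _ _).symm)
      ((Equiv.sumAssoc _ _ _).trans e) := by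
  rw [loc_perm_tensor]
  refine hm.eq_loc (f' := (((e'.symm.trans (Equiv.sumAssoc _ _ _).symm).trans (Equiv.sumCongr
    (Equiv.sumComm W Unit) (Equiv.refl U))).trans (Equiv.sumAssoc _ W U)).symm) ?_
  rintro ((_ | _) | w | u)
  exacts [h (.inr (.inl (.inl ()))), h (.inr (.inl (.inr ()))), h (.inl w), h (.inr (.inr u))]

theorem IsMul.eq_loc_first {π : A → B} {m : Cob R A B} (hm : IsMul π m)
    (e : ((Unit ⊕ Unit) ⊕ Unit) ⊕ U ≃ A) (e' : (Unit ⊕ Unit) ⊕ U ≃ B)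
    (h : ∀ s, π (e s) = e' (Sum.map fold id s)) :
    m = loc (mul.tensor (perm (Equiv.refl Unit))) e.symm e' := by
  rw [loc_tensor_perm]
  refine hm.eq_loc (f := (e.symm.trans (Equiv.sumAssoc _ _ _)).symm) ?_
  rintro ((_ | _) | _ | u)
  exacts [h (.inl (.inl (.inl ()))), h (.inl (.inl (.inr ()))), h (.inl (.inr ())), h (.inr u)]

theorem IsComul.eq_loc_first {π : A → B} {m : Cob R B A} (hm : IsComul π m)
    (e : ((Unit ⊕ Unit) ⊕ Unit) ⊕ U ≃ A) (e' : (Unit ⊕ Unit) ⊕ U ≃ B)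
    (h : ∀ s, π (e s) = e' (Sum.map fold id s)) :
    m = loc (comul.tensor (perm (Equiv.refl Unit))) e'.symm e := by
  rw [loc_tensor_perm]
  refine hm.eq_loc (f' := (e'.symm.trans (Equiv.sumAssoc _ _ _)).symm) ?_
  rintro ((_ | _) | _ | u)
  exacts [h (.inl (.inl (.inl ()))), h (.inl (.inl (.inr ()))), h (.inl (.inr ())), h (.inr u)]

/-- The form with `Equiv.sumAssoc` in front is the one occurring in both `mul_assoc` and
`frobenius`. -/
theorem IsMul.eq_loc_last {π : A → B} {m : Cob R A B} (hm : IsMul π m)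
    (e : ((Unit ⊕ Unit) ⊕ Unit) ⊕ U ≃ A) (e' : (Unit ⊕ Unit) ⊕ U ≃ B)
    (h : ∀ s, π (e s) = e' (Sum.map (Sum.map id (fun _ => ()) ∘ Equiv.sumAssoc _ _ _) id s)) :
    m = loc ((perm (Equiv.sumAssoc _ _ _)).comp ((perm (Equiv.refl Unit)).tensor mul))
      e.symm e' := by
  rw [loc_perm_comp, loc_perm_tensor]
  refine hm.eq_loc (f := (((e.symm.trans (Equiv.sumCongr (Equiv.sumAssoc _ _ _)
    (Equiv.refl U))).trans (Equiv.sumCongr (Equiv.sumComm Unit (Unit ⊕ Unit))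
    (Equiv.refl U))).trans (Equiv.sumAssoc _ _ U)).symm) ?_
  rintro ((_ | _) | _ | u)
  exacts [h (.inl (.inl (.inr ()))), h (.inl (.inr ())), h (.inl (.inl (.inl ()))), h (.inr u)]

theorem IsComul.eq_loc_last {π : A → B} {m : Cob R B A} (hm : IsComul π m)
    (e : ((Unit ⊕ Unit) ⊕ Unit) ⊕ U ≃ A) (e' : (Unit ⊕ Unit) ⊕ U ≃ B)
    (h : ∀ s, π (e s) = e' (Sum.map (Sum.map id (fun _ => ()) ∘ Equiv.sumAssoc _ _ _) id s)) :
    m = loc (((perm (Equiv.refl Unit)).tensor comul).comp (perm (Equiv.sumAssoc _ _ _).symm))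
      e'.symm e := by
  rw [loc_comp_perm, loc_perm_tensor]
  refine hm.eq_loc (f' := ((e'.symm.trans (Equiv.sumCongr (Equiv.sumComm Unit Unit)
    (Equiv.refl U))).trans (Equiv.sumAssoc _ _ U)).symm) ?_
  rintro ((_ | _) | _ | u)
  exacts [h (.inl (.inl (.inr ()))), h (.inl (.inr ())), h (.inl (.inl (.inl ()))), h (.inr u)]

end Cob

/-! ### Commutation of pants along a merge square -/

namespace MergeSquare
open Cob

variable {R : Type u} [CommRing R] {T A D C : Type} {f : T → A} {g : T → D} {h : A → C} {k : D → C}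
  {x y x' y' : T} [Finite T]

theorem mul_mul [Finite A] [Finite D] (S : MergeSquare f g h k x y x' y') {mf : Cob R T A}
    {mg : Cob R T D}
    {mh : Cob R A C} {mk : Cob R D C} (hf : IsMul f mf) (hg : IsMul g mg) (hh : IsMul h mh)
    (hk : IsMul k mk) : mf.comp mh = mg.comp mk := by
  -- The claim does not mention the merged points, so reordering the pairs is free. Disjoint pairs
  -- reduce to the interchange law, a common circle to associativity.
  refine S.induction (P := fun _ _ _ _ => mf.comp mh = mg.comp mk) (fun _ _ _ _ => id)
    (fun _ _ _ _ => id) (fun h1 h2 h3 h4 => ?_) fun x y z S hne => ?_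
  · obtain ⟨U, _, eT, eA, eD, eC, cf, cg, ch, ck⟩ := S.exists_coord_disjoint h1 h2 h3 h4
    rw [hf.eq_loc cf, hg.eq_loc_right _ _ cg, hh.eq_loc_right _ _ ch, hk.eq_loc ck]
    exact loc_interchange mul mul eT.symm eD.symm eA.symm eC
  · obtain ⟨U, _, eT, eA, eD, eC, cf, cg, ch, ck⟩ := S.exists_coord_common hne
    rw [hf.eq_loc_first _ _ cf, hg.eq_loc_last _ _ cg, hh.eq_loc ch, hk.eq_loc ck]
    refine (loc_comp_loc _ _ _ eA.symm _).trans (.trans ?_ (loc_comp_loc _ _ _ eD.symm _).symm)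
    rw [Cob.mul_assoc, comp_assoc]

theorem comul_comul [Finite A] [Finite D] (S : MergeSquare f g h k x y x' y') {mf : Cob R A T}
    {mg : Cob R D T}
    {mh : Cob R C A} {mk : Cob R C D} (hf : IsComul f mf) (hg : IsComul g mg) (hh : IsComul h mh)
    (hk : IsComul k mk) : mh.comp mf = mk.comp mg := by
  refine S.induction (P := fun _ _ _ _ => mh.comp mf = mk.comp mg) (fun _ _ _ _ => id)
    (fun _ _ _ _ => id) (fun h1 h2 h3 h4 => ?_) fun x y z S hne => ?_
  · obtain ⟨U, _, eT, eA, eD, eC, cf, cg, ch, ck⟩ := S.exists_coord_disjoint h1 h2 h3 h4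
    rw [hf.eq_loc cf, hg.eq_loc_right _ _ cg, hh.eq_loc_right _ _ ch, hk.eq_loc ck]
    exact (loc_interchange comul comul eC.symm eA.symm eD.symm eT).symm
  · obtain ⟨U, _, eT, eA, eD, eC, cf, cg, ch, ck⟩ := S.exists_coord_common hne
    rw [hf.eq_loc_first _ _ cf, hg.eq_loc_last _ _ cg, hh.eq_loc ch, hk.eq_loc ck]
    refine (loc_comp_loc _ _ _ eA.symm _).trans (.trans ?_ (loc_comp_loc _ _ _ eD.symm _).symm)
    rw [← comp_assoc, ← comul_assoc]
    simp only [comp_assoc, perm_comp, Equiv.self_trans_symm, comp_perm_refl]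

/-- Here `T`, the corner with the most circles, is in the middle of one path. For disjoint pairs the
claim is the interchange law, for a common circle the Frobenius relation. -/
theorem comul_mul [Finite C] (S : MergeSquare f g h k x y x' y') {df : Cob R A T} {mg : Cob R T D}
    {mh : Cob R A C} {dk : Cob R C D} (hf : IsComul f df) (hg : IsMul g mg) (hh : IsMul h mh)
    (hk : IsComul k dk) : df.comp mg = mh.comp dk := by
  refine S.induction (P := fun _ _ _ _ => df.comp mg = mh.comp dk) (fun _ _ _ _ => id)
    (fun _ _ _ _ => id) (fun h1 h2 h3 h4 => ?_) fun x y z S hne => ?_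
  · obtain ⟨U, _, eT, eA, eD, eC, cf, cg, ch, ck⟩ := S.exists_coord_disjoint h1 h2 h3 h4
    rw [hf.eq_loc cf, hg.eq_loc_right _ _ cg, hh.eq_loc_right _ _ ch, hk.eq_loc ck]
    exact loc_interchange comul mul eA.symm eC.symm eT.symm eD
  · obtain ⟨U, _, eT, eA, eD, eC, cf, cg, ch, ck⟩ := S.exists_coord_common hne
    rw [hf.eq_loc_first _ _ cf, hg.eq_loc_last _ _ cg, hh.eq_loc ch, hk.eq_loc ck]
    refine (loc_comp_loc _ _ _ eT.symm _).trans (.trans ?_ (loc_comp_loc _ _ _ eC.symm _).symm)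
    rw [Cob.frobenius]

end MergeSquare

/-! ### Handles and bridges -/

namespace Cob

variable {R : Type u} [CommRing R] {A B C D : Type} [Finite B] [Finite C]

/-- Splitting a circle and merging the two parts adds a handle to this circle. -/
theorem comul_mul_of_handle [Finite A] {f : B → A} {g : B → D} {f' : C → A} {g' : C → D} {x y : B}
    {x' y' : C}
    (hf : IsMerge f x y) (hf' : IsMerge f' x' y') (e : f x = f' x') (θ : A ≃ D)
    (hg : ∀ c, g c = θ (f c)) (hg' : ∀ c, g' c = θ (f' c)) {d : Cob R A B} {m : Cob R B D}
    {d' : Cob R A C} {m' : Cob R C D} (hd : IsComul f d) (hm : IsMul g m) (hd' : IsComul f' d')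
    (hm' : IsMul g' m') : d.comp m = d'.comp m' := by
  -- The composite is `comul` followed by `mul` on the circle `f x`, with cylinders elsewhere. The
  -- intermediate family `B` disappears from the description.
  have key : ∀ {B : Type} [Finite B] {f : B → A} {g : B → D} {x y : B} {d : Cob R A B}
      {m : Cob R B D}, IsMerge f x y → (∀ c, g c = θ (f c)) → IsComul f d → IsMul g m →
      ∃ (U : Type) (_ : Finite U) (a : Unit ⊕ U ≃ A), a (.inl ()) = f x ∧
        d.comp m = loc (comul.comp mul) a.symm (a.trans θ) := by
    intro B _ f g x y d m hf hg hd hm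
    obtain ⟨U, _, e, e', c, rfl⟩ := hd
    have cg : Coord g e (e'.trans θ) := fun s => (hg _).trans (congrArg θ (c s))
    refine ⟨U, inferInstance, e', ?_, ?_⟩
    · have h1 : f (e (.inl (.inl ()))) = f (e (.inl (.inr ()))) := 
        (c _).trans (c (.inl (.inr ()))).symm
      have h2 := (c (.inl (.inl ()))).symm
      refine h2.trans ?_
      rcases (hf.ker _ _).1 h1 with h | ⟨h, -⟩ | ⟨h, -⟩
      · cases e.injective h
      · rw [h]
      · rw [h, hf.eq]
    · rw [hm.eq_loc cg]
      exact loc_comp_loc _ _ _ e.symm _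
  obtain ⟨U, _, a, ha, h1⟩ := key hf hg hd hm
  obtain ⟨V, _, b, hb, h2⟩ := key hf' hg' hd' hm'
  rw [h1, h2]
  -- Both coordinate systems mark the same circle of `A`, so they differ by a renaming of the other
  -- circles.
  obtain ⟨u, hu⟩ := exists_sumCongr_unit (a.trans b.symm) (by simp [ha, e, ← hb])
  rw [loc_congr_rest u, ← hu]
  congr 1 <;> ext <;> simp

/-- Merging two circles and splitting the result. -/
theorem mul_comul_of_equiv {f : A → B} {k : D → B} {f' : A → C} {k' : D → C} (ψ : B ≃ C)
    (hf : ∀ c, f' c = ψ (f c)) (hk : ∀ c, k' c = ψ (k c)) {m : Cob R A B} {d : Cob R B D}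
    {m' : Cob R A C} {d' : Cob R C D} (hm : IsMul f m) (hd : IsComul k d) (hm' : IsMul f' m')
    (hd' : IsComul k' d') : m.comp d = m'.comp d' := by
  obtain ⟨U, _, e, e', c, rfl⟩ := hm
  obtain ⟨V, _, a, a', c', rfl⟩ := hd
  have h1 : Coord f' e (e'.trans ψ) := fun s => (hf _).trans (congrArg ψ (c s))
  have h2 : Coord k' a (a'.trans ψ) := fun s => (hk _).trans (congrArg ψ (c' s))
  rw [hm'.eq_loc h1, hd'.eq_loc h2]
  unfold loc
  simp only [comp_assoc, perm_comp_assoc]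
  congr 4
  ext; simp

end Cob

/-! ### Moving decorations through pants -/

namespace Cob

variable {R : Type u} [CommRing R] {A B X Y U : Type}

/-- Decorations slide along the permutations. At the generator those above and below stay separate;
along a cylinder only their sum modulo two survives. -/
theorem cyl_comp_loc_comp_cyl [Finite A] [Finite B] [Finite X] [Finite Y] [Finite U]
    (g : Cob R X Y) (e : A ≃ X ⊕ U)
    (e' : Y ⊕ U ≃ B) (w : A → Bool) (w' : B → Bool) :
    (cyl (Equiv.refl A) w).comp ((loc g e e').comp (cyl (Equiv.refl B) w')) =
      (perm e).comp ((((cyl (Equiv.refl X) fun x => w (e.symm (.inl x))).comp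
        (g.comp (cyl (Equiv.refl Y) fun y => w' (e' (.inl y))))).tensor
          (cyl (Equiv.refl U) fun u => xor (w (e.symm (.inr u))) (w' (e' (.inr u))))).comp
        (perm e')) := by
  have h1 : (cyl (Equiv.refl A) w : Cob R A A).comp (perm e) =
      (perm e).comp ((cyl (Equiv.refl X) fun x => w (e.symm (.inl x))).tensor
        (cyl (Equiv.refl U) fun u => w (e.symm (.inr u)))) := by
    rw [cyl_tensor]
    refine (cyl_comp _ _ _ _).trans (.trans ?_ (cyl_comp _ _ _ _).symm)
    congr 1
    · ext a; simp
    · funext a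
      obtain ⟨s, rfl⟩ := e.symm.surjective a
      rcases s with x | u <;> simp
  have h2 : (perm e' : Cob R _ _).comp (cyl (Equiv.refl B) w') =
      ((cyl (Equiv.refl Y) fun y => w' (e' (.inl y))).tensor
        (cyl (Equiv.refl U) fun u => w' (e' (.inr u)))).comp (perm e') := by
    rw [cyl_tensor]
    refine (cyl_comp _ _ _ _).trans (.trans ?_ (cyl_comp _ _ _ _).symm)
    congr 1
    · ext s; rcases s with x | u <;> rfl
    · funext s
      rcases s with x | u <;> simp
  have h3 : (cyl (Equiv.refl U) fun u => xor (w (e.symm (.inr u))) (w' (e' (.inr u))) : Cob R _ _) =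
      (cyl (Equiv.refl U) fun u => w (e.symm (.inr u))).comp ((perm (Equiv.refl U)).comp
        (cyl (Equiv.refl U) fun u => w' (e' (.inr u)))) := by
    rw [perm_refl_comp, cyl_comp]
    rfl
  rw [h3, tensor_comp, tensor_comp]
  unfold loc
  rw [comp_assoc, comp_assoc, h2, ← comp_assoc, h1]
  simp only [comp_assoc]

theorem cyl_true_tensor : (cyl (Equiv.refl Unit) fun _ => true : Cob R _ _).tensor
    (cyl (Equiv.refl Unit) fun _ => true) = cyl (Equiv.refl _) fun _ => true := by
  refine (cyl_tensor _ _ _ _).trans ?_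
  congr 1
  · ext x; cases x <;> rfl
  · funext x; cases x <;> rfl

theorem cyl_true_comp_self [Finite X] (f : Cob R X Y) :
    (cyl (Equiv.refl X) fun _ => true).comp ((cyl (Equiv.refl X) fun _ => true).comp f) = f := by
  rw [← comp_assoc, cyl_comp]
  exact perm_refl_comp f

theorem cyl_xor_true [Finite X] (v : X → Bool) :
    (cyl (Equiv.refl X) fun i => xor (v i) true : Cob R X X) =
      (cyl (Equiv.refl _) v).comp (cyl (Equiv.refl _) fun _ => true) := by
  rw [cyl_comp]; rfl

theorem cyl_xor_true' [Finite X] (v : X → Bool) :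
    (cyl (Equiv.refl X) fun i => xor (v i) true : Cob R X X) =
      (cyl (Equiv.refl _) fun _ => true).comp (cyl (Equiv.refl _) v) := by
  rw [cyl_comp]
  congr 1
  funext i
  exact Bool.xor_comm _ _

/-- `Φ` at all three ends of a pantsup cancels, by `CobRel.mul_phi` and `ΦΦ = Id`. -/
theorem cyl_comp_mul_comp_cyl (w : Unit ⊕ Unit → Bool) (η : Bool) (w' : Unit → Bool) :
    (cyl (Equiv.refl _) fun i => xor (w i) η).comp ((mul : Cob R _ _).comp
      (cyl (Equiv.refl _) fun i => xor (w' i) η)) =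
    (cyl (Equiv.refl _) w).comp (mul.comp (cyl (Equiv.refl _) w')) := by
  cases η
  · simp
  have h : (mul : Cob R _ _).comp (cyl (Equiv.refl _) fun _ => true) =
      ((cyl (Equiv.refl Unit) fun _ => true).tensor (cyl (Equiv.refl Unit) fun _ => true)).comp
        mul := Quotient.sound CobRel.mul_phi
  rw [cyl_true_tensor] at h
  rw [cyl_xor_true, cyl_xor_true', ← comp_assoc mul, h]
  simp only [comp_assoc, cyl_true_comp_self]

/-- The same cancellation for a pantsdown costs the sign in `CobRel.phi_comul`. This is the source
of the crossing signs in `virtualSign`. -/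
theorem cyl_comp_comul_comp_cyl (w : Unit → Bool) (η : Bool) (w' : Unit ⊕ Unit → Bool) :
    (cyl (Equiv.refl _) fun i => xor (w i) η).comp ((comul : Cob R _ _).comp
      (cyl (Equiv.refl _) fun i => xor (w' i) η)) =
    (if η then (-1 : R) else 1) •
      (cyl (Equiv.refl _) w).comp (comul.comp (cyl (Equiv.refl _) w')) := by
  cases η
  · simp
  have h : (cyl (Equiv.refl _) fun _ => true).comp (comul : Cob R _ _) =
      (-1 : R) • comul.comp ((cyl (Equiv.refl Unit) fun _ => true).tensor
        (cyl (Equiv.refl Unit) fun _ => true)) := Quotient.sound CobRel.phi_comul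
  rw [cyl_true_tensor] at h
  rw [cyl_xor_true, cyl_xor_true', comp_assoc, ← comp_assoc (cyl _ fun _ => true) comul, h]
  simp only [comp_assoc, smul_comp, comp_smul, cyl_true_comp_self, if_true]

/-- A common change `η` at all three circles of the pantsup is invisible, and on an unaffected
circle only the sum of the decorations above and below matters. -/
theorem IsMul.change_decoration [Finite A] [Finite B] {π : A → B} {x y : A} (hπ : IsMerge π x y)
    {m : Cob R A B} (hm : IsMul π m) (η : Bool) {w v : A → Bool} {w' v' : B → Bool}
    (hx : w x = xor (v x) η) (hy : w y = xor (v y) η) (hxy : w' (π x) = xor (v' (π x)) η)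
    (hc : ∀ c, c ≠ x → c ≠ y → xor (w c) (w' (π c)) = xor (v c) (v' (π c))) :
    (cyl (Equiv.refl A) w).comp (m.comp (cyl (Equiv.refl B) w')) =
      (cyl (Equiv.refl A) v).comp (m.comp (cyl (Equiv.refl B) v')) := by
  obtain ⟨U, _, e, e', c, rfl⟩ := hm
  obtain ⟨h1, h2, h3⟩ := c.pair hπ
  rw [cyl_comp_loc_comp_cyl, cyl_comp_loc_comp_cyl, ← cyl_comp_mul_comp_cyl _ η]
  congr 2
  congr 1
  · congr 2
    · funext i
      rcases h1 i with h | h <;> simp [h, hx, hy]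
    · congr 2
      funext i
      simp [← h2, hxy]
  · congr 1
    funext u
    have := hc _ (h3 u).1 (h3 u).2
    rw [c] at this
    exact this

theorem IsComul.change_decoration [Finite A] [Finite B] {π : A → B} {x y : A} (hπ : IsMerge π x y)
    {m : Cob R B A} (hm : IsComul π m) (η : Bool) {w v : A → Bool} {w' v' : B → Bool}
    (hx : w x = xor (v x) η) (hy : w y = xor (v y) η) (hxy : w' (π x) = xor (v' (π x)) η)
    (hc : ∀ c, c ≠ x → c ≠ y → xor (w' (π c)) (w c) = xor (v' (π c)) (v c)) :
    (cyl (Equiv.refl B) w').comp (m.comp (cyl (Equiv.refl A) w)) =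
      (if η then (-1 : R) else 1) •
        (cyl (Equiv.refl B) v').comp (m.comp (cyl (Equiv.refl A) v)) := by
  obtain ⟨U, _, e, e', c, rfl⟩ := hm
  obtain ⟨h1, h2, h3⟩ := c.pair hπ
  rw [cyl_comp_loc_comp_cyl, cyl_comp_loc_comp_cyl, ← comp_smul, ← smul_comp, ← smul_tensor,
    ← cyl_comp_comul_comp_cyl]
  congr 2
  congr 1
  · congr 2
    · funext i
      simp [← h2, hxy]
    · congr 2
      funext i
      rcases h1 i with h | h <;> simp [h, hx, hy]
  · congr 1
    funext u
    have := hc _ (h3 u).1 (h3 u).2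
    rw [c] at this
    exact this

end Cob

/-! ## Signs of numberings -/

section RelSign

variable {X Y Z : Type} [Fintype X] [DecidableEq X]

/-- The sign of the permutation between two bijections. -/
def relSign (e e' : X ≃ Y) : ℤˣ := Equiv.Perm.sign (e.trans e'.symm)

theorem relSign_mul (e e' e'' : X ≃ Y) : relSign e e' * relSign e' e'' = relSign e e'' := by
  unfold relSign
  rw [mul_comm, ← Equiv.Perm.sign_mul]
  congr 1
  ext x
  simp

theorem relSign_trans_right (e e' : X ≃ Y) (b : Y ≃ Z) :
    relSign (e.trans b) (e'.trans b) = relSign e e' := by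
  unfold relSign
  congr 1
  ext x
  simp

theorem relSign_trans_left [Fintype Z] [DecidableEq Z] (b : Z ≃ X) (e e' : X ≃ Y) :
    relSign (b.trans e) (b.trans e') = relSign e e' := by
  unfold relSign
  rw [← Equiv.Perm.sign_trans_trans_symm (e.trans e'.symm) b]
  rfl

theorem relSign_perm (σ : Equiv.Perm X) (e : X ≃ Y) :
    relSign e (σ.trans e) = Equiv.Perm.sign σ := by
  unfold relSign
  rw [← Equiv.Perm.sign_symm σ]
  congr 1
  ext x
  simp

theorem relSign_optionCongr (e e' : X ≃ Y) :
    relSign (Equiv.optionCongr e) (Equiv.optionCongr e') = relSign e e' := by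
  unfold relSign
  rw [← Equiv.optionCongr_sign (e.trans e'.symm), ← Equiv.optionCongr_symm, Equiv.optionCongr_trans]

end RelSign

/-- Adding a largest number. -/
def finOption {m n : ℕ} (h : m + 1 = n) : Option (Fin m) ≃ Fin n :=
  finSuccEquivLast.symm.trans (finCongr h)

theorem finOption_none {m n : ℕ} (h : m + 1 = n) : (finOption h none : ℕ) = m := by
  simp [finOption]

theorem finOption_some {m n : ℕ} (h : m + 1 = n) (i : Fin m) : (finOption h (some i) : ℕ) = i := by
  simp [finOption]

/-! ### Induced numberings along two merges -/

namespace VLinkDiagram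

variable {A B C D T : Type}
  [Fintype A] [Fintype B] [Fintype C] [Fintype D] [Fintype T]

theorem card_of_equiv_option (E : B ≃ Option A) : Fintype.card A + 1 = Fintype.card B := by
  rw [Fintype.card_congr E, Fintype.card_option]

variable [DecidableEq B] [DecidableEq T]

theorem numberingSign_eq_relSign (E : B ≃ Option A) (ν : B ≃ Fin (Fintype.card B))
    (μ : A ≃ Fin (Fintype.card A)) : numberingSign E ν μ =
      relSign ν ((E.trans (Equiv.optionCongr μ)).trans (finOption (card_of_equiv_option E))) := by
  unfold numberingSign relSign
  congr 1

/-- The bijection `E` splits off the point `y`, and it is induced by `π` elsewhere. -/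
def IsDrop (π : B → A) (y : B) (E : B ≃ Option A) : Prop :=
  E y = none ∧ ∀ c, c ≠ y → E c = some (π c)

/-- Compares `νT` with a numbering induced in two stages from `νC`: the point dropped by `E` gets
the largest number, the one dropped by `E'` the number before it. The intermediate numbering `νA`
cancels. -/
theorem numberingSign_mul [DecidableEq A] (E : T ≃ Option A) (E' : A ≃ Option C)
    (νT : T ≃ Fin (Fintype.card T))
    (νA : A ≃ Fin (Fintype.card A)) (νC : C ≃ Fin (Fintype.card C))
    (h : Fintype.card C + 1 + 1 = Fintype.card T) :
    numberingSign E νT νA * numberingSign E' νA νC =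
      relSign νT ((E.trans (Equiv.optionCongr E')).trans
        ((Equiv.optionCongr (Equiv.optionCongr νC)).trans
          ((Equiv.optionCongr (finOption rfl)).trans (finOption h)))) := by
  rw [numberingSign_eq_relSign, numberingSign_eq_relSign, ← relSign_optionCongr νA,
    ← relSign_trans_right _ _ (finOption (card_of_equiv_option E)), ← relSign_trans_left E,
    ← Equiv.trans_assoc, relSign_mul]
  congr 1
  ext t
  rcases hE : E t with _ | a
  · simp [hE, finOption_none, ← card_of_equiv_option E']
  · rcases hE' : E' a with _ | c <;> simp [hE, hE', finOption_none, finOption_some]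

/-- The two paths around the square induce numberings of `T` that differ by one transposition. If `y
≠ y'`, one path numbers `y` last and `y'` second to last, and the other path does the opposite. If
`y = y'`, this point is last for both, and the second to last is `x` for one path and `x'` for the
other. -/
theorem numberingSign_square [DecidableEq A] [DecidableEq D] {f : T → A} {g : T → D} {h : A → C}
    {k : D → C} {x y x' y' : T}
    (S : MergeSquare f g h k x y x' y') {Ef : T ≃ Option A} {Eg : T ≃ Option D} {Eh : A ≃ Option C}
    {Ek : D ≃ Option C} (hf : IsDrop f y Ef) (hg : IsDrop g y' Eg) (hh : IsDrop h (f y') Eh)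
    (hk : IsDrop k (g y) Ek) (νT : T ≃ Fin (Fintype.card T)) (νA : A ≃ Fin (Fintype.card A))
    (νD : D ≃ Fin (Fintype.card D)) (νC : C ≃ Fin (Fintype.card C)) :
    (numberingSign Ef νT νA * numberingSign Eh νA νC) *
      (numberingSign Eg νT νD * numberingSign Ek νD νC) = -1 := by
  have card : Fintype.card C + 1 + 1 = Fintype.card T := by
    rw [card_of_equiv_option Eh, card_of_equiv_option Ef]
  rw [numberingSign_mul _ _ _ _ _ card, numberingSign_mul _ _ _ _ _ card]
  have f0 : Ef.trans (Equiv.optionCongr Eh) y = none := by simp [hf.1]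
  have f1 : ∀ t, t ≠ y → f t = f y' → Ef.trans (Equiv.optionCongr Eh) t = some none :=
    fun t ht e => by simp [hf.2 t ht, e, hh.1]
  have f2 : ∀ t, t ≠ y → f t ≠ f y' → Ef.trans (Equiv.optionCongr Eh) t = some (some (h (f t))) :=
    fun t ht e => by simp [hf.2 t ht, hh.2 _ e]
  have g0 : Eg.trans (Equiv.optionCongr Ek) y' = none := by simp [hg.1]
  have g1 : ∀ t, t ≠ y' → g t = g y → Eg.trans (Equiv.optionCongr Ek) t = some none :=
    fun t ht e => by simp [hg.2 t ht, e, hk.1]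
  have g2 : ∀ t, t ≠ y' → g t ≠ g y → Eg.trans (Equiv.optionCongr Ek) t = some (some (k (g t))) :=
    fun t ht e => by simp [hg.2 t ht, hk.2 _ e]
  have fk := S.f_merge.ker
  have gk := S.g_merge.ker
  have fne := S.f_merge.ne
  have gne := S.g_merge.ne
  have feq := S.f_merge.eq
  have geq := S.g_merge.eq
  have heq := S.h_merge.eq
  have comm := S.comm
  obtain ⟨p, q, hpq, hσ⟩ : ∃ p q, p ≠ q ∧
      Eg.trans (Equiv.optionCongr Ek) = (Equiv.swap p q).trans (Ef.trans (Equiv.optionCongr Eh)) :=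
        by
    by_cases hy : y = y'
    · have hx : x ≠ x' := fun e => S.pairs_ne.1 ⟨e, hy⟩
      refine ⟨x, x', hx, Equiv.ext fun t => ?_⟩
      rw [Equiv.trans_apply (Equiv.swap x x')]
      by_cases h0 : t = y
      · rw [Equiv.swap_apply_of_ne_of_ne (by grind) (by grind), h0, f0, hy, g0]
      by_cases h1 : t = x
      · rw [h1, Equiv.swap_apply_left, g2 _ (by grind) (by grind), f2 _ (by grind) (by grind)]
        grind
      by_cases h2 : t = x'
      · rw [h2, Equiv.swap_apply_right, g1 _ (by grind) (by grind), f1 _ (by grind) (by grind)]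
      · rw [Equiv.swap_apply_of_ne_of_ne h1 h2, g2 _ (by grind) (by grind),
          f2 _ (by grind) (by grind), comm]
    · refine ⟨y, y', hy, Equiv.ext fun t => ?_⟩
      rw [Equiv.trans_apply (Equiv.swap y y')]
      by_cases h1 : t = y
      · rw [h1, Equiv.swap_apply_left, g1 _ hy rfl, f1 _ (Ne.symm hy) rfl]
      by_cases h2 : t = y'
      · rw [h2, Equiv.swap_apply_right, g0, f0]
      · rw [Equiv.swap_apply_of_ne_of_ne h1 h2, g2 _ (by grind) (by grind),
          f2 _ (by grind) (by grind), comm]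
  have inv : ∀ e e' : T ≃ Fin (Fintype.card T), relSign νT e * relSign νT e' = relSign e e' :=
    fun e e' => by
      rw [← relSign_mul νT e e', ← mul_assoc, Int.units_mul_self, one_mul]
  rw [inv, relSign_trans_right, hσ, relSign_perm, Equiv.Perm.sign_swap hpq]

/-- Both merges identify the same pair, and their targets are matched by `θ`. The induced numberings
agree up to the comparison of `νA` with `νD`, and up to exchanging `z` and `z'` if different points
are dropped. The comparison factor cancels later, since it occurs twice around a face. -/
theorem numberingSign_mul_of_equiv [DecidableEq A] {f : B → A} {g : B → D} {x y : B}
    (hf : IsMerge f x y)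
    (θ : A ≃ D) (hg : ∀ c, g c = θ (f c)) {z z' : B} (hz : z = x ∨ z = y) (hz' : z' = x ∨ z' = y)
    {E : B ≃ Option A} {E' : B ≃ Option D} (h : IsDrop f z E) (h' : IsDrop g z' E')
    (νB : B ≃ Fin (Fintype.card B)) (νA : A ≃ Fin (Fintype.card A))
    (νD : D ≃ Fin (Fintype.card D)) :
    numberingSign E νB νA * numberingSign E' νB νD = (if z = z' then 1 else -1) *
      relSign νA ((θ.trans νD).trans (finCongr (Fintype.card_congr θ.symm))) := by
  obtain ⟨σ, hs, hσ⟩ : ∃ σ : Equiv.Perm B, Equiv.Perm.sign σ = (if z = z' then 1 else -1) ∧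
      E' = σ.trans (E.trans (Equiv.optionCongr θ)) := by
    have feq := hf.eq
    by_cases e : z = z'
    · subst e
      refine ⟨1, by simp, Equiv.ext fun t => ?_⟩
      by_cases h0 : t = z
      · simp [h0, h.1, h'.1]
      · simp [h.2 t h0, h'.2 t h0, hg]
    · have fz : f z = f z' := by
        rcases hz with rfl | rfl <;> rcases hz' with rfl | rfl <;> simp_all
      refine ⟨Equiv.swap z z', by rw [Equiv.Perm.sign_swap e, if_neg e], Equiv.ext fun t => ?_⟩
      rw [Equiv.trans_apply (Equiv.swap z z')]
      by_cases h1 : t = z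
      · rw [h1, Equiv.swap_apply_left, h'.2 _ e]
        simp [h.2 _ (Ne.symm e), hg, fz]
      by_cases h2 : t = z'
      · rw [h2, Equiv.swap_apply_right]
        simp [h.1, h'.1]
      · rw [Equiv.swap_apply_of_ne_of_ne h1 h2]
        simp [h.2 _ h1, h'.2 _ h2, hg]
  have inv : ∀ e e' : B ≃ Fin (Fintype.card B), relSign νB e * relSign νB e' = relSign e e' :=
    fun e e' => by
      rw [← relSign_mul νB e e', ← mul_assoc, Int.units_mul_self, one_mul]
  rw [numberingSign_eq_relSign, numberingSign_eq_relSign, inv, ← hs,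
    ← relSign_perm σ ((E.trans (Equiv.optionCongr νA)).trans (finOption (card_of_equiv_option E))),
    ← relSign_mul _ (σ.trans ((E.trans (Equiv.optionCongr νA)).trans
      (finOption (card_of_equiv_option E))))]
  congr 1
  rw [← relSign_optionCongr νA,
    ← relSign_trans_right _ _ (finOption (card_of_equiv_option E)), ← relSign_trans_left E]
  refine .trans ?_ (relSign_trans_left σ _ _)
  congr 1
  ext t
  simp only [hσ, Equiv.trans_apply]
  rcases E (σ t) with _ | a
  · simp [finOption_none, Fintype.card_congr θ]
  · simp [finOption_some]

end VLinkDiagram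

/-! ## Planar diagrams have a source-sink orientation -/

namespace VLinkDiagram

variable (L : VLinkDiagram)

/-- The next half-edge at the same vertex. -/
def rot (d : Dart L.n L.v) : Dart L.n L.v := (d.1, d.2 + 1)

theorem rot_bijective : Function.Bijective L.rot := by
  refine Finite.injective_iff_bijective.1 ?_
  rintro ⟨x, i⟩ ⟨y, j⟩ h
  simpa [rot] using h

theorem edge_bijective : Function.Bijective L.edge :=
  (show Function.Involutive L.edge from L.edge_edge).bijective

/-- The edges of the underlying four valent graph. -/
abbrev EdgeQuot : Type := Quot fun d d' : Dart L.n L.v => d' = L.edge d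

/-- The faces of the underlying four valent plane graph. -/
abbrev FaceQuot : Type := Quot fun d d' : Dart L.n L.v => d' = ((L.edge d).1, (L.edge d).2 + 1)

/-- The connected components of the underlying four valent graph. -/
abbrev CompQuot : Type := Quot fun d d' : Dart L.n L.v => d' = L.edge d ∨ d' = (d.1, d.2 + 1)

theorem card_dart_le : Nat.card (Dart L.n L.v) ≤ 2 * Nat.card L.EdgeQuot := by
  classical
  have key : ∀ d d' : Dart L.n L.v, (Quot.mk _ d : L.EdgeQuot) = Quot.mk _ d' →
      d = d' ∨ d = L.edge d' := fun d d' h => by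
    let F : L.EdgeQuot → Finset (Dart L.n L.v) := Quot.lift (fun d => {d, L.edge d}) (by
      rintro d _ rfl
      simp only [L.edge_edge]
      exact Finset.pair_comm _ _)
    have h1 : ({d, L.edge d} : Finset _) = {d', L.edge d'} := congrArg F h
    have h2 : d ∈ ({d', L.edge d'} : Finset _) := h1 ▸ Finset.mem_insert_self _ _
    simpa using h2
  let _ : Fintype L.EdgeQuot := Fintype.ofFinite _
  rw [Nat.card_eq_fintype_card, Nat.card_eq_fintype_card, ← Finset.card_univ, ← Finset.card_univ]
  refine Finset.card_le_mul_card_image_of_maps_to (f := Quot.mk _) (fun _ _ => Finset.mem_univ _) 2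
    ?_
  rintro ⟨d'⟩ -
  refine (Finset.card_le_card (t := {d', L.edge d'}) fun d hd => ?_).trans Finset.card_le_two
  simpa using key d d' (Finset.mem_filter.1 hd).2

/-- The coboundary of a function on half-edges modulo two. -/
def coboundary : (Dart L.n L.v → ZMod 2) →ₗ[ZMod 2]
    (Dart L.n L.v → ZMod 2) × (Dart L.n L.v → ZMod 2) :=
  ((LinearMap.funLeft _ _ L.edge) + LinearMap.id).prod ((LinearMap.funLeft _ _ L.rot) +
    LinearMap.id)

/-- The functionals given by the boundaries of the vertices, edges and faces. -/
def boundaryPairing : ((Fin L.n ⊕ Fin L.v → ZMod 2) × (L.EdgeQuot → ZMod 2) ×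
      (L.FaceQuot → ZMod 2)) →ₗ[ZMod 2]
    Module.Dual (ZMod 2) ((Dart L.n L.v → ZMod 2) × (Dart L.n L.v → ZMod 2)) :=
  LinearMap.mk₂ (ZMod 2) (fun s w => ∑ d, ((s.2.1 (Quot.mk _ d) + s.2.2 (Quot.mk _ d)) * w.1 d +
      (s.1 d.1 + s.2.2 (Quot.mk _ (L.edge d))) * w.2 d))
    (fun s s' w => by
      rw [← Finset.sum_add_distrib]
      refine Finset.sum_congr rfl fun d _ => ?_
      simp only [Prod.fst_add, Prod.snd_add, Pi.add_apply]
      ring)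
    (fun c s w => by
      rw [smul_eq_mul, Finset.mul_sum]
      refine Finset.sum_congr rfl fun d _ => ?_
      simp only [Prod.smul_fst, Prod.smul_snd, Pi.smul_apply, smul_eq_mul]
      ring)
    (fun s w w' => by
      rw [← Finset.sum_add_distrib]
      refine Finset.sum_congr rfl fun d _ => ?_
      simp only [Prod.fst_add, Prod.snd_add, Pi.add_apply]
      ring)
    (fun c s w => by
      rw [smul_eq_mul, Finset.mul_sum]
      refine Finset.sum_congr rfl fun d _ => ?_
      simp only [Prod.smul_fst, Prod.smul_snd, Pi.smul_apply, smul_eq_mul]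
      ring)

theorem boundaryPairing_apply (s) (w) : L.boundaryPairing s w =
    ∑ d, ((s.2.1 (Quot.mk _ d) + s.2.2 (Quot.mk _ d)) * w.1 d +
      (s.1 d.1 + s.2.2 (Quot.mk _ (L.edge d))) * w.2 d) := rfl

/-- Functions that are constant on connected components. -/
def constOnComp : (L.CompQuot → ZMod 2) →ₗ[ZMod 2] (Dart L.n L.v → ZMod 2) :=
  LinearMap.funLeft _ _ (Quot.mk _)

theorem mem_range_constOnComp {p : Dart L.n L.v → ZMod 2} (h : ∀ d, p (L.edge d) = p d)
    (h' : ∀ d, p (L.rot d) = p d) : p ∈ LinearMap.range L.constOnComp :=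
  ⟨Quot.lift p (by rintro d _ (rfl | rfl); exacts [(h d).symm, (h' d).symm]), rfl⟩

theorem finrank_range_constOnComp_le :
    Module.finrank (ZMod 2) (LinearMap.range L.constOnComp) ≤ Nat.card L.CompQuot := by
  let _ : Fintype L.CompQuot := Fintype.ofFinite _
  refine (LinearMap.finrank_range_le _).trans ?_
  rw [Module.finrank_fintype_fun_eq_card, Nat.card_eq_fintype_card]

theorem eq_of_add_eq_zero {a b : ZMod 2} (h : a + b = 0) : a = b := by
  rw [eq_neg_of_add_eq_zero_left h, ZMod.neg_eq_self_mod_two]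

/-- A cocycle of degree zero is invariant under `L.edge` and `L.rot`, hence constant on components.
-/
theorem finrank_ker_coboundary_le :
    Module.finrank (ZMod 2) (LinearMap.ker L.coboundary) ≤ Nat.card L.CompQuot := by
  refine (Submodule.finrank_mono fun p hp => ?_).trans L.finrank_range_constOnComp_le
  have h := LinearMap.mem_ker.1 hp
  exact L.mem_range_constOnComp (fun d => eq_of_add_eq_zero (congrFun (congrArg Prod.fst h) d))
    fun d => eq_of_add_eq_zero (congrFun (congrArg Prod.snd h) d)

/-- Testing on standard basis vectors shows that the values at an edge and at a vertex are those of
adjacent faces. So an element of the kernel is determined by its values on faces, and these are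
constant on components. -/
theorem finrank_ker_boundaryPairing_le :
    Module.finrank (ZMod 2) (LinearMap.ker L.boundaryPairing) ≤ Nat.card L.CompQuot := by
  classical
  have key : ∀ s ∈ LinearMap.ker L.boundaryPairing, ∀ d : Dart L.n L.v,
      s.2.1 (Quot.mk _ d) = s.2.2 (Quot.mk _ d) ∧ s.1 d.1 = s.2.2 (Quot.mk _ (L.edge d)) := by
    intro s hs d
    have h1 := LinearMap.congr_fun (LinearMap.mem_ker.1 hs) (Pi.single d 1, 0)
    have h2 := LinearMap.congr_fun (LinearMap.mem_ker.1 hs) (0, Pi.single d 1)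
    rw [boundaryPairing_apply, Finset.sum_eq_single d (by simp +contextual) (by simp)] at h1 h2
    exact ⟨eq_of_add_eq_zero (by simpa using h1), eq_of_add_eq_zero (by simpa using h2)⟩
  let T : ((Fin L.n ⊕ Fin L.v → ZMod 2) × (L.EdgeQuot → ZMod 2) × (L.FaceQuot → ZMod 2))
      →ₗ[ZMod 2] (Dart L.n L.v → ZMod 2) :=
    (LinearMap.funLeft _ _ (Quot.mk _)).comp ((LinearMap.snd _ _ _).comp (LinearMap.snd _ _ _))
  have hT : ∀ s d, T s d = s.2.2 (Quot.mk _ d) := fun _ _ => rfl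
  have inj : Function.Injective (T.domRestrict (LinearMap.ker L.boundaryPairing)) := by
    rw [← LinearMap.ker_eq_bot, LinearMap.ker_eq_bot']
    rintro ⟨s, hs⟩ h0
    have h1 : ∀ d, s.2.2 (Quot.mk _ d) = 0 := fun d => congrFun h0 d
    refine Subtype.ext (Prod.ext ?_ (Prod.ext ?_ ?_))
    · funext x
      exact ((key s hs (x, 0)).2).trans (h1 _)
    · funext x
      obtain ⟨d, rfl⟩ := Quot.exists_rep x
      exact ((key s hs d).1).trans (h1 _)
    · funext x
      obtain ⟨d, rfl⟩ := Quot.exists_rep x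
      exact h1 d
  rw [← LinearMap.finrank_range_of_inj inj]
  refine (Submodule.finrank_mono ?_).trans L.finrank_range_constOnComp_le
  rintro _ ⟨⟨s, hs⟩, rfl⟩
  have he : ∀ d, s.2.2 (Quot.mk _ (L.edge d)) = s.2.2 (Quot.mk _ d) := fun d => by
    rw [← (key s hs _).1, ← (key s hs _).1]
    exact congrArg _ (Quot.sound (r := fun d d' => d' = L.edge d) rfl).symm
  refine L.mem_range_constOnComp he fun d => ?_
  change s.2.2 (Quot.mk _ (L.rot d)) = s.2.2 (Quot.mk _ d)
  rw [← he, ← he d, ← (key s hs _).2, ← (key s hs _).2]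
  rfl

/-- This is `∂∂ = 0` modulo two for the cell structure whose vertices are the half-edges, whose
edges are the steps along `L.edge` and `L.rot`, and whose two-cells are a bigon for every edge, a
quadrilateral for every crossing and a polygon for every face. After reindexing along these steps
every term occurs twice. -/
theorem boundaryPairing_coboundary (s) (p) : L.boundaryPairing s (L.coboundary p) = 0 := by
  rw [boundaryPairing_apply]
  let σ := Equiv.ofBijective _ L.edge_bijective
  let ρ := Equiv.ofBijective _ L.rot_bijective
  have e1 : ∑ d, s.2.1 (Quot.mk _ d) * p (L.edge d) = ∑ d, s.2.1 (Quot.mk _ d) * p d := by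
    rw [← Equiv.sum_comp σ fun d => s.2.1 (Quot.mk _ d) * p d]
    refine Finset.sum_congr rfl fun d _ => ?_
    rw [Quot.sound (r := fun d d' => d' = L.edge d) (show L.edge d = L.edge d from rfl)]
    rfl
  have e2 : ∑ d, s.1 d.1 * p (L.rot d) = ∑ d, s.1 d.1 * p d := by
    rw [← Equiv.sum_comp ρ fun d => s.1 d.1 * p d]
    rfl
  have e3 : ∑ d, s.2.2 (Quot.mk _ (L.edge d)) * p d = ∑ d, s.2.2 (Quot.mk _ d) * p (L.edge d) := by
    rw [← Equiv.sum_comp σ fun d => s.2.2 (Quot.mk _ (L.edge d)) * p d]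
    refine Finset.sum_congr rfl fun d _ => ?_
    change s.2.2 (Quot.mk _ (L.edge (L.edge d))) * p (L.edge d) = _
    rw [L.edge_edge]
  have e4 : ∑ d, s.2.2 (Quot.mk _ (L.edge d)) * p (L.rot d) = ∑ d, s.2.2 (Quot.mk _ d) * p d := by
    rw [← Equiv.sum_comp σ fun d => s.2.2 (Quot.mk _ (L.edge d)) * p (L.rot d),
      ← Equiv.sum_comp (σ.trans ρ) fun d => s.2.2 (Quot.mk _ d) * p d]
    refine Finset.sum_congr rfl fun d _ => ?_
    change s.2.2 (Quot.mk _ (L.edge (L.edge d))) * p (L.rot (L.edge d)) =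
      s.2.2 (Quot.mk _ (L.rot (L.edge d))) * p (L.rot (L.edge d))
    rw [L.edge_edge]
    exact congrArg (fun q => s.2.2 q * p (L.rot (L.edge d)))
      (Quot.sound (r := fun d d' => d' = ((L.edge d).1, (L.edge d).2 + 1)) rfl)
  have e : ∀ d, (s.2.1 (Quot.mk _ d) + s.2.2 (Quot.mk _ d)) * (L.coboundary p).1 d +
      (s.1 d.1 + s.2.2 (Quot.mk _ (L.edge d))) * (L.coboundary p).2 d =
      ((s.2.1 (Quot.mk _ d) * p (L.edge d) + s.2.1 (Quot.mk _ d) * p d) +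
      (s.2.2 (Quot.mk _ d) * p (L.edge d) + s.2.2 (Quot.mk _ d) * p d)) +
      ((s.1 d.1 * p (L.rot d) + s.1 d.1 * p d) + (s.2.2 (Quot.mk _ (L.edge d)) * p (L.rot d) +
        s.2.2 (Quot.mk _ (L.edge d)) * p d)) := fun d => by
    change _ * (p (L.edge d) + p d) + _ * (p (L.rot d) + p d) = _
    ring
  rw [Finset.sum_congr rfl fun d _ => e d]
  simp only [Finset.sum_add_distrib]
  rw [e1, e2, e3, e4]
  have two : (2 : ZMod 2) = 0 := rfl
  linear_combination (∑ d, s.2.1 (Quot.mk _ d) * p d + ∑ d, s.1 d.1 * p d +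
    ∑ d, s.2.2 (Quot.mk _ d) * p d + ∑ d, s.2.2 (Quot.mk _ d) * p (L.edge d)) * two

/-- All two-cells have boundaries of even length: two for an edge, four for a vertex, and for a face
because steps along `L.edge` and `L.rot` alternate. -/
theorem boundaryPairing_one (s) : L.boundaryPairing s (1, 1) = 0 := by
  rw [boundaryPairing_apply]
  let σ := Equiv.ofBijective _ L.edge_bijective
  simp only [Pi.one_apply, mul_one, Finset.sum_add_distrib]
  have two : (2 : ZMod 2) = 0 := rfl
  have e1 : ∑ d : Dart L.n L.v, s.2.1 (Quot.mk _ d) = 0 :=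
    Finset.sum_involution (fun d _ => L.edge d) (fun d _ => by
        rw [← Quot.sound (r := fun d d' => d' = L.edge d) (show L.edge d = L.edge d from rfl)]
        linear_combination (s.2.1 (Quot.mk _ d)) * two)
      (fun d _ _ => L.edge_ne d) (fun _ _ => Finset.mem_univ _) fun d _ => L.edge_edge d
  have e2 : ∑ d : Dart L.n L.v, s.1 d.1 = 0 := by
    rw [Fintype.sum_prod_type]
    refine Finset.sum_eq_zero fun x _ => ?_
    simp only [Finset.sum_const, Finset.card_univ, Fintype.card_fin, nsmul_eq_mul]
    push_cast
    linear_combination 2 * s.1 x * two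
  have e3 : ∑ d, s.2.2 (Quot.mk _ (L.edge d)) = ∑ d, s.2.2 (Quot.mk _ d) :=
    Equiv.sum_comp σ fun d => s.2.2 (Quot.mk _ d)
  rw [e1, e2, e3]
  linear_combination (∑ d, s.2.2 (Quot.mk _ d)) * two

/-- The half-edges of a planar diagram can be oriented such that the orientations alternate around
every vertex. -/
theorem exists_sourceSink : ∃ o : Dart L.n L.v → Bool,
    (∀ d, o (L.edge d) = !o d) ∧ ∀ x i, o (x, i + 1) = !o (x, i) := by
  have hle : LinearMap.range L.boundaryPairing ≤
      (LinearMap.range L.coboundary).dualAnnihilator := by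
    rintro _ ⟨s, rfl⟩
    rw [Submodule.mem_dualAnnihilator]
    rintro _ ⟨p, rfl⟩
    exact L.boundaryPairing_coboundary s p
  -- Let `D`, `V`, `E`, `F`, `C` count half-edges, vertices, edges, faces and components. The
  -- coboundaries have dimension at least `D - C` in a space of dimension `2D`, so their annihilator
  -- has dimension at most `D + C`. The pairing has rank at least `V + E + F - C`, which is `2E + C`
  -- by Euler's formula, and `D ≤ 2E`.
  have heq := Submodule.eq_of_le_of_finrank_le hle (by
    let _ : Fintype L.EdgeQuot := Fintype.ofFinite _
    let _ : Fintype L.FaceQuot := Fintype.ofFinite _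
    have h1 := LinearMap.finrank_range_add_finrank_ker L.boundaryPairing
    have h2 := LinearMap.finrank_range_add_finrank_ker L.coboundary
    have h3 := Subspace.finrank_add_finrank_dualAnnihilator_eq (LinearMap.range L.coboundary)
    have h4 := L.finrank_ker_coboundary_le
    have h5 := L.finrank_ker_boundaryPairing_le
    have h6 := L.card_dart_le
    have h7 : L.n + L.v + Nat.card L.FaceQuot = Nat.card L.EdgeQuot + 2 * Nat.card L.CompQuot :=
      L.planar
    simp only [Module.finrank_prod, Module.finrank_fintype_fun_eq_card, ← Nat.card_eq_fintype_card]
      at h1 h2 h3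
    simp only [Nat.card_eq_fintype_card, Fintype.card_sum, Fintype.card_fin] at *
    omega)
  have hmem : ((1, 1) : (Dart L.n L.v → ZMod 2) × (Dart L.n L.v → ZMod 2)) ∈
      LinearMap.range L.coboundary := by
    -- A vector killed by the annihilator of a subspace lies in the subspace, so it suffices to test
    -- on boundaries.
    rw [← Subspace.forall_mem_dualAnnihilator_apply_eq_zero_iff, ← heq]
    rintro _ ⟨s, rfl⟩
    exact L.boundaryPairing_one s
  obtain ⟨p, hp⟩ := hmem
  have h1 : ∀ d, p (L.edge d) + p d = 1 := fun d => congrFun (congrArg Prod.fst hp) d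
  have h2 : ∀ d, p (L.rot d) + p d = 1 := fun d => congrFun (congrArg Prod.snd hp) d
  have key : ∀ a b : ZMod 2, a + b = 1 → decide (a = 1) = !decide (b = 1) := by decide
  exact ⟨fun d => decide (p d = 1), fun d => key _ _ (h1 d), fun x i => key _ _ (h2 (x, i))⟩

end VLinkDiagram

/-! ## Cycles of permutations and transpositions -/

section Cycles

open Equiv Equiv.Perm

variable {α : Type} [Finite α] {P Q : Perm α} {i j k l y : α}

/-- Take the first visit of `y`. If the path met `j` earlier, it would restart at `P j` and reach
`y` in fewer steps. Starting at `P j` instead of `j` makes `y = j` describe a full turn around the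
cycle. -/
theorem exists_path (h : P.SameCycle j y) :
    ∃ m : ℕ, (P ^ m) (P j) = y ∧ ∀ t < m, (P ^ t) (P j) ≠ y ∧ (P ^ t) (P j) ≠ j := by
  classical
  have h' : ∃ m : ℕ, (P ^ m) (P j) = y := (sameCycle_apply_left.2 h).exists_nat_pow_eq
  refine ⟨Nat.find h', Nat.find_spec h', fun t ht => ⟨Nat.find_min h' ht, fun e => ?_⟩⟩
  have h1 := Nat.find_spec h'
  obtain ⟨n, hn⟩ := Nat.exists_eq_add_of_lt ht
  refine Nat.find_min h' (m := n) (by omega) ?_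
  rw [hn, show t + n + 1 = n + 1 + t by omega, pow_add, mul_apply, e, pow_succ, mul_apply] at h1
  exact h1

theorem sameCycle_of_path (h : P.SameCycle j y) (hi : Q i = P j)
    (hQ : ∀ z, P.SameCycle j z → z ≠ j → z ≠ y → Q z = P z) : Q.SameCycle i y := by
  obtain ⟨m, hm, hlt⟩ := exists_path h
  have key : ∀ t ≤ m, (Q ^ t) (P j) = (P ^ t) (P j) := by
    intro t
    induction t with
    | zero => simp
    | succ t ih =>
      intro ht
      rw [pow_succ', pow_succ', mul_apply, mul_apply, ih (by omega)]
      refine hQ _ ?_ (hlt t ht).2 (hlt t ht).1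
      exact sameCycle_pow_right.2 (sameCycle_apply_right.2 (SameCycle.refl _ _))
  rw [← sameCycle_apply_left, hi, ← hm, ← key m le_rfl]
  exact sameCycle_pow_right.2 (SameCycle.refl _ _)

variable [DecidableEq α]

/-- From `i` the new permutation jumps to `P j` and goes once around the cycle of `j`, which does
not contain `i`. -/
theorem sameCycle_mul_swap (h : ¬ P.SameCycle i j) : (P * swap i j).SameCycle i j := by
  refine sameCycle_of_path (SameCycle.refl P j) (by simp) fun z hz hj _ => ?_
  rw [mul_apply, swap_apply_of_ne_of_ne _ hj]
  rintro rfl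
  exact h hz.symm

theorem not_sameCycle_mul_swap (h : P.SameCycle i j) (hij : i ≠ j) :
    ¬ (P * swap i j).SameCycle i j := by
  obtain ⟨m, hm, hlt⟩ := exists_path h.symm
  intro hQ
  -- The new orbit of `i` stays on the part of the old cycle from `P j` to `i`, which avoids `j`.
  have key : ∀ n : ℕ, ∃ t ≤ m, ((P * swap i j) ^ n) i = (P ^ t) (P j) := by
    intro n
    induction n with
    | zero => exact ⟨m, le_rfl, by simp [hm]⟩
    | succ n ih =>
      obtain ⟨t, ht, e⟩ := ih
      rw [pow_succ', mul_apply, e]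
      rcases ht.lt_or_eq with ht | rfl
      · refine ⟨t + 1, ht, ?_⟩
        rw [mul_apply, swap_apply_of_ne_of_ne (hlt t ht).1 (hlt t ht).2, pow_succ', mul_apply]
      · exact ⟨0, Nat.zero_le _, by simp [hm]⟩
  obtain ⟨n, hn⟩ := hQ.exists_nat_pow_eq
  obtain ⟨t, ht, e⟩ := key n
  rcases ht.lt_or_eq with ht | rfl
  · exact (hlt t ht).2 (e.symm.trans hn)
  · exact hij (hm.symm.trans (e.symm.trans hn))

/-- From `i` the new permutation jumps to `P j` and follows the old cycle as far as `l`. On the way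
it meets neither `i` nor `k`, which lie on other cycles of `P`. -/
theorem sameCycle_mul_swap_mul_swap (hij : ¬ P.SameCycle i j) (hkl : ¬ P.SameCycle k l)
    (hjl : P.SameCycle j l) (hik : i ≠ k) : (P * swap i j * swap k l).SameCycle i l := by
  have hil : i ≠ l := by rintro rfl; exact hij hjl.symm
  refine sameCycle_of_path hjl ?_ fun z hz hj hl => ?_
  · rw [mul_apply, mul_apply, swap_apply_of_ne_of_ne hik hil, swap_apply_left]
  · rw [mul_apply, mul_apply, swap_apply_of_ne_of_ne _ hl, swap_apply_of_ne_of_ne _ hj]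
    · rintro rfl
      exact hij hz.symm
    · rintro rfl
      exact hkl (hz.symm.trans hjl)

end Cycles

/-! ### The circles of a resolution as cycles of a permutation -/

namespace VLinkDiagram

variable {L : VLinkDiagram}

theorem smooth_smooth (a : L.State) (d : Dart L.n L.v) : smooth a (smooth a d) = d := by
  obtain ⟨x | x, i⟩ := d
  · cases h : a x <;> fin_cases i <;> simp [smooth, h]
  · simp only [smooth]
    congr 1
    rw [add_assoc]
    exact add_zero i

variable (L) in
/-- A source-sink orientation of a classical diagram. -/
structure SourceSink where
  out : Dart L.n L.v → Bool
  out_edge : ∀ d, out (L.edge d) = !out d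
  out_rot : ∀ x i, out (x, i + 1) = !out (x, i)

namespace SourceSink

variable (o : L.SourceSink)

theorem out_one (x) : o.out (x, 1) = !o.out (x, 0) := o.out_rot x 0

theorem out_two (x) : o.out (x, 2) = o.out (x, 0) := by
  rw [show (2 : Fin 4) = 1 + 1 from rfl, o.out_rot, o.out_one, Bool.not_not]

theorem out_three (x) : o.out (x, 3) = !o.out (x, 0) := by
  rw [show (3 : Fin 4) = 2 + 1 from rfl, o.out_rot, o.out_two]

/-- Both smoothings join half-edges of opposite parity. A virtual crossing would join half-edges of
equal parity, whence the restriction to classical diagrams. -/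
theorem out_smooth (hL : L.IsClassical) (a : L.State) (d : Dart L.n L.v) : o.out
    (smooth a d) = !o.out d := by
  obtain ⟨x | x, i⟩ := d
  · cases h : a x <;> fin_cases i <;>
      simp [smooth, h, o.out_one, o.out_two, o.out_three]
  · have : IsEmpty (Fin L.v) := by rw [show L.v = 0 from hL]; infer_instance
    exact isEmptyElim x

/-- The half-edges that are incoming at their vertex. -/
abbrev In : Type := {d : Dart L.n L.v // o.out d = false}

/-- Following the circles of a resolution from one incoming half-edge to the next one. -/
def perm (hL : L.IsClassical) (a : L.State) : Equiv.Perm o.In where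
  toFun d := ⟨L.edge (smooth a d.1), by rw [o.out_edge, o.out_smooth hL, d.2]; rfl⟩
  invFun d := ⟨smooth a (L.edge d.1), by rw [o.out_smooth hL, o.out_edge, d.2]; rfl⟩
  left_inv d := Subtype.ext (by simp only [L.edge_edge, smooth_smooth])
  right_inv d := Subtype.ext (by simp only [L.edge_edge, smooth_smooth])

theorem circleOf_eq_iff (hL : L.IsClassical) (a : L.State) (d d' : o.In) :
    circleOf a d.1 = circleOf a d'.1 ↔ (o.perm hL a).SameCycle d d' := by
  constructor
  · intro h
    -- An outgoing half-edge is represented by the incoming half-edge at the start of its string.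
    let G : ∀ d : Dart L.n L.v, o.out d ≠ false → o.In := fun d hd =>
      ⟨smooth a d, by rw [o.out_smooth hL]; simpa using hd⟩
    let F : Quot (fun d d' : Dart L.n L.v => d' = L.edge d ∨ d' = smooth a d) →
        Quotient (Equiv.Perm.SameCycle.setoid (o.perm hL a)) :=
      Quot.lift (fun d => if h : o.out d = false then Quotient.mk _ ⟨d, h⟩
        else Quotient.mk _ (G d h)) (by
          have he : ∀ d (h : o.out d = false) (h' : o.out (L.edge d) ≠ false),
              (Quotient.mk (Equiv.Perm.SameCycle.setoid (o.perm hL a)) ⟨d, h⟩ : Quotient _) =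
                Quotient.mk _ (G (L.edge d) h') := fun d h h' => by
            refine Quotient.sound (Equiv.Perm.sameCycle_apply_right.1 ?_)
            rw [show o.perm hL a (G (L.edge d) h') = ⟨d, h⟩ from
              Subtype.ext (by simp [perm, G, smooth_smooth, L.edge_edge])]
          have hs : ∀ d (h : o.out d = false) (h' : o.out (smooth a d) ≠ false),
              (Quotient.mk (Equiv.Perm.SameCycle.setoid (o.perm hL a)) ⟨d, h⟩ : Quotient _) =
                Quotient.mk _ (G (smooth a d) h') := fun d h h' =>
            congrArg _ (Subtype.ext (smooth_smooth a d).symm)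
          rintro d _ (rfl | rfl)
          · have h1 := o.out_edge d
            by_cases h : o.out d = false
            · have h' : o.out (L.edge d) ≠ false := by simp [h1, h]
              simp only [h, h', dif_pos]
              exact he d h h'
            · have h' : o.out (L.edge d) = false := by simpa [h1] using h
              simp only [h, h', dif_pos]
              have := he (L.edge d) h' (by simpa [L.edge_edge] using h)
              rw [this]
              exact congrArg _ (Subtype.ext (congrArg (smooth a) (L.edge_edge d).symm))
          · have h1 := o.out_smooth hL a d
            by_cases h : o.out d = false
            · have h' : o.out (smooth a d) ≠ false := by simp [h1, h]
              simp only [h, h', dif_pos]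
              exact hs d h h'
            · have h' : o.out (smooth a d) = false := by simpa [h1] using h
              simp only [h, h', dif_pos]
              rfl)
    have h2 := congrArg F (Sum.inl.inj h)
    simp only [F, d.2, d'.2, dif_pos] at h2
    exact Quotient.exact h2
  · intro h
    obtain ⟨n, rfl⟩ := h.exists_nat_pow_eq
    induction n with
    | zero => rfl
    | succ n ih =>
      refine (ih (Equiv.Perm.sameCycle_pow_right.2 (.refl _ _))).trans ?_
      rw [pow_succ', Equiv.Perm.mul_apply]
      exact ((circleOf_edge a _).trans (circleOf_smooth a _)).symm

/-- The incoming half-edge on the string of the `0`-resolution that ends in the half-edge `0`. -/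
def in0 (r : Fin L.n) : o.In :=
  if h : o.out (Sum.inl r, 0) = false then ⟨(Sum.inl r, 0), h⟩
  else ⟨(Sum.inl r, 1), by rw [o.out_one]; simpa using h⟩

/-- The incoming half-edge on the string of the `0`-resolution that ends in the half-edge `2`. -/
def in2 (r : Fin L.n) : o.In :=
  if h : o.out (Sum.inl r, 0) = false then ⟨(Sum.inl r, 2), by rw [o.out_two, h]⟩
  else ⟨(Sum.inl r, 3), by rw [o.out_three]; simpa using h⟩

theorem in0_of_false {r : Fin L.n} (h : o.out (Sum.inl r, 0) = false) :
    (o.in0 r).1 = (Sum.inl r, 0) := by simp [in0, h]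

theorem in0_of_true {r : Fin L.n} (h : o.out (Sum.inl r, 0) = true) :
    (o.in0 r).1 = (Sum.inl r, 1) := by simp [in0, h]

theorem in2_of_false {r : Fin L.n} (h : o.out (Sum.inl r, 0) = false) :
    (o.in2 r).1 = (Sum.inl r, 2) := by simp [in2, h]

theorem in2_of_true {r : Fin L.n} (h : o.out (Sum.inl r, 0) = true) :
    (o.in2 r).1 = (Sum.inl r, 3) := by simp [in2, h]

theorem in0_fst (r : Fin L.n) : (o.in0 r).1.1 = Sum.inl r := by
  unfold in0; split <;> rfl

theorem in2_fst (r : Fin L.n) : (o.in2 r).1.1 = Sum.inl r := by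
  unfold in2; split <;> rfl

theorem in0_ne_in2 (r s : Fin L.n) : o.in0 r ≠ o.in2 s := by
  intro h
  have h1 := congrArg Subtype.val h
  have h2 := congrArg Prod.fst h1
  rw [in0_fst, in2_fst] at h2
  obtain rfl : r = s := Sum.inl_injective h2
  cases h : o.out (Sum.inl r, 0)
  · rw [o.in0_of_false h, o.in2_of_false h] at h1; simp at h1
  · rw [o.in0_of_true h, o.in2_of_true h] at h1; simp at h1

theorem in0_injective : Function.Injective o.in0 := fun r s h => by
  have h2 := congrArg (fun d => d.1.1) h
  simp only [in0_fst] at h2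
  exact Sum.inl_injective h2

theorem in2_injective : Function.Injective o.in2 := fun r s h => by
  have h2 := congrArg (fun d => d.1.1) h
  simp only [in2_fst] at h2
  exact Sum.inl_injective h2

theorem eq_in0_or_in2 {r : Fin L.n} {d : o.In} (hd : d.1.1 = Sum.inl r) :
    d = o.in0 r ∨ d = o.in2 r := by
  obtain ⟨⟨x, i⟩, h⟩ := d
  obtain rfl : x = Sum.inl r := hd
  have h1 := o.out_one (Sum.inl r)
  have h2 := o.out_two (Sum.inl r)
  have h3 := o.out_three (Sum.inl r)
  cases h0 : o.out (Sum.inl r, 0) <;> rw [h0] at h1 h2 h3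
  · rw [Subtype.ext_iff, Subtype.ext_iff, o.in0_of_false h0, o.in2_of_false h0]
    fin_cases i
    exacts [.inl rfl, (Bool.noConfusion (h.symm.trans h1)), .inr rfl,
      (Bool.noConfusion (h.symm.trans h3))]
  · rw [Subtype.ext_iff, Subtype.ext_iff, o.in0_of_true h0, o.in2_of_true h0]
    fin_cases i
    exacts [(Bool.noConfusion (h.symm.trans h0)), .inl rfl,
      (Bool.noConfusion (h.symm.trans h2)), .inr rfl]

theorem circ0_eq_of_false {a : L.State} {r : Fin L.n} (h : a r = false) :
    circ0 a r = circleOf a (o.in0 r).1 := by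
  cases h0 : o.out (Sum.inl r, 0)
  · rw [o.in0_of_false h0]; rfl
  · rw [o.in0_of_true h0]
    exact (circleOf_smooth a (Sum.inl r, 0)).symm.trans (by simp [smooth, h])

theorem circ2_eq_of_false {a : L.State} {r : Fin L.n} (h : a r = false) :
    circ2 a r = circleOf a (o.in2 r).1 := by
  cases h0 : o.out (Sum.inl r, 0)
  · rw [o.in2_of_false h0]; rfl
  · rw [o.in2_of_true h0]
    exact (circleOf_smooth a (Sum.inl r, 2)).symm.trans (by simp [smooth, h])

/-- The `1`-resolution has the strings `0`–`3` and `1`–`2`, so whether the string through `0` starts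
at `in0` or at `in2` depends on the source-sink orientation. For the `0`-resolution it does not. The
crossing signs enter the face computations through this difference. -/
theorem circ0_eq_of_true {a : L.State} {r : Fin L.n} (h : a r = true) :
    circ0 a r = circleOf a (if o.out (Sum.inl r, 0) then o.in2 r else o.in0 r).1 := by
  cases h0 : o.out (Sum.inl r, 0)
  · simp only [Bool.false_eq_true, if_false, o.in0_of_false h0]; rfl
  · simp only [if_true, o.in2_of_true h0]
    exact (circleOf_smooth a (Sum.inl r, 0)).symm.trans (by simp [smooth, h])

theorem circ2_eq_of_true {a : L.State} {r : Fin L.n} (h : a r = true) :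
    circ2 a r = circleOf a (if o.out (Sum.inl r, 0) then o.in0 r else o.in2 r).1 := by
  cases h0 : o.out (Sum.inl r, 0)
  · simp only [Bool.false_eq_true, if_false, o.in2_of_false h0]; rfl
  · simp only [if_true, o.in0_of_true h0]
    exact (circleOf_smooth a (Sum.inl r, 2)).symm.trans (by simp [smooth, h])

theorem circ_eq_iff (hL : L.IsClassical) (a : L.State) (r : Fin L.n) :
    circ0 a r = circ2 a r ↔ (o.perm hL a).SameCycle (o.in0 r) (o.in2 r) := by
  rw [← circleOf_eq_iff]
  cases h : a r
  · rw [o.circ0_eq_of_false h, o.circ2_eq_of_false h]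
  · rw [o.circ0_eq_of_true h, o.circ2_eq_of_true h]
    cases o.out (Sum.inl r, 0)
    · rfl
    · exact eq_comm

/-- Changing the smoothing at `r` exchanges the outgoing ends reached from the two incoming
half-edges at `r`, and nothing else. -/
theorem perm_saddle (hL : L.IsClassical) {a b : L.State} {r : Fin L.n} (h : IsSaddle a b r) :
    o.perm hL b = o.perm hL a * Equiv.swap (o.in0 r) (o.in2 r) := by
  have h1 := h.src
  have h2 := h.tgt
  have key : smooth b (o.in0 r).1 = smooth a (o.in2 r).1 ∧
      smooth b (o.in2 r).1 = smooth a (o.in0 r).1 := by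
    cases h0 : o.out (Sum.inl r, 0)
    · rw [o.in0_of_false h0, o.in2_of_false h0]; simp [smooth, h1, h2]
    · rw [o.in0_of_true h0, o.in2_of_true h0]; simp [smooth, h1, h2]
  refine Equiv.ext fun d => Subtype.ext ?_
  by_cases hd : d.1.1 = Sum.inl r
  · rcases o.eq_in0_or_in2 hd with rfl | rfl
    · rw [Equiv.Perm.mul_apply, Equiv.swap_apply_left]
      exact congrArg L.edge key.1
    · rw [Equiv.Perm.mul_apply, Equiv.swap_apply_right]
      exact congrArg L.edge key.2
  · rw [Equiv.Perm.mul_apply, Equiv.swap_apply_of_ne_of_ne]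
    · exact congrArg L.edge (smooth_away h.away hd).symm
    · rintro rfl; exact hd (o.in0_fst r)
    · rintro rfl; exact hd (o.in2_fst r)

/-- A saddle between resolutions of a classical diagram is not a projective plane. -/
theorem circ_ne_of_eq (o : L.SourceSink) (hL : L.IsClassical) {a b : L.State} {r : Fin L.n}
    (h : IsSaddle a b r)
    (e : circ0 a r = circ2 a r) : circ0 b r ≠ circ2 b r := by
  rw [Ne, o.circ_eq_iff hL, o.perm_saddle hL h]
  exact not_sameCycle_mul_swap ((o.circ_eq_iff hL a r).1 e) (o.in0_ne_in2 r r)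

theorem circ_eq_of_ne (o : L.SourceSink) (hL : L.IsClassical) {a b : L.State} {r : Fin L.n}
    (h : IsSaddle a b r)
    (e : circ0 a r ≠ circ2 a r) : circ0 b r = circ2 b r := by
  rw [o.circ_eq_iff hL, o.perm_saddle hL h]
  exact sameCycle_mul_swap fun e' => e ((o.circ_eq_iff hL a r).2 e')

/-- How the strings at two crossings are connected, if both crossings are changed and both of them
join two circles before and after that. -/
theorem circleOf_of_perm_eq (hL : L.IsClassical) {a d : L.State} {r s : Fin L.n} (hrs : r ≠ s)
    (h : o.perm hL d = o.perm hL a * Equiv.swap (o.in0 r) (o.in2 r) *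
      Equiv.swap (o.in0 s) (o.in2 s))
    (hr : circ0 a r ≠ circ2 a r) (hs : circ0 a s ≠ circ2 a s) :
    (circleOf a (o.in0 r).1 = circleOf a (o.in0 s).1 →
      circleOf a (o.in2 r).1 = circleOf a (o.in2 s).1 →
        circleOf d (o.in0 r).1 = circleOf d (o.in2 s).1 ∧
        circleOf d (o.in2 r).1 = circleOf d (o.in0 s).1) ∧
    (circleOf a (o.in0 r).1 = circleOf a (o.in2 s).1 →
      circleOf a (o.in2 r).1 = circleOf a (o.in0 s).1 →
        circleOf d (o.in0 r).1 = circleOf d (o.in0 s).1 ∧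
        circleOf d (o.in2 r).1 = circleOf d (o.in2 s).1) := by
  rw [Ne, o.circ_eq_iff hL] at hr hs
  simp only [o.circleOf_eq_iff hL, h]
  have hr' := fun e => hr (Equiv.Perm.SameCycle.symm e)
  have hs' := fun e => hs (Equiv.Perm.SameCycle.symm e)
  refine ⟨fun e0 e2 => ⟨?_, ?_⟩, fun e0 e2 => ⟨?_, ?_⟩⟩
  · exact sameCycle_mul_swap_mul_swap hr hs e2 fun e => hrs (o.in0_injective e)
  · rw [Equiv.swap_comm (o.in0 r), Equiv.swap_comm (o.in0 s)]
    exact sameCycle_mul_swap_mul_swap hr' hs' e0 fun e => hrs (o.in2_injective e)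
  · rw [Equiv.swap_comm (o.in0 s)]
    exact sameCycle_mul_swap_mul_swap hr hs' e2 (o.in0_ne_in2 r s)
  · rw [Equiv.swap_comm (o.in0 r)]
    exact sameCycle_mul_swap_mul_swap hr' hs e0 (o.in0_ne_in2 s r).symm

end SourceSink
end VLinkDiagram

/-! ## Saddles as pantsups and pantsdowns -/

namespace VLinkDiagram

variable {L : VLinkDiagram} {a b : L.State} {r : Fin L.n}

theorem circleOf_surjective {P : Circle a → Prop} (h : ∀ d, P (circleOf a d))
    (h' : ∀ l, P (Sum.inr l)) (c : Circle a) : P c := by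
  obtain ⟨⟨d⟩⟩ | l := c
  exacts [h d, h' l]

theorem circleOf_at_eq (h : circ0 a r = circ2 a r) (i j : Fin 4) :
    circleOf a (Sum.inl r, i) = circleOf a (Sum.inl r, j) := by
  have key : ∀ i, circleOf a (Sum.inl r, i) = circ0 a r := fun i => by
    rcases touched_at a r i with e | e
    exacts [e, e.trans h.symm]
  rw [key, key]

/-- If the two strings at `r` belong to one v-circle of `γ_b`, this sends the v-circle of `γ_a`
through a half-edge to the v-circle of `γ_b` through the same half-edge. -/
def mergeMap (h : ∀ x, x ≠ r → a x = b x) (hb : circ0 b r = circ2 b r) : Circle a → Circle b :=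
  Sum.elim
    (Quot.lift (circleOf b) (by
      rintro d _ (rfl | rfl)
      · exact (circleOf_edge b d).symm
      · by_cases hd : d.1 = Sum.inl r
        · obtain ⟨x, i⟩ := d
          obtain rfl : x = Sum.inl r := hd
          exact circleOf_at_eq hb _ _
        · rw [smooth_away h hd, circleOf_smooth]))
    Sum.inr

section MergeMap

variable (h : ∀ x, x ≠ r → a x = b x) (hb : circ0 b r = circ2 b r)

theorem mergeMap_circleOf (d : Dart L.n L.v) : mergeMap h hb (circleOf a d) = circleOf b d := rfl

theorem mergeMap_of_not_touched (c : Circle a) (hc : ¬ Touched a r c) :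
    mergeMap h hb c = transferAux h c := by
  revert hc
  refine circleOf_surjective (P := fun c => ¬ Touched a r c → mergeMap h hb c = transferAux h c)
    (fun d hd => ?_) (fun l _ => rfl) c
  rw [transferAux_circleOf h d hd, mergeMap_circleOf]

theorem touched_mergeMap {c : Circle a} (hc : Touched a r c) : Touched b r (mergeMap h hb c) := by
  rcases hc with rfl | rfl
  exacts [.inl rfl, .inr rfl]

theorem not_touched_mergeMap {c : Circle a} (hc : ¬ Touched a r c) :
    ¬ Touched b r (mergeMap h hb c) := by
  rw [mergeMap_of_not_touched h hb c hc]
  exact transferAux_not_touched h c hc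

/-- On untouched circles the map is injective because transfer back to `γ_a` inverts it. The two
touched circles go to the single touched circle of `γ_b`. -/
theorem isMerge_mergeMap (ha : circ0 a r ≠ circ2 a r) :
    IsMerge (mergeMap h hb) (circ0 a r) (circ2 a r) := by
  have h' : ∀ x, x ≠ r → b x = a x := fun x hx => (h x hx).symm
  refine ⟨ha, circleOf_surjective (fun d => ⟨circleOf a d, rfl⟩) fun l => ⟨Sum.inr l, rfl⟩,
    fun c c' => ⟨fun e => ?_, ?_⟩⟩
  · by_cases hc : Touched a r c
    · have hc' : Touched a r c' := by
        by_contra hc'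
        exact not_touched_mergeMap h hb hc' (e ▸ touched_mergeMap h hb hc)
      rcases hc with rfl | rfl <;> rcases hc' with rfl | rfl <;> simp
    · have hc' : ¬ Touched a r c' := fun hc' =>
        not_touched_mergeMap h hb hc (e ▸ touched_mergeMap h hb hc')
      rw [mergeMap_of_not_touched h hb c hc, mergeMap_of_not_touched h hb c' hc'] at e
      have e' := congrArg (transferAux h') e
      rw [transferAux_transferAux h h' c hc, transferAux_transferAux h h' c' hc'] at e'
      exact .inl e'
  · rintro (rfl | ⟨rfl, rfl⟩ | ⟨rfl, rfl⟩)
    exacts [rfl, hb, hb.symm]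

end MergeMap

section Saddle

variable (R : Type u) [CommRing R]

theorem tensor_perm_eq {X Y U V : Type} [Finite Y] [Finite U] (g : Cob R X Y) (e : U ≃ V) :
    g.tensor (Cob.perm e) = (g.tensor (Cob.perm (Equiv.refl U))).comp
      (Cob.perm (Equiv.sumCongr (Equiv.refl Y) e)) := by
  rw [← Cob.perm_tensor, ← Cob.tensor_comp, Cob.comp_perm_refl, Cob.perm_comp]
  rfl

theorem isMul_saddle (h : IsSaddle a b r) (ha : circ0 a r ≠ circ2 a r)
    (hb : circ0 b r = circ2 b r) : Cob.IsMul (mergeMap h.away hb) (saddle R h) := by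
  refine ⟨_, inferInstance, (split20 a r ha).symm,
    (Equiv.sumCongr (Equiv.refl _) (unaffected h)).trans (splitOne b r hb).symm, ?_, ?_⟩
  · rintro ((_ | _) | c)
    · exact hb.symm
    · rfl
    · exact mergeMap_of_not_touched h.away hb c.1 c.2
  · rw [saddle, dif_neg ha, dif_pos hb, tensor_perm_eq, Cob.comp_assoc, Cob.perm_comp]
    rfl

theorem isComul_saddle (h : IsSaddle a b r) (ha : circ0 a r = circ2 a r)
    (hb : circ0 b r ≠ circ2 b r) :
    Cob.IsComul (mergeMap (fun x hx => (h.away x hx).symm) ha) (saddle R h) := by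
  refine ⟨_, inferInstance, (Equiv.sumCongr (Equiv.refl _) (unaffected h)).trans
    (split02 b r hb).symm, (splitOne a r ha).symm, ?_, ?_⟩
  · rintro ((_ | _) | c)
    · rfl
    · exact ha.symm
    · have hc := (unaffected h c).2
      exact (mergeMap_of_not_touched _ ha _ hc).trans
        (transferAux_transferAux h.away (fun x hx => (h.away x hx).symm) c.1 c.2)
  · rw [saddle, dif_pos ha, dif_neg hb, tensor_perm_eq, Cob.comp_assoc, Cob.perm_comp]
    rfl

/-- The point with the largest number is the right string `circ0` for a merge and, in
`saddleSign_of_eq`, the upper string `circ2` for a split. All that later matters about `E` is which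
point it drops. -/
theorem saddleSign_of_ne (h : IsSaddle a b r) (ha : circ0 a r ≠ circ2 a r)
    (hb : circ0 b r = circ2 b r) : ∃ E, IsDrop (mergeMap h.away hb) (circ0 a r) E ∧
      ∀ ν μ, saddleSign h ν μ = numberingSign E ν μ := by
  refine ⟨_, ⟨?_, ?_⟩, fun ν μ => by rw [saddleSign, dif_neg ha, dif_pos hb]⟩
  · simp [← show (split20 a r ha).symm (.inl (.inr ())) = circ0 a r from rfl, dropSecond]
  · intro c hc
    obtain ⟨s, rfl⟩ := (split20 a r ha).symm.surjective c
    rcases s with (_ | _) | c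
    · simp only [Equiv.trans_apply, Equiv.apply_symm_apply]
      exact congrArg some hb
    · exact absurd rfl hc
    · simp only [Equiv.trans_apply, Equiv.apply_symm_apply]
      exact congrArg some (mergeMap_of_not_touched h.away hb c.1 c.2).symm

theorem saddleSign_of_eq (h : IsSaddle a b r) (ha : circ0 a r = circ2 a r)
    (hb : circ0 b r ≠ circ2 b r) :
    ∃ E, IsDrop (mergeMap (fun x hx => (h.away x hx).symm) ha) (circ2 b r) E ∧
      ∀ ν μ, saddleSign h ν μ = numberingSign E μ ν := by
  refine ⟨_, ⟨?_, ?_⟩, fun ν μ => by rw [saddleSign, dif_pos ha, dif_neg hb]⟩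
  · simp [← show (split02 b r hb).symm (.inl (.inr ())) = circ2 b r from rfl, dropSecond]
  · intro c hc
    obtain ⟨s, rfl⟩ := (split02 b r hb).symm.surjective c
    rcases s with (_ | _) | c
    · simp only [Equiv.trans_apply, Equiv.apply_symm_apply]
      rfl
    · exact absurd rfl hc
    · simp only [Equiv.trans_apply, Equiv.apply_symm_apply]
      exact congrArg some (mergeMap_of_not_touched _ ha c.1 c.2).symm

end Saddle

/-! ### Decorations -/

namespace SourceSink

variable (o : L.SourceSink) (hL : L.IsClassical)

/-- The v-circles whose orientation differs from the source-sink orientation. -/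
def reversed (oa : ResOrientation a) : Circle a → Bool :=
  Sum.elim
    (Quot.lift (fun d => xor (oa.out d) (o.out d)) (by
      rintro d _ (rfl | rfl)
      · simp [oa.out_edge, o.out_edge]
      · simp [oa.out_smooth, o.out_smooth hL]))
    oa.loopDir

theorem reversed_circleOf (oa : ResOrientation a) (d : Dart L.n L.v) :
    o.reversed hL oa (circleOf a d) = xor (oa.out d) (o.out d) := rfl

/-- The sign of a crossing in the source-sink orientation. -/
def sign (r : Fin L.n) : ℤˣ := if o.out (Sum.inl r, 0) then -1 else 1

/-- The source-sink orientation agrees at the half-edges `0` and `2`, so the gluing number depends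
only on the circle and on the crossing, even if both strings lie on one circle. -/
theorem gluingNeg_iff (oa : ResOrientation a) {c : Circle a} (hc : Touched a r c) :
    GluingNeg oa r c ↔ xor (o.reversed hL oa c) (o.out (Sum.inl r, 0)) = true := by
  have h0 : xor (o.reversed hL oa (circ0 a r)) (o.out (Sum.inl r, 0)) = oa.out (Sum.inl r, 0) := by
    rw [circ0, reversed_circleOf, Bool.xor_assoc, Bool.xor_self, Bool.xor_false]
  have h2 : xor (o.reversed hL oa (circ2 a r)) (o.out (Sum.inl r, 0)) = oa.out (Sum.inl r, 2) := by
    rw [circ2, reversed_circleOf, o.out_two, Bool.xor_assoc, Bool.xor_self, Bool.xor_false]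
  unfold GluingNeg
  rcases hc with rfl | rfl
  · rw [h0]
    constructor
    · rintro (⟨-, e⟩ | ⟨e, e'⟩)
      · exact e
      · rw [← h0, e, h2, e']
    · exact fun e => .inl ⟨rfl, e⟩
  · rw [h2]
    constructor
    · rintro (⟨e, e'⟩ | ⟨-, e⟩)
      · rw [← h2, e, h0, e']
      · exact e
    · exact fun e => .inr ⟨rfl, e⟩

theorem reversed_iff (oa : ResOrientation a) (ob : ResOrientation b) {c : Circle a} {c' : Circle b}
    (hd : ∀ d, c = circleOf a d → c' = circleOf b d) (hl : ∀ l, c = Sum.inr l → c' = Sum.inr l) :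
    Reversed oa ob c ↔ xor (o.reversed hL oa c) (o.reversed hL ob c') = true := by
  have key : ∀ d, c = circleOf a d →
      xor (o.reversed hL oa c) (o.reversed hL ob c') = xor (oa.out d) (ob.out d) := fun d e => by
    rw [hd d e, e, reversed_circleOf, reversed_circleOf]
    cases oa.out d <;> cases ob.out d <;> cases o.out d <;> rfl
  have key' : ∀ l, c = Sum.inr l →
      xor (o.reversed hL oa c) (o.reversed hL ob c') = xor (oa.loopDir l) (ob.loopDir l) :=
    fun l e => by rw [hl l e, e]; rfl
  unfold Reversed
  constructor
  · rintro (⟨d, e, e'⟩ | ⟨l, e, e'⟩)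
    · rw [key d e]; simpa using e'
    · rw [key' l e]; simpa using e'
  · obtain ⟨⟨d⟩⟩ | l := c
    · intro e
      rw [key d rfl] at e
      exact .inl ⟨d, rfl, by simpa using e⟩
    · intro e
      rw [key' l rfl] at e
      exact .inr ⟨l, rfl, by simpa using e⟩

theorem topDecoration_of_touched (oa : ResOrientation a) (ob : ResOrientation b)
    (ht : ¬ IsTheta a b r) {c : Circle a} (hc : Touched a r c) :
    topDecoration oa ob r c = xor (o.reversed hL oa c) (o.out (Sum.inl r, 0)) := by
  classical
  rw [topDecoration, if_pos hc, Bool.eq_iff_iff, decide_eq_true_iff, o.gluingNeg_iff hL oa hc]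
  exact and_iff_right ht

theorem bottomDecoration_of_touched (ob : ResOrientation b) (ht : ¬ IsTheta a b r) {c : Circle b}
    (hc : Touched b r c) :
    bottomDecoration a ob r c = xor (o.reversed hL ob c) (o.out (Sum.inl r, 0)) := by
  classical
  rw [bottomDecoration, Bool.eq_iff_iff, decide_eq_true_iff, o.gluingNeg_iff hL ob hc]
  exact and_iff_right ht

theorem bottomDecoration_of_not_touched (ob : ResOrientation b) {c : Circle b}
    (hc : ¬ Touched b r c) : bottomDecoration a ob r c = false := by
  classical
  rw [bottomDecoration, decide_eq_false_iff_not]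
  rintro ⟨-, ⟨e, -⟩ | ⟨e, -⟩⟩
  exacts [hc (.inl e), hc (.inr e)]

theorem topDecoration_of_not_touched (oa : ResOrientation a) (ob : ResOrientation b)
    {c : Circle a} {c' : Circle b} (hd : ∀ d, c = circleOf a d → c' = circleOf b d)
    (hl : ∀ l, c = Sum.inr l → c' = Sum.inr l) (hc : ¬ Touched a r c) :
    topDecoration oa ob r c = xor (o.reversed hL oa c) (o.reversed hL ob c') := by
  classical
  rw [topDecoration, if_neg hc, Bool.eq_iff_iff, decide_eq_true_iff,
    o.reversed_iff hL oa ob hd hl]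

/-- The sign of a decorated saddle after passing to the source-sink orientation. -/
def virtualSign (ch : L.Choices) (h : IsSaddle a b r) : ℤˣ :=
  saddleSign h (ch.number a) (ch.number b) * if circ0 a r = circ2 a r then o.sign r else 1

/-- On touched circles the decoration is `reversed` plus a constant of the crossing. On unaffected
ones it is the sum of the values of `reversed` in the source and the target. `change_decoration`
removes the constant, at the cost of `sign r` for a split. -/
theorem decoratedSaddle_eq (R : Type u) [CommRing R] (ch : L.Choices) (h : IsSaddle a b r) :
    decoratedSaddle R ch h = ((o.virtualSign ch h : ℤˣ) : ℤ) •
      (Cob.cyl (Equiv.refl _) (o.reversed hL (ch.orient a))).comp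
        ((saddle R h).comp (Cob.cyl (Equiv.refl _) (o.reversed hL (ch.orient b)))) := by
  unfold decoratedSaddle virtualSign
  by_cases ha : circ0 a r = circ2 a r
  · have hb := o.circ_ne_of_eq hL h ha
    have ht : ¬ IsTheta a b r := fun t => hb t.2
    have hm := isMerge_mergeMap (fun x hx => (h.away x hx).symm) ha hb
    rw [(isComul_saddle R h ha hb).change_decoration hm (o.out (Sum.inl r, 0))
      (v := o.reversed hL (ch.orient b)) (v' := o.reversed hL (ch.orient a))
      (o.bottomDecoration_of_touched hL _ ht (.inl rfl))
      (o.bottomDecoration_of_touched hL _ ht (.inr rfl))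
      (o.topDecoration_of_touched hL _ _ ht (.inl rfl)) ?_, if_pos ha]
    · unfold sign
      cases o.out (Sum.inl r, 0)
      · simp
      · simp
    · intro c h0 h2
      have hc : ¬ Touched b r c := by rintro (e | e); exacts [h0 e, h2 e]
      rw [bottomDecoration_of_not_touched _ hc, Bool.xor_false]
      have hc' := not_touched_mergeMap (fun x hx => (h.away x hx).symm) ha hc
      have inv : mergeMap (fun x hx => (h.away x hx).symm) ha c =
          transferAux (fun x hx => (h.away x hx).symm) c := mergeMap_of_not_touched _ _ _ hc
      have inv' : transferAux h.away (mergeMap (fun x hx => (h.away x hx).symm) ha c) = c := by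
        rw [inv, transferAux_transferAux _ _ _ hc]
      refine o.topDecoration_of_not_touched hL _ _ (fun d hd => ?_) (fun l hl => ?_) hc'
      · rw [← inv', hd]
        exact transferAux_circleOf h.away d (hd ▸ hc')
      · rw [← inv', hl]
        rfl
  · have hb := o.circ_eq_of_ne hL h ha
    have ht : ¬ IsTheta a b r := fun t => ha t.1
    have hm := isMerge_mergeMap h.away hb ha
    rw [(isMul_saddle R h ha hb).change_decoration hm (o.out (Sum.inl r, 0))
      (v := o.reversed hL (ch.orient a)) (v' := o.reversed hL (ch.orient b))
      (o.topDecoration_of_touched hL _ _ ht (.inl rfl))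
      (o.topDecoration_of_touched hL _ _ ht (.inr rfl))
      (o.bottomDecoration_of_touched hL _ ht (.inl rfl)) ?_, if_neg ha, mul_one]
    intro c h0 h2
    have hc : ¬ Touched a r c := by rintro (e | e); exacts [h0 e, h2 e]
    rw [bottomDecoration_of_not_touched _ (not_touched_mergeMap h.away hb hc), Bool.xor_false]
    refine o.topDecoration_of_not_touched hL _ _ (fun d hd => ?_) (fun l hl => ?_) hc
    · rw [hd]; rfl
    · rw [hl]; rfl

end SourceSink
end VLinkDiagram

/-! ## The two-dimensional faces of the cube of resolutions -/

theorem exists_equiv_of_ker {T B B' : Type} {p : T → B} {q : T → B'} (hp : Function.Surjective p)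
    (hq : Function.Surjective q) (h : ∀ s t, p s = p t ↔ q s = q t) :
    ∃ e : B ≃ B', ∀ t, q t = e (p t) := by
  choose i hi using hp
  refine ⟨Equiv.ofBijective (fun b => q (i b)) ⟨fun b b' e => ?_, fun b' => ?_⟩, fun t => ?_⟩
  · rw [← hi b, ← hi b']
    exact (h _ _).2 e
  · obtain ⟨t, rfl⟩ := hq b'
    exact ⟨p t, (h _ _).1 (hi _)⟩
  · exact ((h _ _).1 (hi _)).symm

theorem IsMerge.pair_eq {A B : Type} {π : A → B} {x y x' y' : A} (h : IsMerge π x y) (hne : x' ≠ y')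
    (e : π x' = π y') : (x' = x ∧ y' = y) ∨ (x' = y ∧ y' = x) :=
  ((h.ker _ _).1 e).resolve_left hne

namespace VLinkDiagram

variable {L : VLinkDiagram}

/-- A face of the cube of resolutions. -/
structure IsFace (a b c d : L.State) (r s : Fin L.n) : Prop where
  ab : IsSaddle a b r
  ac : IsSaddle a c s
  bd : IsSaddle b d s
  cd : IsSaddle c d r

namespace IsFace

variable {a b c d : L.State} {r s : Fin L.n}

theorem ne (F : IsFace a b c d r s) : r ≠ s := by
  rintro rfl
  exact Bool.noConfusion (F.ab.tgt.symm.trans F.bd.src)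

theorem transpose (F : IsFace a b c d r s) : IsFace a c b d s r := ⟨F.ac, F.ab, F.cd, F.bd⟩

end IsFace

namespace SourceSink

variable (o : L.SourceSink) (hL : L.IsClassical) {a b c d : L.State} {r s : Fin L.n}

/-- The count discards the combinations of merges and splits that cannot bound a face. -/
theorem card_circle (o : L.SourceSink) (hL : L.IsClassical) (h : IsSaddle a b r) :
    (circ0 a r = circ2 a r ∧ Fintype.card (Circle a) + 1 = Fintype.card (Circle b)) ∨
      (circ0 a r ≠ circ2 a r ∧ Fintype.card (Circle b) + 1 = Fintype.card (Circle a)) := by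
  by_cases ha : circ0 a r = circ2 a r
  · obtain ⟨E, -, -⟩ := saddleSign_of_eq h ha (o.circ_ne_of_eq hL h ha)
    exact .inl ⟨ha, card_of_equiv_option E⟩
  · obtain ⟨E, -, -⟩ := saddleSign_of_ne h ha (o.circ_eq_of_ne hL h ha)
    exact .inr ⟨ha, card_of_equiv_option E⟩

/-- The two transpositions turn the matching of `in0 r`, `in2 r` with `in0 s`, `in2 s` into the
opposite one. At `d` both crossings have their `1`-resolution, so translating to `circ0` and `circ2`
exchanges the labels at each crossing of sign `-1`. The product of all these signs is `-1` in each
case. -/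
theorem sign_of_merge_split (hL : L.IsClassical) (F : IsFace a b c d r s)
    (har : circ0 a r ≠ circ2 a r) (has : circ0 a s ≠ circ2 a s) (hdr : circ0 d r ≠ circ2 d r)
    (hpair : (circ0 a s = circ0 a r ∧ circ2 a s = circ2 a r) ∨
      (circ0 a s = circ2 a r ∧ circ2 a s = circ0 a r)) :
    (if circ0 a r = circ0 a s then 1 else -1) * (if circ2 d s = circ2 d r then 1 else -1) *
      (o.sign r * o.sign s) = -1 := by
  have hP : o.perm hL d = o.perm hL a * Equiv.swap (o.in0 r) (o.in2 r) *
      Equiv.swap (o.in0 s) (o.in2 s) := by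
    rw [o.perm_saddle hL F.bd, o.perm_saddle hL F.ab]
  obtain ⟨h1, h2⟩ := o.circleOf_of_perm_eq hL F.ne hP har has
  rw [o.circ0_eq_of_false F.ab.src, o.circ2_eq_of_false F.ab.src] at *
  rw [o.circ0_eq_of_false F.ac.src, o.circ2_eq_of_false F.ac.src] at *
  rw [o.circ0_eq_of_true F.cd.tgt, o.circ2_eq_of_true F.cd.tgt] at *
  rw [o.circ2_eq_of_true F.bd.tgt] at *
  unfold sign
  cases o.out (Sum.inl r, 0) <;> cases o.out (Sum.inl s, 0) <;>
    simp only [if_true, if_false, Bool.false_eq_true] at * <;> split_ifs <;>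
    first | rfl | (exfalso; grind)

theorem sign_of_split_merge (hL : L.IsClassical) (F : IsFace a b c d r s)
    (hbr : circ0 b r ≠ circ2 b r) (hbs : circ0 b s ≠ circ2 b s) (hcs : circ0 c s ≠ circ2 c s)
    (hpair : (circ0 b s = circ0 b r ∧ circ2 b s = circ2 b r) ∨
      (circ0 b s = circ2 b r ∧ circ2 b s = circ0 b r)) :
    (if circ2 b r = circ0 b s then 1 else -1) * (if circ2 c s = circ0 c r then 1 else -1) *
      (o.sign r * o.sign s) = -1 := by
  -- The corners `b` and `c` also differ by both transpositions, since the one at `r` is its own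
  -- inverse.
  have hP : o.perm hL c = o.perm hL b * Equiv.swap (o.in0 r) (o.in2 r) *
      Equiv.swap (o.in0 s) (o.in2 s) := by
    rw [o.perm_saddle hL F.ac, o.perm_saddle hL F.ab, mul_assoc (o.perm hL a), Equiv.swap_mul_self,
      mul_one]
  obtain ⟨h1, h2⟩ := o.circleOf_of_perm_eq hL F.ne hP hbr hbs
  rw [o.circ0_eq_of_true F.ab.tgt, o.circ2_eq_of_true F.ab.tgt] at *
  rw [o.circ0_eq_of_false F.bd.src, o.circ2_eq_of_false F.bd.src] at *
  rw [o.circ0_eq_of_true F.ac.tgt, o.circ2_eq_of_true F.ac.tgt] at *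
  rw [o.circ0_eq_of_false F.cd.src] at *
  unfold sign
  cases o.out (Sum.inl r, 0) <;> cases o.out (Sum.inl s, 0) <;>
    simp only [if_true, if_false, Bool.false_eq_true] at * <;> split_ifs <;>
    first | rfl | (exfalso; grind)

end SourceSink
end VLinkDiagram

/-! ### The types of faces -/

namespace VLinkDiagram.SourceSink

variable {L : VLinkDiagram} (o : L.SourceSink) {a b c d : L.State} {r s : Fin L.n}

/-- The saddles commute and their signs anticommute around the face `F`. -/
def FaceRelation (R : Type u) [CommRing R] (ch : L.Choices) (F : IsFace a b c d r s) : Prop :=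
  (saddle R F.ab).comp (saddle R F.bd) = (saddle R F.ac).comp (saddle R F.cd) ∧
    (o.virtualSign ch F.ab * o.virtualSign ch F.bd) *
      (o.virtualSign ch F.ac * o.virtualSign ch F.cd) = -1

theorem FaceRelation.transpose {R : Type u} [CommRing R] {ch : L.Choices} {F : IsFace a b c d r s}
    (h : o.FaceRelation R ch F.transpose) : o.FaceRelation R ch F :=
  ⟨h.1.symm, (mul_comm _ _).trans h.2⟩

variable (R : Type u) [CommRing R] (ch : L.Choices)

theorem face_merge (hL : L.IsClassical) (F : IsFace a b c d r s) (hab : circ0 a r ≠ circ2 a r)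
    (hac : circ0 a s ≠ circ2 a s) (hbd : circ0 b s ≠ circ2 b s) (hcd : circ0 c r ≠ circ2 c r) :
    o.FaceRelation R ch F := by
  have hb := o.circ_eq_of_ne hL F.ab hab
  have hc := o.circ_eq_of_ne hL F.ac hac
  have hds := o.circ_eq_of_ne hL F.bd hbd
  have hdr := o.circ_eq_of_ne hL F.cd hcd
  -- The second point of each pair is the one dropped by the induced numbering: `circ0` for a merge,
  -- and `circ2` for a split in the faces below.
  have S : MergeSquare (mergeMap F.ab.away hb) (mergeMap F.ac.away hc) (mergeMap F.bd.away hds)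
      (mergeMap F.cd.away hdr) (circ2 a r) (circ0 a r) (circ2 a s) (circ0 a s) :=
    ⟨circleOf_surjective (fun _ => rfl) fun _ => rfl, (isMerge_mergeMap _ _ hab).symm,
      (isMerge_mergeMap _ _ hac).symm, (isMerge_mergeMap _ _ hbd).symm,
      (isMerge_mergeMap _ _ hcd).symm⟩
  refine ⟨S.mul_mul (isMul_saddle R _ hab hb) (isMul_saddle R _ hac hc) (isMul_saddle R _ hbd hds)
    (isMul_saddle R _ hcd hdr), ?_⟩
  obtain ⟨E1, h1, e1⟩ := saddleSign_of_ne F.ab hab hb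
  obtain ⟨E2, h2, e2⟩ := saddleSign_of_ne F.ac hac hc
  obtain ⟨E3, h3, e3⟩ := saddleSign_of_ne F.bd hbd hds
  obtain ⟨E4, h4, e4⟩ := saddleSign_of_ne F.cd hcd hdr
  unfold virtualSign
  rw [if_neg hab, if_neg hac, if_neg hbd, if_neg hcd, e1, e2, e3, e4]
  simp only [mul_one]
  exact numberingSign_square S h1 h2 h3 h4 _ _ _ _

/-- Read backwards from `d`, the face is a merge square. Each of `sign r` and `sign s` occurs twice
and cancels. -/
theorem face_split (hL : L.IsClassical) (F : IsFace a b c d r s) (hab : circ0 a r = circ2 a r)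
    (hac : circ0 a s = circ2 a s) (hbd : circ0 b s = circ2 b s) (hcd : circ0 c r = circ2 c r) :
    o.FaceRelation R ch F := by
  have hb := o.circ_ne_of_eq hL F.ab hab
  have hc := o.circ_ne_of_eq hL F.ac hac
  have hds := o.circ_ne_of_eq hL F.bd hbd
  have hdr := o.circ_ne_of_eq hL F.cd hcd
  have S : MergeSquare (mergeMap (fun x hx => (F.cd.away x hx).symm) hcd)
      (mergeMap (fun x hx => (F.bd.away x hx).symm) hbd)
      (mergeMap (fun x hx => (F.ac.away x hx).symm) hac)
      (mergeMap (fun x hx => (F.ab.away x hx).symm) hab)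
      (circ0 d r) (circ2 d r) (circ0 d s) (circ2 d s) :=
    ⟨circleOf_surjective (fun _ => rfl) fun _ => rfl, isMerge_mergeMap _ _ hdr,
      isMerge_mergeMap _ _ hds, isMerge_mergeMap _ _ hc, isMerge_mergeMap _ _ hb⟩
  refine ⟨(S.comul_comul (isComul_saddle R _ hcd hdr) (isComul_saddle R _ hbd hds)
    (isComul_saddle R _ hac hc) (isComul_saddle R _ hab hb)).symm, ?_⟩
  obtain ⟨E1, h1, e1⟩ := saddleSign_of_eq F.ab hab hb
  obtain ⟨E2, h2, e2⟩ := saddleSign_of_eq F.ac hac hc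
  obtain ⟨E3, h3, e3⟩ := saddleSign_of_eq F.bd hbd hds
  obtain ⟨E4, h4, e4⟩ := saddleSign_of_eq F.cd hcd hdr
  unfold virtualSign
  rw [if_pos hab, if_pos hac, if_pos hbd, if_pos hcd, e1, e2, e3, e4]
  refine Eq.trans ?_ (numberingSign_square S h4 h3 h2 h1 (ch.number d) (ch.number c)
    (ch.number b) (ch.number a))
  rcases Int.units_eq_one_or (o.sign r) with hr | hr <;>
    rcases Int.units_eq_one_or (o.sign s) with hs | hs <;> rw [hr, hs] <;>
    simp only [mul_one, mul_neg, neg_mul, neg_neg] <;> ac_rfl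

/-- The corner `b` has the most circles and serves as the source of the merge square. The factor
`sign r` occurs twice. -/
theorem face_split_merge (hL : L.IsClassical) (F : IsFace a b c d r s)
    (hab : circ0 a r = circ2 a r) (hac : circ0 a s ≠ circ2 a s) (hbd : circ0 b s ≠ circ2 b s)
    (hcd : circ0 c r = circ2 c r) : o.FaceRelation R ch F := by
  have hb := o.circ_ne_of_eq hL F.ab hab
  have hc := o.circ_eq_of_ne hL F.ac hac
  have hds := o.circ_eq_of_ne hL F.bd hbd
  have hdr := o.circ_ne_of_eq hL F.cd hcd
  have S : MergeSquare (mergeMap (fun x hx => (F.ab.away x hx).symm) hab)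
      (mergeMap F.bd.away hds) (mergeMap F.ac.away hc)
      (mergeMap (fun x hx => (F.cd.away x hx).symm) hcd)
      (circ0 b r) (circ2 b r) (circ2 b s) (circ0 b s) :=
    ⟨circleOf_surjective (fun _ => rfl) fun _ => rfl, isMerge_mergeMap _ _ hb,
      (isMerge_mergeMap _ _ hbd).symm, (isMerge_mergeMap _ _ hac).symm, isMerge_mergeMap _ _ hdr⟩
  refine ⟨S.comul_mul (isComul_saddle R _ hab hb) (isMul_saddle R _ hbd hds)
    (isMul_saddle R _ hac hc) (isComul_saddle R _ hcd hdr), ?_⟩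
  obtain ⟨E1, h1, e1⟩ := saddleSign_of_eq F.ab hab hb
  obtain ⟨E2, h2, e2⟩ := saddleSign_of_ne F.ac hac hc
  obtain ⟨E3, h3, e3⟩ := saddleSign_of_ne F.bd hbd hds
  obtain ⟨E4, h4, e4⟩ := saddleSign_of_eq F.cd hcd hdr
  unfold virtualSign
  rw [if_pos hab, if_neg hac, if_neg hbd, if_pos hcd, e1, e2, e3, e4]
  refine Eq.trans ?_ (numberingSign_square S h1 h3 h2 h4 (ch.number b) (ch.number a)
    (ch.number d) (ch.number c))
  rcases Int.units_eq_one_or (o.sign r) with hr | hr <;> rw [hr] <;>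
    simp only [mul_one, mul_neg, neg_mul, neg_neg] <;> ac_rfl

/-- The strings at `s` share a circle in `γ_a` but not after the splitting at `r`. So they separate
exactly the two new circles, which are merged again: both paths add a handle to the same circle. -/
theorem face_handle (hL : L.IsClassical) (F : IsFace a b c d r s)
    (hab : circ0 a r = circ2 a r) (hac : circ0 a s = circ2 a s) (hbd : circ0 b s ≠ circ2 b s)
    (hcd : circ0 c r ≠ circ2 c r) : o.FaceRelation R ch F := by
  have hb := o.circ_ne_of_eq hL F.ab hab
  have hc := o.circ_ne_of_eq hL F.ac hac
  have hds := o.circ_eq_of_ne hL F.bd hbd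
  have hdr := o.circ_eq_of_ne hL F.cd hcd
  have hf := isMerge_mergeMap (fun x hx => (F.ab.away x hx).symm) hab hb
  have hf' := isMerge_mergeMap (fun x hx => (F.ac.away x hx).symm) hac hc
  have hg := isMerge_mergeMap F.bd.away hds hbd
  have pb := hf.pair_eq hbd hac
  have pc := hf'.pair_eq hcd hab
  have e : circ0 a r = circ0 a s := by
    rcases pb with ⟨h, -⟩ | ⟨h, -⟩
    · exact (congrArg (mergeMap (fun x hx => (F.ab.away x hx).symm) hab) h).symm
    · exact hab.trans (congrArg (mergeMap (fun x hx => (F.ab.away x hx).symm) hab) h).symm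
  -- Both maps out of `γ_b` merge the same pair, so `γ_a` and `γ_d` have matching circles.
  obtain ⟨θ, hθ⟩ := exists_equiv_of_ker hf.surj hg.surj fun t t' => by
    rw [hf.ker, hg.ker]
    rcases pb with ⟨h, h'⟩ | ⟨h, h'⟩ <;> rw [h, h']
    rw [or_comm (a := t = circ2 b r ∧ _)]
  have hθ' : ∀ t, mergeMap F.cd.away hdr t =
      θ (mergeMap (fun x hx => (F.ac.away x hx).symm) hac t) :=
    circleOf_surjective (fun e => hθ (circleOf b e)) fun l => hθ (Sum.inr l)
  refine ⟨Cob.comul_mul_of_handle hf hf' e θ hθ hθ' (isComul_saddle R _ hab hb)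
    (isMul_saddle R _ hbd hds) (isComul_saddle R _ hac hc) (isMul_saddle R _ hcd hdr), ?_⟩
  obtain ⟨E1, h1, e1⟩ := saddleSign_of_eq F.ab hab hb
  obtain ⟨E2, h2, e2⟩ := saddleSign_of_eq F.ac hac hc
  obtain ⟨E3, h3, e3⟩ := saddleSign_of_ne F.bd hbd hds
  obtain ⟨E4, h4, e4⟩ := saddleSign_of_ne F.cd hcd hdr
  unfold virtualSign
  rw [if_pos hab, if_pos hac, if_neg hbd, if_neg hcd, e1, e2, e3, e4]
  have k1 := numberingSign_mul_of_equiv hf θ hθ (.inr rfl) (pb.imp And.left And.left) h1 h3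
    (ch.number b) (ch.number a) (ch.number d)
  have k2 := numberingSign_mul_of_equiv hf' θ hθ' (.inr rfl) (pc.imp And.left And.left) h2 h4
    (ch.number c) (ch.number a) (ch.number d)
  have k3 : ∀ p q p' q' x y : ℤˣ, p * x * (p' * 1) * (q * y * (q' * 1)) =
      (p * p') * (q * q') * (x * y) := fun p q p' q' x y => by simp only [mul_one]; ac_rfl
  rw [k3, k1, k2, mul_mul_mul_comm _ (relSign _ _), Int.units_mul_self, mul_one]
  exact o.sign_of_split_merge hL F hb hbd hc pb

/-- After the merge at `r` the strings at `s` share a circle, so both crossings join the same two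
circles of `γ_a`. Both paths merge these and split the result into the circles of `γ_d`. -/
theorem face_bridge (hL : L.IsClassical) (F : IsFace a b c d r s)
    (hab : circ0 a r ≠ circ2 a r) (hac : circ0 a s ≠ circ2 a s) (hbd : circ0 b s = circ2 b s)
    (hcd : circ0 c r = circ2 c r) : o.FaceRelation R ch F := by
  have hb := o.circ_eq_of_ne hL F.ab hab
  have hc := o.circ_eq_of_ne hL F.ac hac
  have hds := o.circ_ne_of_eq hL F.bd hbd
  have hdr := o.circ_ne_of_eq hL F.cd hcd
  have hf := isMerge_mergeMap F.ab.away hb hab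
  have hf' := isMerge_mergeMap F.ac.away hc hac
  have hk := isMerge_mergeMap (fun x hx => (F.bd.away x hx).symm) hbd hds
  have pa := hf.pair_eq hac hbd
  obtain ⟨ψ, hψ⟩ := exists_equiv_of_ker hf.surj hf'.surj fun t t' => by
    rw [hf.ker, hf'.ker]
    rcases pa with ⟨h, h'⟩ | ⟨h, h'⟩ <;> rw [h, h']
    rw [or_comm (a := t = circ2 a r ∧ _)]
  have hψ' : ∀ t, mergeMap (fun x hx => (F.cd.away x hx).symm) hcd t =
      ψ (mergeMap (fun x hx => (F.bd.away x hx).symm) hbd t) :=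
    circleOf_surjective (fun e => hψ (circleOf a e)) fun l => hψ (Sum.inr l)
  have pd := hk.pair_eq hdr (ψ.injective ((hψ' (circ0 d r)).symm.trans
    (hcd.trans (hψ' (circ2 d r)))))
  refine ⟨Cob.mul_comul_of_equiv ψ hψ hψ' (isMul_saddle R _ hab hb) (isComul_saddle R _ hbd hds)
    (isMul_saddle R _ hac hc) (isComul_saddle R _ hcd hdr), ?_⟩
  obtain ⟨E1, h1, e1⟩ := saddleSign_of_ne F.ab hab hb
  obtain ⟨E2, h2, e2⟩ := saddleSign_of_ne F.ac hac hc
  obtain ⟨E3, h3, e3⟩ := saddleSign_of_eq F.bd hbd hds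
  obtain ⟨E4, h4, e4⟩ := saddleSign_of_eq F.cd hcd hdr
  unfold virtualSign
  rw [if_neg hab, if_neg hac, if_pos hbd, if_pos hcd, e1, e2, e3, e4]
  have k1 := numberingSign_mul_of_equiv hf ψ hψ (.inl rfl) (pa.imp And.left And.left) h1 h2
    (ch.number a) (ch.number b) (ch.number c)
  have k2 := numberingSign_mul_of_equiv hk ψ hψ' (.inr rfl)
    (pd.symm.imp And.right And.right) h3 h4 (ch.number d) (ch.number b) (ch.number c)
  have k3 : ∀ p q p' q' x y : ℤˣ, p * 1 * (p' * x) * (q * 1 * (q' * y)) =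
      (p * q) * (p' * q') * (y * x) := fun p q p' q' x y => by simp only [mul_one]; ac_rfl
  rw [k3, k1, k2, mul_mul_mul_comm _ (relSign _ _), Int.units_mul_self, mul_one]
  exact o.sign_of_merge_split hL F hab hac hdr pa

theorem faceRelation (hL : L.IsClassical) (F : IsFace a b c d r s) : o.FaceRelation R ch F := by
  -- Of the sixteen combinations six are compatible with the number of circles at `d`. Two of these
  -- are transposes of each other.
  rcases o.card_circle hL F.ab with ⟨hab, c1⟩ | ⟨hab, c1⟩ <;>
    rcases o.card_circle hL F.ac with ⟨hac, c2⟩ | ⟨hac, c2⟩ <;>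
    rcases o.card_circle hL F.bd with ⟨hbd, c3⟩ | ⟨hbd, c3⟩ <;>
    rcases o.card_circle hL F.cd with ⟨hcd, c4⟩ | ⟨hcd, c4⟩ <;>
    first
    | exact o.face_merge R ch hL F hab hac hbd hcd
    | exact o.face_split R ch hL F hab hac hbd hcd
    | exact o.face_split_merge R ch hL F hab hac hbd hcd
    | exact o.face_handle R ch hL F hab hac hbd hcd
    | exact o.face_bridge R ch hL F hab hac hbd hcd
    | exact FaceRelation.transpose o (o.face_split_merge R ch hL F.transpose hac hab hcd hbd)
    | omega

end VLinkDiagram.SourceSink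

/-! ## Comparison of the signs -/

/-- A sign assignment on the edges of a cube whose product around every face is trivial is a
coboundary. -/
theorem exists_sign_potential {n : ℕ} (s : (Fin n → Bool) → Fin n → ℤˣ)
    (hs : ∀ a k l, k ≠ l → a k = false → a l = false →
      s a k * s (Function.update a k true) l = s a l * s (Function.update a l true) k) :
    ∃ t : (Fin n → Bool) → ℤˣ, ∀ a k, a k = false → s a k = t a * t (Function.update a k true) := by
  suffices h : ∀ S : Finset (Fin n), ∃ t : (Fin n → Bool) → ℤˣ, ∀ a, ∀ k ∈ S, a k = false →
      s a k = t a * t (Function.update a k true) by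
    obtain ⟨t, ht⟩ := h Finset.univ
    exact ⟨t, fun a k => ht a k (Finset.mem_univ k)⟩
  intro S
  induction S using Finset.induction_on with
  | empty => exact ⟨fun _ => 1, by simp⟩
  | insert k S _ ih =>
    obtain ⟨t, ht⟩ := ih
    let p : (Fin n → Bool) → Fin n → Bool := fun a => Function.update a k false
    -- The potential is kept where the letter `k` is `0` and transported along the edge in direction
    -- `k` elsewhere.
    refine ⟨fun a => if a k then t (p a) * s (p a) k else t a, fun a l hl ha => ?_⟩
    by_cases hkl : l = k
    · subst hkl
      have e : p (Function.update a l true) = a := by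
        simp only [p]
        rw [Function.update_idem, ← ha, Function.update_eq_self]
      simp only [ha, Function.update_self, e, if_true, Bool.false_eq_true, if_false]
      rw [← mul_assoc, Int.units_mul_self, one_mul]
    · have hl' : l ∈ S := (Finset.mem_insert.1 hl).resolve_left hkl
      have e : Function.update a l true k = a k := Function.update_of_ne (Ne.symm hkl) _ _
      cases hak : a k
      · simp only [e, hak, Bool.false_eq_true, if_false]
        exact ht a l hl' ha
      · have hp : p (Function.update a l true) = Function.update (p a) l true :=
          Function.update_comm hkl _ _ _
        have hpl : p a l = false := (Function.update_of_ne hkl _ _).trans ha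
        have hpk : Function.update (p a) k true = a := by
          rw [Function.update_idem, ← hak, Function.update_eq_self]
        simp only [e, hak, if_true, hp]
        -- For edges in direction `l` on the far side, the relation on the face spanned by `k` and
        -- `l` reduces to the near side.
        have h1 := hs (p a) k l (Ne.symm hkl) (Function.update_self _ _ _) hpl
        rw [hpk] at h1
        rw [← mul_right_inj (s (p a) k), h1, ht _ _ hl' hpl]
        have h2 : ∀ x y u v : ℤˣ, x * y * u = v * (x * v * (y * u)) := fun x y u v => by
          have := Int.units_mul_self v
          calc x * y * u = v * v * (x * y * u) := by rw [this, one_mul]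
            _ = _ := by ac_rfl
        exact h2 _ _ _ _

/-! ### Faces of the cube and the classical signs -/

namespace VLinkDiagram

variable {L : VLinkDiagram} {a b c d : L.State} {r s : Fin L.n}

theorem isSaddle_iff : IsSaddle a b r ↔ a r = false ∧ b = Function.update a r true := by
  constructor
  · intro h
    refine ⟨h.src, funext fun x => ?_⟩
    by_cases hx : x = r
    · subst hx; rw [Function.update_self, h.tgt]
    · rw [Function.update_of_ne hx, h.away x hx]
  · rintro ⟨h, rfl⟩
    exact ⟨h, Function.update_self _ _ _, fun x hx => (Function.update_of_ne hx _ _).symm⟩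

theorem isSaddle_update (h : a r = false) : IsSaddle a (Function.update a r true) r :=
  isSaddle_iff.2 ⟨h, rfl⟩

theorem ones_of_isSaddle (h : IsSaddle a b r) : ones b = ones a + 1 := by
  have : (Finset.univ.filter fun x => b x = true) =
      insert r (Finset.univ.filter fun x => a x = true) := by
    ext x
    by_cases hx : x = r
    · subst hx; simp [h.tgt]
    · simp [hx, h.away x hx]
  rw [ones, this, Finset.card_insert_of_notMem (by simp [h.src])]
  rfl

/-- Two consecutive saddles are part of a face. -/
theorem IsSaddle.face (h : IsSaddle a b r) (h' : IsSaddle b d s) : ∃ c, IsFace a b c d r s := by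
  have hrs : s ≠ r := by
    rintro rfl
    exact Bool.noConfusion (h'.src.symm.trans h.tgt)
  have hs : a s = false := (h.away s hrs).trans h'.src
  obtain ⟨hr, rfl⟩ := isSaddle_iff.1 h
  obtain ⟨-, rfl⟩ := isSaddle_iff.1 h'
  refine ⟨Function.update a s true, h, isSaddle_update hs, h', isSaddle_iff.2
    ⟨(Function.update_of_ne hrs.symm _ _).trans hr, Function.update_comm hrs.symm _ _ _⟩⟩

theorem isFace_update (hrs : r ≠ s) (hr : a r = false) (hs : a s = false) :
    IsFace a (Function.update a r true) (Function.update a s true)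
      (Function.update (Function.update a r true) s true) r s :=
  ⟨isSaddle_update hr, isSaddle_update hs,
    isSaddle_update ((Function.update_of_ne hrs.symm _ _).trans hs),
    isSaddle_iff.2 ⟨(Function.update_of_ne hrs _ _).trans hr, Function.update_comm hrs _ _ _⟩⟩

/-- The sign in the classical Khovanov complex. -/
def classicalSign (a : L.State) (r : Fin L.n) : ℤˣ :=
  (-1) ^ (Finset.univ.filter fun x : Fin L.n => x < r ∧ a x = true).card

theorem classicalSign_of_isSaddle (h : IsSaddle a b s) :
    classicalSign b r = classicalSign a r * if s < r then -1 else 1 := by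
  unfold classicalSign
  split_ifs with hsr
  · have : (Finset.univ.filter fun x => x < r ∧ b x = true) =
        insert s (Finset.univ.filter fun x => x < r ∧ a x = true) := by
      ext x
      by_cases hx : x = s
      · subst hx; simp [h.tgt, hsr]
      · simp [hx, h.away x hx]
    rw [this, Finset.card_insert_of_notMem (by simp [h.src]), pow_succ]
  · have : (Finset.univ.filter fun x => x < r ∧ b x = true) =
        (Finset.univ.filter fun x => x < r ∧ a x = true) := by
      ext x
      by_cases hx : x = s
      · subst hx; simp [hsr]
      · simp [h.away x hx]
    rw [this, mul_one]

/-- Exactly one of the crossings precedes the other, so exactly one of the two signs changes across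
the face. -/
theorem classicalSign_face (F : IsFace a b c d r s) :
    (classicalSign a r * classicalSign b s) * (classicalSign a s * classicalSign c r) = -1 := by
  rw [classicalSign_of_isSaddle F.ab, classicalSign_of_isSaddle F.ac]
  have h : ∀ x y u v : ℤˣ, x * (y * u) * (y * (x * v)) = u * v := fun x y u v => by
    calc x * (y * u) * (y * (x * v)) = (x * x) * (y * y) * (u * v) := by ac_rfl
      _ = u * v := by rw [Int.units_mul_self, Int.units_mul_self, one_mul, one_mul]
  rw [h]
  rcases lt_or_gt_of_ne F.ne with h | h
  · rw [if_pos h, if_neg h.not_gt, mul_one]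
  · rw [if_neg h.not_gt, if_pos h, one_mul]

theorem classicalSaddle_eq (R : Type u) [CommRing R] (h : IsSaddle a b r) :
    classicalSaddle R h = ((classicalSign a r : ℤˣ) : ℤ) • saddle R h := by
  rw [classicalSaddle, classicalSign]
  push_cast
  rfl

/-- Both sign systems have product `-1` around every face, so their product is a multiplicative
cocycle on the cube. -/
theorem SourceSink.exists_sign_comparison (o : L.SourceSink) (hL : L.IsClassical) (ch : L.Choices) :
    ∃ t : L.State → ℤˣ, ∀ a b r (h : IsSaddle a b r),
      o.virtualSign ch h * classicalSign a r = t a * t b := by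
  classical
  obtain ⟨t, ht⟩ := exists_sign_potential (n := L.n) (fun a r =>
    if h : IsSaddle a (Function.update a r true) r then
      o.virtualSign ch h * classicalSign a r else 1) fun a r s hrs hr hs => by
    have F := isFace_update hrs hr hs
    have e : Function.update (Function.update a r true) s true =
      Function.update (Function.update a s true) r true := Function.update_comm hrs _ _ _
    have cd := F.cd
    rw [e] at cd
    rw [dif_pos F.ab, dif_pos F.ac, dif_pos F.bd, dif_pos cd]
    -- The two saddles differ only in the way the far corner of the face is written.
    have e' : o.virtualSign ch cd = o.virtualSign ch F.cd := by
      congr 1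
      exact e.symm
    -- The sign statement does not involve the coefficient ring, so `ℤ` serves as well as any other.
    have h1 := (o.faceRelation ℤ ch hL F).2
    have h2 := classicalSign_face F
    rw [e', ← mul_inv_eq_one, Int.units_inv_eq_self]
    calc _ = (o.virtualSign ch F.ab * o.virtualSign ch F.bd *
          (o.virtualSign ch F.ac * o.virtualSign ch F.cd)) *
          (classicalSign a r * classicalSign (Function.update a r true) s *
            (classicalSign a s * classicalSign (Function.update a s true) r)) := by ac_rfl
      _ = 1 := by rw [h1, h2]; rfl
  refine ⟨t, fun a b r h => ?_⟩
  obtain ⟨hr, rfl⟩ := isSaddle_iff.1 h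
  rw [← ht a r hr, dif_pos h]

end VLinkDiagram

/-! ## The complexes -/

section Additive

variable {R : Type u} [CommRing R] {A B C : Type}

/-- Composition of cobordisms as a biadditive map. -/
def Cob.compHom [Finite B] : Cob R A B →+ Cob R B C →+ Cob R A C :=
  AddMonoidHom.mk' (fun f => AddMonoidHom.mk' (fun g => f.comp g) (by
    rintro ⟨g⟩ ⟨g'⟩
    obtain ⟨f⟩ := f
    exact Quotient.sound (CobRel.comp_add f g g'))) (by
    rintro ⟨f⟩ ⟨f'⟩
    ext ⟨g⟩
    exact Quotient.sound (CobRel.add_comp f f' g))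

variable [Finite B]

theorem Cob.zero_comp (g : Cob R B C) : (0 : Cob R A B).comp g = 0 :=
  DFunLike.congr_fun (map_zero (Cob.compHom (R := R) (A := A) (C := C))) g

theorem Cob.comp_zero (f : Cob R A B) : f.comp (0 : Cob R B C) = 0 := map_zero (Cob.compHom f)

theorem Cob.zsmul_comp (n : ℤ) (f : Cob R A B) (g : Cob R B C) :
    (n • f).comp g = n • f.comp g :=
  DFunLike.congr_fun (map_zsmul (Cob.compHom (R := R) (A := A) (C := C)) n f) g

theorem Cob.comp_zsmul (n : ℤ) (f : Cob R A B) (g : Cob R B C) :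
    f.comp (n • g) = n • f.comp g := map_zsmul (Cob.compHom f) n g

theorem Cob.comp_sum {I : Type} (S : Finset I) (f : Cob R A B) (g : I → Cob R B C) :
    f.comp (∑ i ∈ S, g i) = ∑ i ∈ S, f.comp (g i) := map_sum (Cob.compHom f) g S

theorem Cob.sum_comp {I : Type} (S : Finset I) (f : I → Cob R A B) (g : Cob R B C) :
    (∑ i ∈ S, f i).comp g = ∑ i ∈ S, (f i).comp g := by
  have := DFunLike.congr_fun (map_sum (Cob.compHom (R := R) (A := A) (C := C)) f S) g
  rwa [AddMonoidHom.finsetSum_apply] at this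

end Additive

namespace VLinkDiagram

/-! ### Diagonal isomorphisms and the differentials -/

variable {L : VLinkDiagram} (R : Type u) [CommRing R]

section Diagonal

variable {R}

open scoped Classical in
/-- The diagonal matrix of a family of endomorphisms. -/
def diag (g : ∀ a : L.State, Cob R (Circle a) (Circle a)) (ν μ : ∀ a : L.State, Numbering a)
    (i : ℤ) : L.chainModule R ν i ⟶ L.chainModule R μ i :=
  fun a b => (if h : a = b then (congrArg (fun c => Cob R (Circle a.1) (Circle c.1)) h).mp (g a.1)
    else 0 : Cob R (Circle a.1) (Circle b.1))

variable (g : ∀ a : L.State, Cob R (Circle a) (Circle a)) (ν μ : ∀ a : L.State, Numbering a) (i : ℤ)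

theorem diag_self (a : {a : L.State // (ones a : ℤ) - L.nMinus = i}) :
    diag g ν μ i a a = g a.1 := dif_pos rfl

theorem diag_of_ne {a b : {a : L.State // (ones a : ℤ) - L.nMinus = i}} (h : a ≠ b) :
    diag g ν μ i a b = (0 : Cob R (Circle a.1) (Circle b.1)) := dif_neg h

theorem diag_comp_apply {N : Mat_ (UCob R)} (f : L.chainModule R μ i ⟶ N) (a b) :
    (diag g ν μ i ≫ f) a b = Cob.comp (g a.1) (f a b) := by
  rw [Mat_.comp_apply]
  refine (Finset.sum_eq_single a (fun c _ hc => ?_) fun h => absurd (Finset.mem_univ a) h).trans ?_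
  · rw [diag_of_ne g ν μ i hc.symm]
    exact Cob.zero_comp _
  · exact congrArg (fun z => Cob.comp z (f a b)) (diag_self g ν μ i a)

theorem comp_diag_apply {N : Mat_ (UCob R)} (f : N ⟶ L.chainModule R ν i) (a b) :
    (f ≫ diag g ν μ i) a b = Cob.comp (f a b) (g b.1) := by
  rw [Mat_.comp_apply]
  refine (Finset.sum_eq_single b (fun c _ hc => ?_) fun h => absurd (Finset.mem_univ b) h).trans ?_
  · rw [diag_of_ne g ν μ i hc]
    exact Cob.comp_zero _
  · exact congrArg (Cob.comp (f a b)) (diag_self g ν μ i b)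

theorem diag_comp_diag (hg : ∀ a, (g a).comp (g a) = Cob.perm (Equiv.refl _)) :
    diag g ν μ i ≫ diag g μ ν i = 𝟙 _ := by
  refine Mat_.hom_ext _ _ fun a b => ?_
  rw [diag_comp_apply]
  by_cases h : a = b
  · subst h
    rw [Mat_.id_apply_self]
    exact (congrArg (Cob.comp (g a.1)) (diag_self g μ ν i a)).trans (hg a.1)
  · rw [diag_of_ne g μ ν i h, Mat_.id_apply_of_ne _ _ _ h]
    exact Cob.comp_zero _

/-- A diagonal matrix of involutions is an isomorphism. -/
def diagIso (hg : ∀ a, (g a).comp (g a) = Cob.perm (Equiv.refl _)) :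
    L.chainModule R ν i ≅ L.chainModule R μ i :=
  ⟨diag g ν μ i, diag g μ ν i, diag_comp_diag g ν μ i hg, diag_comp_diag g μ ν i hg⟩

end Diagonal

namespace SourceSink

variable (o : L.SourceSink) (hL : L.IsClassical)

/-- The local change of basis relating the two complexes. -/
def change (ch : L.Choices) (t : L.State → ℤˣ) (a : L.State) : Cob R (Circle a) (Circle a) :=
  ((t a : ℤˣ) : ℤ) • Cob.cyl (Equiv.refl _) (o.reversed hL (ch.orient a))

theorem cyl_comp_self {A : Type} [Finite A] (w : A → Bool) :
    (Cob.cyl (Equiv.refl A) w : Cob R A A).comp (Cob.cyl (Equiv.refl A) w) =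
      Cob.perm (Equiv.refl A) := by
  rw [Cob.cyl_comp]
  simp only [Equiv.refl_apply, Bool.xor_self]
  rfl

theorem change_comp_change (ch : L.Choices) (t : L.State → ℤˣ) (a : L.State) :
    (o.change R hL ch t a).comp (o.change R hL ch t a) = Cob.perm (Equiv.refl _) := by
  rw [change, Cob.zsmul_comp, Cob.comp_zsmul, cyl_comp_self, smul_smul, ← Units.val_mul,
    Int.units_mul_self, Units.val_one, one_smul]

/-- The reversing cylinders at `b` cancel those below the saddle, leaving those at `a`. The signs
match because `t` has the prescribed coboundary. -/
theorem decoratedSaddle_comp_change (ch : L.Choices) {t : L.State → ℤˣ} {a b : L.State}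
    {r : Fin L.n} (h : IsSaddle a b r) (ht : o.virtualSign ch h * classicalSign a r = t a * t b) :
    (decoratedSaddle R ch h).comp (o.change R hL ch t b) =
      (o.change R hL ch t a).comp (classicalSaddle R h) := by
  rw [o.decoratedSaddle_eq hL, change, change, classicalSaddle_eq, Cob.zsmul_comp, Cob.comp_zsmul,
    Cob.zsmul_comp, Cob.comp_zsmul, Cob.comp_assoc, Cob.comp_assoc, cyl_comp_self,
    Cob.comp_perm_refl, smul_smul, smul_smul, ← Units.val_mul, ← Units.val_mul]
  congr 2
  have e : ∀ v k x y : ℤˣ, v * k = x * y → v * y = x * k := by decide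
  exact e _ _ _ _ ht

theorem virtualD_comp_diag (ch : L.Choices) (ν : ∀ a : L.State, Numbering a) {t : L.State → ℤˣ}
    (ht : ∀ a b r (h : IsSaddle a b r), o.virtualSign ch h * classicalSign a r = t a * t b)
    (i : ℤ) : L.virtualD R ch i ≫ diag (o.change R hL ch t) ch.number ν (i + 1) =
      diag (o.change R hL ch t) ch.number ν i ≫ L.classicalD R ν i := by
  refine Mat_.hom_ext _ _ fun a b => ?_
  rw [diag_comp_apply, comp_diag_apply]
  unfold virtualD classicalD
  refine (Cob.sum_comp _ _ _).trans (Eq.trans ?_ (Cob.comp_sum _ _ _).symm)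
  refine Finset.sum_congr rfl fun r _ => ?_
  by_cases h : IsSaddle a.1 b.1 r
  · rw [dif_pos h, dif_pos h]
    exact o.decoratedSaddle_comp_change R hL ch h (ht _ _ _ h)
  · rw [dif_neg h, dif_neg h]
    exact (Cob.zero_comp _).trans (Cob.comp_zero _).symm

theorem classicalSaddle_comp (o : L.SourceSink) (hL : L.IsClassical) (ch : L.Choices)
    {a b c d : L.State} {r s : Fin L.n}
    (F : IsFace a b c d r s) : (classicalSaddle R F.ab).comp (classicalSaddle R F.bd) +
      (classicalSaddle R F.ac).comp (classicalSaddle R F.cd) = 0 := by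
  have h1 := classicalSign_face F
  simp only [classicalSaddle_eq, Cob.zsmul_comp, Cob.comp_zsmul, smul_smul, ← Units.val_mul]
  have e : ∀ v k x y : ℤˣ, v * k * (x * y) = -1 → k * v = -(y * x) := by decide
  rw [e _ _ _ _ h1, (o.faceRelation R ch hL F).1, Units.val_neg, neg_smul, neg_add_cancel]

open scoped Classical in
theorem classicalD_comp_classicalD (o : L.SourceSink) (hL : L.IsClassical) (ch : L.Choices)
    (ν : ∀ a : L.State, Numbering a) (i : ℤ) :
    L.classicalD R ν i ≫ L.classicalD R ν (i + 1) = 0 := by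
  refine Mat_.hom_ext _ _ fun a d => ?_
  rw [Mat_.comp_apply]
  let E : ∀ a b : L.State, Fin L.n → Cob R (Circle a) (Circle b) := fun a b r =>
    if h : IsSaddle a b r then classicalSaddle R h else 0
  let I : Type := {a : L.State // (ones a : ℤ) - L.nMinus = i + 1}
  let : Fintype I := Fintype.ofFinite _
  -- Contribution of the paths from `a` to `d` that change `r` and afterwards `s`. At most one
  -- intermediate state contributes.
  let G : Fin L.n × Fin L.n → Cob R (Circle a.1) (Circle d.1) := fun p =>
    ∑ b : I, (E a.1 b.1 p.1).comp (E b.1 d.1 p.2)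
  have hG : ∀ {b r s} (h : IsSaddle a.1 b r) (h' : IsSaddle b d.1 s),
      G (r, s) = (classicalSaddle R h).comp (classicalSaddle R h') := by
    intro b r s h h'
    have hb : (ones b : ℤ) - L.nMinus = i + 1 := by
      have := a.2
      rw [ones_of_isSaddle h]
      push_cast
      linarith
    refine (Finset.sum_eq_single (⟨b, hb⟩ : I) (fun c _ hc => ?_)
      fun h => absurd (Finset.mem_univ _) h).trans ?_
    · have : ¬ IsSaddle a.1 c.1 r := fun h1 =>
        hc (Subtype.ext ((isSaddle_iff.1 h1).2.trans (isSaddle_iff.1 h).2.symm))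
      simp only [E]
      rw [dif_neg this, Cob.zero_comp]
    · simp only [E]
      rw [dif_pos h, dif_pos h']
  have hG0 : ∀ {r s}, (∀ b, IsSaddle a.1 b r → ¬ IsSaddle b d.1 s) → G (r, s) = 0 := by
    intro r s h
    refine Finset.sum_eq_zero fun b _ => ?_
    by_cases h1 : IsSaddle a.1 b.1 r
    · simp only [E]
      rw [dif_neg (h _ h1), Cob.comp_zero]
    · simp only [E]
      rw [dif_neg h1, Cob.zero_comp]
  have key : ∀ r s, G (r, s) + G (s, r) = 0 := by
    intro r s
    by_cases h : ∃ b, IsSaddle a.1 b r ∧ IsSaddle b d.1 s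
    · obtain ⟨b, h, h'⟩ := h
      obtain ⟨c, F⟩ := h.face h'
      rw [hG F.ab F.bd, hG F.ac F.cd]
      exact o.classicalSaddle_comp R hL ch F
    · push Not at h
      rw [hG0 h, hG0, add_zero]
      intro c h1 h2
      obtain ⟨b, F⟩ := h1.face h2
      exact h b F.ac F.cd
  have e : ∑ p, G p = 0 := by
    refine Finset.sum_involution (fun p _ => p.swap) (fun p _ => key p.1 p.2) ?_
      (fun _ _ => Finset.mem_univ _) fun _ _ => rfl
    rintro ⟨r, s⟩ - hp e
    -- A fixed point of the involution would change the same crossing twice, so its term is zero.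
    obtain rfl : s = r := congrArg Prod.fst e
    refine hp (hG0 fun b h h' => ?_)
    exact Bool.noConfusion (h'.src.symm.trans h.tgt)
  refine Eq.trans ?_ e
  rw [Finset.sum_comm]
  refine Finset.sum_congr rfl fun b _ => ?_
  refine (Cob.sum_comp Finset.univ (E a.1 b.1) (∑ s, E b.1 d.1 s)).trans ?_
  rw [Fintype.sum_prod_type]
  exact Finset.sum_congr rfl fun r _ => Cob.comp_sum _ _ _

end SourceSink
end VLinkDiagram

end VKh

end

theorem mainTheorem3 {R : Type*} [CommRing R] (L : VKh.VLinkDiagram) (hL : L.IsClassical)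
    (ch : L.Choices) (ν : ∀ a : L.State, VKh.VLinkDiagram.Numbering a) :
    ∃ (hv : ∀ i, L.virtualD R ch i ≫ L.virtualD R ch (i + 1) = 0)
      (hc : ∀ i, L.classicalD R ν i ≫ L.classicalD R ν (i + 1) = 0),
      Nonempty (L.virtualComplex R ch hv ≅ L.classicalComplex R ν hc) := by
  obtain ⟨out, h1, h2⟩ := L.exists_sourceSink
  let o : L.SourceSink := ⟨out, h1, h2⟩
  obtain ⟨t, ht⟩ := o.exists_sign_comparison hL ch
  have hc : ∀ i, L.classicalD R ν i ≫ L.classicalD R ν (i + 1) = 0 :=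
    o.classicalD_comp_classicalD R hL ch ν
  let T : ∀ i, L.chainModule R ch.number i ≅ L.chainModule R ν i := fun i =>
    VKh.VLinkDiagram.diagIso (o.change R hL ch t) ch.number ν i (o.change_comp_change R hL ch t)
  have comm : ∀ i, L.virtualD R ch i ≫ (T (i + 1)).hom = (T i).hom ≫ L.classicalD R ν i :=
    o.virtualD_comp_diag R hL ch ν ht
  have hv : ∀ i, L.virtualD R ch i ≫ L.virtualD R ch (i + 1) = 0 := fun i => by
    -- The isomorphisms `T` intertwine the differentials, so the virtual one inherits square zero
    -- from the classical one.
    rw [← cancel_mono (T (i + 1 + 1)).hom, Category.assoc, comm, ← Category.assoc, comm,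
      Category.assoc, hc, Limits.comp_zero, Limits.zero_comp]
  refine ⟨hv, hc, ⟨HomologicalComplex.Hom.isoOfComponents T ?_⟩⟩
  rintro i _ rfl
  refine Eq.trans ?_ ((comm i).symm.trans ?_)
  · exact congrArg ((T i).hom ≫ ·) (CochainComplex.of_d _ _ i)
  · exact congrArg (· ≫ (T (i + 1)).hom) (CochainComplex.of_d _ _ i).symm
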